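/- Let $M$ be a free $\mathbb{Z}$-module of finite rank $n$, $N=\mathrm{Hom}(M,\mathbb{Z})$, $N_{\mathbb{R}}=N\otimes\mathbb{R}$, and let $M'\subset N_{\mathbb{R}}$ be a lattice of full rank $n$. The quotient $X=N_{\mathbb{R}}/M'$ is a real torus with integral structure $N$; it is a rational polyhedral space whose charts are local inverses of $N_{\mathbb{R}}\to X$ composed with the coordinates with respect to $\mathbb{Z}$-bases of $N$. The following are equivalent. (i) $X$ is a tropical abelian variety, i.e. it has a polarization: a homomorphism $\lambda\colon M'\to M$ for which there is a positive-definite symmetric $\mathbb{R}$-bilinear form $Q$ on $N_{\mathbb{R}}$ with $Q(u',v)=\langle\lambda(u'),v\rangle$ for all $u'\in M'$, $v\in N$. (ii) There is a tropical line bundle $L$ on $X$ that admits a faithful embedding, i.e. there are $m\ge 0$ and $s_0,\dots,s_m\in H^0(X,L)\setminus\{+\infty\}$ such that $\varphi_{s_0,\dots,s_m}\colon X\to\mathbb{TP}^m$, $x\mapsto(s_0(x):\cdots:s_m(x))$, is unimodular and a homeomorphism onto its image. (iii) There are a tropical line bundle $L$ on $X$, an integer $m\ge 0$ and sections $s_0,\dots,s_m\in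 H^0(X,L)\setminus\{+\infty\}$ such that $\varphi_{s_0,\dots,s_m}\colon X\to\mathbb{TP}^m$ is injective. Here $\mathbb{T}=\mathbb{R}\cup\{+\infty\}$ with its Euclidean topology, and $\mathbb{TP}^m=(\mathbb{T}^{m+1}\setminus\{(+\infty,\dots,+\infty)\})/\mathbb{R}$, with $c\in\mathbb{R}$ acting by adding $c$ to all coordinates. A tropical line bundle on $X$ is a continuous map $L\to X$ with local trivializations $L|_{X_i}\cong X_i\times\mathbb{T}$ over the charts of an atlas of $X$, whose transition maps are $(x,a)\mapsto(x,a+t_{ij}(x))$ with $t_{ij}$ real-valued and, in the coordinates of the charts, locally of the form $y\mapsto\langle k,y\rangle+b$ with $k$ integral and $b$ real. $H^0(X,L)$ is the set of regular sections: $+\infty$ is the section equal to $+\infty$ everywhere, and the other regular sections are real-valued and, in every trivialization, locally concave and locally piecewise $\mathbb{Z}$-affine (piecewise affine with integral linear parts). The map $\varphi_{s_0,\dots,s_m}$ has image in the maximal tropical torus $\mathbb{R}^{m+1}/\mathbb{R}(1,\dots,1)$, identified with $\mathbb{R}^m$ by $(a_1,\dots,a_m)\mapsto(0:a_1:\cdots:a_m)$.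 A map $\varphi\colon X\to\mathbb{R}^m$ is unimodular if, for some atlas of $X$, in each chart with image $U\subset\mathbb{R}^r$ there is a rational polyhedral complex whose support contains $U$ as an open subset and such that on $\sigma\cap U$, for every cell $\sigma$, $\varphi$ agrees with an affine map $x\mapsto Ax+b$, where $b\in\mathbb{R}^m$ and $A$ is an integral $m\times r$ matrix of rank $r$ with $\mathbb{Z}^m/A\mathbb{Z}^r$ torsion-free. -/

import Mathlib

open Set Topology

universe u

/-! ## Rational polyhedral geometry in `ℝⁿ` -/

/-- The solution set of the finite system of inequalities `⟨x, v i⟩ ≥ b i`. -/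
def polyhedron {n k : ℕ} (v : Fin k → Fin n → ℝ) (b : Fin k → ℝ) : Set (Fin n → ℝ) :=
  {x | ∀ i, b i ≤ v i ⬝ᵥ x}

def IsPolyhedron {n : ℕ} (σ : Set (Fin n → ℝ)) : Prop :=
  ∃ (k : ℕ) (v : Fin k → Fin n → ℝ) (b : Fin k → ℝ), σ = polyhedron v b

/-- A polyhedron that can be defined by integral normal vectors and real constants. -/
def IsRationalPolyhedron {n : ℕ} (σ : Set (Fin n → ℝ)) : Prop :=
  ∃ (k : ℕ) (v : Fin k → Fin n → ℤ) (b : Fin k → ℝ),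
    σ = polyhedron (fun i j => (v i j : ℝ)) b

/-- `τ` arises from a defining system of `σ` by turning some inequalities into equalities. -/
def IsFace {n : ℕ} (τ σ : Set (Fin n → ℝ)) : Prop :=
  ∃ (k : ℕ) (v : Fin k → Fin n → ℝ) (b : Fin k → ℝ) (J : Set (Fin k)),
    σ = polyhedron v b ∧ τ = {x | x ∈ σ ∧ ∀ i ∈ J, v i ⬝ᵥ x = b i}

structure IsPolyhedralComplex {n : ℕ} (C : Set (Set (Fin n → ℝ))) : Prop where
  polyhedron : ∀ σ ∈ C, IsPolyhedron σ
  locallyFinite : LocallyFinite (fun σ : C => (σ : Set (Fin n → ℝ)))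
  face_mem : ∀ σ ∈ C, ∀ τ, IsFace τ σ → τ ∈ C
  inter : ∀ σ ∈ C, ∀ σ' ∈ C, (σ ∩ σ').Nonempty → IsFace (σ ∩ σ') σ ∧ IsFace (σ ∩ σ') σ'

structure IsRationalPolyhedralComplex {n : ℕ} (C : Set (Set (Fin n → ℝ))) : Prop
    extends IsPolyhedralComplex C where
  rational : ∀ σ ∈ C, IsRationalPolyhedron σ

/-- `U` is an open subset of the topological space `S ⊆ ℝⁿ`. -/
def IsOpenIn {n : ℕ} (U S : Set (Fin n → ℝ)) : Prop :=
  ∃ W : Set (Fin n → ℝ), IsOpen W ∧ U = W ∩ S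

/-- Open subsets of supports `|C| = ⋃₀ C` of rational polyhedral complexes. -/
def IsOpenRationalPolyhedralSet {n : ℕ} (U : Set (Fin n → ℝ)) : Prop :=
  ∃ C : Set (Set (Fin n → ℝ)), IsRationalPolyhedralComplex C ∧ IsOpenIn U (⋃₀ C)

/-- The affine map `x ↦ A x + b` with integral linear part. -/
def zAffine {m n : ℕ} (A : Matrix (Fin n) (Fin m) ℤ) (b : Fin n → ℝ) :
    (Fin m → ℝ) → (Fin n → ℝ) :=
  fun x => (A.map (fun z : ℤ => (z : ℝ))).mulVec x + b

def IsZAffine {m n : ℕ} (F : (Fin m → ℝ) → (Fin n → ℝ)) : Prop :=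
  ∃ (A : Matrix (Fin n) (Fin m) ℤ) (b : Fin n → ℝ), F = zAffine A b

/-- A `ℤ`-affine map `ℝᵐ → ℝⁿ` is unimodular if its linear part `A : ℤᵐ → ℤⁿ` has rank `m` and
the cokernel `ℤⁿ / A ℤᵐ` is torsion-free. -/
def IsUnimodularZAffine {m n : ℕ} (F : (Fin m → ℝ) → (Fin n → ℝ)) : Prop :=
  ∃ (A : Matrix (Fin n) (Fin m) ℤ) (b : Fin n → ℝ), F = zAffine A b ∧ A.rank = m ∧
    Module.IsTorsionFree ℤ ((Fin n → ℤ) ⧸ LinearMap.range A.mulVecLin)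

/-- Locally on `U`, the map agrees with a `ℤ`-affine map. -/
def IsTropicalMorphismOn {m n : ℕ} (φ : (Fin m → ℝ) → (Fin n → ℝ)) (U : Set (Fin m → ℝ)) : Prop :=
  ∀ p ∈ U, ∃ W : Set (Fin m → ℝ), IsOpen W ∧ p ∈ W ∧
    ∃ F : (Fin m → ℝ) → (Fin n → ℝ), IsZAffine F ∧ EqOn φ F (W ∩ U)

/-- Real-valued tropical morphisms, the target `ℝ` being regarded as `ℝ¹`. -/
def IsTropicalFunctionOn {m : ℕ} (f : (Fin m → ℝ) → ℝ) (U : Set (Fin m → ℝ)) : Prop :=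
  IsTropicalMorphismOn (fun x (_ : Fin 1) => f x) U

/-- Piecewise `ℤ`-affine functions on the whole of `ℝᵐ`. -/
def IsPiecewiseZAffine {m : ℕ} (f : (Fin m → ℝ) → ℝ) : Prop :=
  ∃ C : Set (Set (Fin m → ℝ)), IsPolyhedralComplex C ∧ ⋃₀ C = univ ∧
    ∀ σ ∈ C, ∃ F : (Fin m → ℝ) → (Fin 1 → ℝ), IsZAffine F ∧ ∀ x ∈ σ, f x = F x 0

/-- (Locally) piecewise `ℤ`-affine functions on an open rational polyhedral set `U`. -/
def IsPiecewiseZAffineOn {m : ℕ} (f : (Fin m → ℝ) → ℝ) (U : Set (Fin m → ℝ)) : Prop :=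
  ∀ p ∈ U, ∃ W : Set (Fin m → ℝ), IsOpen W ∧ p ∈ W ∧
    ∃ F : (Fin m → ℝ) → ℝ, IsPiecewiseZAffine F ∧ EqOn f F (W ∩ U)

/-- (Locally) concave functions on an open rational polyhedral set `U`. -/
def IsTropicallyConcaveOn {m : ℕ} (f : (Fin m → ℝ) → ℝ) (U : Set (Fin m → ℝ)) : Prop :=
  ∀ p ∈ U, ∃ W : Set (Fin m → ℝ), IsOpen W ∧ p ∈ W ∧
    ∃ V : Set (Fin m → ℝ), W ∩ U ⊆ V ∧
      ∃ F : (Fin m → ℝ) → ℝ, ConcaveOn ℝ V F ∧ EqOn f F (W ∩ U)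

/-- Unimodularity of a map from an open rational polyhedral set `U ⊆ ℝᵐ` to `ℝⁿ`. -/
def IsUnimodularOn {m n : ℕ} (φ : (Fin m → ℝ) → (Fin n → ℝ)) (U : Set (Fin m → ℝ)) : Prop :=
  ∃ C : Set (Set (Fin m → ℝ)), IsRationalPolyhedralComplex C ∧ IsOpenIn U (⋃₀ C) ∧
    ∀ σ ∈ C, ∃ F : (Fin m → ℝ) → (Fin n → ℝ), IsUnimodularZAffine F ∧ EqOn φ F (σ ∩ U)

/-! ## Rational polyhedral spaces -/

/-- A homeomorphism from an open subset of `X` onto an open rational polyhedral set in `ℝⁿ`. -/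
structure PolyhedralChart (X : Type u) [TopologicalSpace X] where
  dim : ℕ
  map : PartialEquiv X (Fin dim → ℝ)
  isOpen_source : IsOpen map.source
  continuousOn_map : ContinuousOn map map.source
  continuousOn_symm : ContinuousOn map.symm map.target
  target_polyhedral : IsOpenRationalPolyhedralSet map.target

/-- A set of charts covering `X` all of whose transition maps are tropical morphisms. -/
structure IsPolyhedralAtlas {X : Type u} [TopologicalSpace X] (A : Set (PolyhedralChart X)) :
    Prop where
  cover : ∀ x, ∃ c ∈ A, x ∈ c.map.source
  transition : ∀ c ∈ A, ∀ c' ∈ A, IsTropicalMorphismOn (c.map ∘ c'.map.symm)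
    (c'.map '' (c.map.source ∩ c'.map.source))

/-- A rational polyhedral space, given by one atlas in its equivalence class. -/
class RationalPolyhedralSpace (X : Type u) [TopologicalSpace X] extends T2Space X where
  refAtlas : Set (PolyhedralChart X)
  isAtlas_refAtlas : IsPolyhedralAtlas refAtlas

/-- `A` is an atlas of the rational polyhedral space `X`, that is, an atlas equivalent to the
reference atlas of `X`. -/
def IsAtlasOf (X : Type u) [TopologicalSpace X] [RationalPolyhedralSpace X]
    (A : Set (PolyhedralChart X)) : Prop :=
  IsPolyhedralAtlas A ∧ IsPolyhedralAtlas (A ∪ RationalPolyhedralSpace.refAtlas)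

/-- Unimodularity of a map from a rational polyhedral space to `ℝⁿ`. -/
def IsUnimodularMap {X : Type u} [TopologicalSpace X] [RationalPolyhedralSpace X] {n : ℕ}
    (ψ : X → (Fin n → ℝ)) : Prop :=
  ∃ A : Set (PolyhedralChart X), IsAtlasOf X A ∧
    ∀ c ∈ A, IsUnimodularOn (ψ ∘ c.map.symm) c.map.target

/-! ## Tropical projective space -/

/-- The tropical semifield `ℝ ∪ {+∞}` with its Euclidean (order) topology; tropical
multiplication is `+`. -/
abbrev TropNum : Type := WithTop ℝ

instance tropProjSetoid (m : ℕ) : Setoid {a : Fin (m + 1) → TropNum // ∃ i, a i ≠ ⊤} where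
  r a b := ∃ c : ℝ, ∀ i, b.1 i = (c : TropNum) + a.1 i
  iseqv := by
    refine ⟨fun a => ⟨0, fun i => by simp⟩, ?_, ?_⟩
    · rintro a b ⟨c, h⟩
      refine ⟨-c, fun i => ?_⟩
      rw [h i, ← add_assoc, ← WithTop.coe_add]
      simp
    · rintro a b d ⟨c, h⟩ ⟨c', h'⟩
      refine ⟨c' + c, fun i => ?_⟩
      rw [h' i, h i, ← add_assoc, ← WithTop.coe_add]

/-- The tropical projective space `𝕋ℙᵐ`. -/
def TropicalProjectiveSpace (m : ℕ) : Type := Quotient (tropProjSetoid m)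

instance (m : ℕ) : TopologicalSpace (TropicalProjectiveSpace m) :=
  inferInstanceAs (TopologicalSpace (Quotient (tropProjSetoid m)))

/-- The point `(a 0 : ⋯ : a m)`. -/
def TropicalProjectiveSpace.mk {m : ℕ} (a : Fin (m + 1) → TropNum) (h : ∃ i, a i ≠ ⊤) :
    TropicalProjectiveSpace m :=
  Quotient.mk (tropProjSetoid m) ⟨a, h⟩

/-- The identification `a ↦ (0 : a 0 : ⋯ : a (m-1))` of `ℝᵐ` with the maximal tropical torus. -/
def TropicalProjectiveSpace.ofAffine {m : ℕ} (a : Fin m → ℝ) : TropicalProjectiveSpace m :=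
  TropicalProjectiveSpace.mk
    (Fin.cons ((0 : ℝ) : TropNum) (fun i => ((a i : ℝ) : TropNum)) : Fin (m + 1) → TropNum)
    ⟨0, by simp⟩

/-- Unimodularity of a map to `𝕋ℙᵐ`; it includes the requirement that the image lies in the
maximal tropical torus, which is identified with `ℝᵐ`. -/
def IsUnimodularToTP {X : Type u} [TopologicalSpace X] [RationalPolyhedralSpace X] {m : ℕ}
    (φ : X → TropicalProjectiveSpace m) : Prop :=
  ∃ ψ : X → (Fin m → ℝ), (∀ x, φ x = TropicalProjectiveSpace.ofAffine (ψ x)) ∧ IsUnimodularMap ψ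

/-- A unimodular map that is a homeomorphism onto its image. -/
def IsFaithfulEmbedding {X : Type u} [TopologicalSpace X] [RationalPolyhedralSpace X] {m : ℕ}
    (φ : X → TropicalProjectiveSpace m) : Prop :=
  IsUnimodularToTP φ ∧ IsEmbedding φ

/-! ## Tropical line bundles and regular sections -/

/-- A chart of `X` together with a trivialization `π⁻¹(X_i) ≃ₜ X_i × 𝕋` over its domain. -/
structure LineBundleChart {X E : Type u} [TopologicalSpace X] [TopologicalSpace E]
    (proj : E → X) where
  chart : PolyhedralChart X
  triv : Bundle.Trivialization TropNum proj
  baseSet_eq : triv.baseSet = chart.map.source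

/-- A tropical line bundle on `X`, given by one atlas in its equivalence class. -/
structure TropicalLineBundle (X : Type u) [TopologicalSpace X] [RationalPolyhedralSpace X] where
  Total : Type u
  topTotal : TopologicalSpace Total
  proj : Total → X
  continuous_proj : Continuous proj
  atlas : Set (LineBundleChart proj)
  isAtlas : IsAtlasOf X (LineBundleChart.chart '' atlas)
  transition : ∀ c ∈ atlas, ∀ c' ∈ atlas,
    (c.chart.map.source ∩ c'.chart.map.source).Nonempty →
    ∃ t : (Fin c'.chart.dim → ℝ) → ℝ,
      IsTropicalFunctionOn t (c'.chart.map '' (c.chart.map.source ∩ c'.chart.map.source)) ∧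
      ∀ x ∈ c.chart.map.source ∩ c'.chart.map.source, ∀ a : TropNum,
        c.triv (c'.triv.toOpenPartialHomeomorph.symm (x, a)) =
          (x, a + (t (c'.chart.map x) : TropNum))

namespace TropicalLineBundle

instance {X : Type u} [TopologicalSpace X] [RationalPolyhedralSpace X]
    (L : TropicalLineBundle X) : TopologicalSpace L.Total := L.topTotal

/-- The section `s` in a chart, as the function `pr₂ ∘ β ∘ s ∘ α⁻¹` with values in `𝕋`. -/
def inChart {X : Type u} [TopologicalSpace X] [RationalPolyhedralSpace X]
    (L : TropicalLineBundle X) (s : X → L.Total) (c : LineBundleChart L.proj) :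
    (Fin c.chart.dim → ℝ) → TropNum :=
  fun y => (c.triv (s (c.chart.map.symm y))).2

def IsInfiniteSection {X : Type u} [TopologicalSpace X] [RationalPolyhedralSpace X]
    (L : TropicalLineBundle X) (s : X → L.Total) : Prop :=
  ∀ c ∈ L.atlas, ∀ y ∈ c.chart.map.target, L.inChart s c y = ⊤

def IsFiniteRegularSection {X : Type u} [TopologicalSpace X] [RationalPolyhedralSpace X]
    (L : TropicalLineBundle X) (s : X → L.Total) : Prop :=
  ∀ c ∈ L.atlas, ∃ f : (Fin c.chart.dim → ℝ) → ℝ,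
    (∀ y ∈ c.chart.map.target, L.inChart s c y = (f y : TropNum)) ∧
    IsTropicallyConcaveOn f c.chart.map.target ∧ IsPiecewiseZAffineOn f c.chart.map.target

/-- The set `H⁰(X, L)` of regular global sections. -/
def regularSections {X : Type u} [TopologicalSpace X] [RationalPolyhedralSpace X]
    (L : TropicalLineBundle X) : Set (X → L.Total) :=
  {s | (∀ x, L.proj (s x) = x) ∧ (L.IsInfiniteSection s ∨ L.IsFiniteRegularSection s)}

/-- The set `H⁰(X, L) \ {+∞}`. -/
def nontrivialRegularSections {X : Type u} [TopologicalSpace X] [RationalPolyhedralSpace X]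
    (L : TropicalLineBundle X) : Set (X → L.Total) :=
  {s | s ∈ L.regularSections ∧ ¬ L.IsInfiniteSection s}

theorem exists_chart {X : Type u} [TopologicalSpace X] [RationalPolyhedralSpace X]
    (L : TropicalLineBundle X) (x : X) : ∃ c ∈ L.atlas, x ∈ c.chart.map.source := by
  obtain ⟨_, ⟨c, hc, rfl⟩, hx⟩ := L.isAtlas.1.cover x
  exact ⟨c, hc, hx⟩

theorem value_ne_top {X : Type u} [TopologicalSpace X] [RationalPolyhedralSpace X]
    (L : TropicalLineBundle X) {s : X → L.Total} (hs : s ∈ L.nontrivialRegularSections)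
    {c : LineBundleChart L.proj} (hc : c ∈ L.atlas) {x : X} (hx : x ∈ c.chart.map.source) :
    (c.triv (s x)).2 ≠ ⊤ := by
  obtain ⟨f, hf, -⟩ := (hs.1.2.resolve_left hs.2) c hc
  have h := hf _ (c.chart.map.map_source hx)
  rw [inChart, c.chart.map.left_inv hx] at h
  rw [h]
  exact WithTop.coe_ne_top

/-- The map `φ_{s₀,…,sₘ} : x ↦ (s₀(x) : ⋯ : sₘ(x))`, read in a chosen chart of the line bundle
around `x`. The point does not depend on the chart, see `toTP_eq`. -/
noncomputable def toTP {X : Type u} [TopologicalSpace X] [RationalPolyhedralSpace X]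
    (L : TropicalLineBundle X) {m : ℕ} (s : Fin (m + 1) → L.nontrivialRegularSections) :
    X → TropicalProjectiveSpace m :=
  fun x => TropicalProjectiveSpace.mk
    (fun k => ((L.exists_chart x).choose.triv ((s k).1 x)).2)
    ⟨0, L.value_ne_top (s 0).2 (L.exists_chart x).choose_spec.1 (L.exists_chart x).choose_spec.2⟩

theorem toTP_eq {X : Type u} [TopologicalSpace X] [RationalPolyhedralSpace X]
    (L : TropicalLineBundle X) {m : ℕ} (s : Fin (m + 1) → L.nontrivialRegularSections)
    {c : LineBundleChart L.proj} (hc : c ∈ L.atlas) {x : X} (hx : x ∈ c.chart.map.source) :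
    L.toTP s x = TropicalProjectiveSpace.mk (fun k => (c.triv ((s k).1 x)).2)
      ⟨0, L.value_ne_top (s 0).2 hc hx⟩ := by
  obtain ⟨hd, hxd⟩ := (L.exists_chart x).choose_spec
  unfold toTP
  set d := (L.exists_chart x).choose with hd_def
  obtain ⟨t, -, ht⟩ := L.transition c hc d hd ⟨x, hx, hxd⟩
  refine Quotient.sound ⟨t (d.chart.map x), fun k => ?_⟩
  have hp : L.proj ((s k).1 x) = x := (s k).2.1.1 x
  have hmem : (s k).1 x ∈ d.triv.source := by
    rw [d.triv.mem_source, hp, d.baseSet_eq]; exact hxd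
  have h1 : d.triv ((s k).1 x) = (x, (d.triv ((s k).1 x)).2) := by
    refine Prod.ext ?_ rfl
    rw [d.triv.coe_fst hmem, hp]
  have h2 : d.triv.toOpenPartialHomeomorph.symm (x, (d.triv ((s k).1 x)).2) = (s k).1 x := by
    rw [← h1]
    exact d.triv.toOpenPartialHomeomorph.left_inv hmem
  have h3 := ht x ⟨hx, hxd⟩ (d.triv ((s k).1 x)).2
  rw [h2] at h3
  show (c.triv ((s k).1 x)).2 = _ + (d.triv ((s k).1 x)).2
  rw [h3, add_comm]

def AdmitsFaithfulEmbedding {X : Type u} [TopologicalSpace X] [RationalPolyhedralSpace X]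
    (L : TropicalLineBundle X) : Prop :=
  ∃ (m : ℕ) (s : Fin (m + 1) → L.nontrivialRegularSections), IsFaithfulEmbedding (L.toTP s)

end TropicalLineBundle

/-! ## Real tori with integral structure -/

/-- The real torus `V / M'`. Here `V = N_ℝ`, and the lattice `N ⊆ V` is its integral structure. -/
def RealTorus {V : Type u} [NormedAddCommGroup V] [NormedSpace ℝ V] (_N M' : Submodule ℤ V) :
    Type u :=
  V ⧸ M'.toAddSubgroup

namespace RealTorus

instance {V : Type u} [NormedAddCommGroup V] [NormedSpace ℝ V] (N M' : Submodule ℤ V) :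
    AddCommGroup (RealTorus N M') :=
  inferInstanceAs (AddCommGroup (V ⧸ M'.toAddSubgroup))

instance {V : Type u} [NormedAddCommGroup V] [NormedSpace ℝ V] (N M' : Submodule ℤ V) :
    TopologicalSpace (RealTorus N M') :=
  inferInstanceAs (TopologicalSpace (V ⧸ M'.toAddSubgroup))

/-- The canonical surjection `V → V / M'`. -/
def mk {V : Type u} [NormedAddCommGroup V] [NormedSpace ℝ V] (N M' : Submodule ℤ V) :
    V → RealTorus N M' :=
  fun v => QuotientAddGroup.mk v

/-- The standard charts: local inverses of the covering `V → V / M'`, followed by the coordinates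
with respect to a `ℤ`-basis of `N`. -/
def IsStandardChart {V : Type u} [NormedAddCommGroup V] [NormedSpace ℝ V] [FiniteDimensional ℝ V]
    (N M' : Submodule ℤ V) [DiscreteTopology N] [IsZLattice ℝ N]
    (c : PolyhedralChart (RealTorus N M')) : Prop :=
  ∃ (b : Module.Basis (Fin c.dim) ℤ N) (W : Set V), IsOpen W ∧ InjOn (mk N M') W ∧
    c.map.source = mk N M' '' W ∧
    ∀ w ∈ W, c.map (mk N M' w) = (b.ofZLatticeBasis ℝ N).equivFun w

end RealTorus

theorem isRationalPolyhedralComplex_univ (n : ℕ) :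
    IsRationalPolyhedralComplex ({univ, ∅} : Set (Set (Fin n → ℝ))) := by
  have hR : ∀ σ ∈ ({univ, ∅} : Set (Set (Fin n → ℝ))), IsRationalPolyhedron σ := by
    rintro σ (rfl | rfl)
    · exact ⟨0, fun i => i.elim0, fun i => i.elim0, by ext x; simp [polyhedron]⟩
    · refine ⟨1, fun _ => 0, fun _ => 1, ?_⟩
      ext x
      simp [polyhedron, dotProduct]
  have hface : ∀ σ : Set (Fin n → ℝ), IsPolyhedron σ → IsFace σ σ := by
    rintro σ ⟨k, v, b, h⟩
    exact ⟨k, v, b, ∅, h, by simp⟩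
  have hP : ∀ σ ∈ ({univ, ∅} : Set (Set (Fin n → ℝ))), IsPolyhedron σ := fun σ hσ => by
    obtain ⟨k, v, b, h⟩ := hR σ hσ
    exact ⟨k, _, b, h⟩
  refine ⟨⟨hP, ?_, ?_, ?_⟩, hR⟩
  · have : Finite ({univ, ∅} : Set (Set (Fin n → ℝ))) := Set.Finite.to_subtype (by simp)
    exact locallyFinite_of_finite _
  · rintro σ (rfl | rfl) τ ⟨k, v, b, J, hσ, rfl⟩
    · have hv : ∀ i, v i = 0 := by
        intro i
        have h0 : ∀ x : Fin n → ℝ, b i ≤ v i ⬝ᵥ x := fun x => by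
          have : x ∈ polyhedron v b := hσ ▸ mem_univ x
          exact this i
        by_contra hne
        have hpos : 0 < v i ⬝ᵥ v i := by
          have h1 : 0 ≤ v i ⬝ᵥ v i := Finset.sum_nonneg fun j _ => mul_self_nonneg _
          exact lt_of_le_of_ne h1 fun h => hne (dotProduct_self_eq_zero.1 h.symm)
        have := h0 (((b i - 1) / (v i ⬝ᵥ v i)) • v i)
        rw [dotProduct_smul, smul_eq_mul, div_mul_cancel₀ _ hpos.ne'] at this
        linarith
      by_cases h : ∀ i ∈ J, 0 = b i
      · left
        ext x
        simpa [hv] using h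
      · right
        ext x
        simpa [hv] using h
    · right
      simp
  · rintro σ hσ σ' hσ' ⟨x, hx, hx'⟩
    obtain rfl : σ = univ := by
      rcases hσ with rfl | rfl
      · rfl
      · exact hx.elim
    obtain rfl : σ' = univ := by
      rcases hσ' with rfl | rfl
      · rfl
      · exact hx'.elim
    rw [univ_inter]
    exact ⟨hface _ (hP _ hσ), hface _ (hP _ hσ)⟩

theorem isOpenRationalPolyhedralSet_of_isOpen {n : ℕ} {U : Set (Fin n → ℝ)} (hU : IsOpen U) :
    IsOpenRationalPolyhedralSet U :=
  ⟨_, isRationalPolyhedralComplex_univ n, U, hU, by simp⟩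

namespace RealTorus

theorem mk_eq_mk_iff {V : Type u} [NormedAddCommGroup V] [NormedSpace ℝ V]
    (N M' : Submodule ℤ V) (v w : V) : mk N M' v = mk N M' w ↔ w - v ∈ M' := by
  have h : (QuotientAddGroup.mk v : V ⧸ M'.toAddSubgroup) = QuotientAddGroup.mk w ↔
      -v + w ∈ M'.toAddSubgroup := QuotientAddGroup.eq
  rw [neg_add_eq_sub] at h
  exact h

/-- The standard chart attached to a `ℤ`-basis of `N` and an open set on which `V → V / M'` is
injective. -/
theorem exists_standardChart {V : Type u} [NormedAddCommGroup V] [NormedSpace ℝ V]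
    [FiniteDimensional ℝ V] (N M' : Submodule ℤ V) [DiscreteTopology N] [IsZLattice ℝ N]
    {n : ℕ} (b : Module.Basis (Fin n) ℤ N) {W : Set V} (hW : IsOpen W)
    (hinj : InjOn (mk N M') W) :
    ∃ c : PolyhedralChart (RealTorus N M'), IsStandardChart N M' c ∧
      c.map.source = mk N M' '' W := by
  classical
  have hopen : IsOpenMap (mk N M') := QuotientAddGroup.isOpenMap_coe
  have hcont : Continuous (mk N M') := QuotientAddGroup.continuous_mk
  let e : V ≃L[ℝ] (Fin n → ℝ) := (b.ofZLatticeBasis ℝ N).equivFun.toContinuousLinearEquiv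
  let g : OpenPartialHomeomorph V (RealTorus N M') :=
    OpenPartialHomeomorph.ofContinuousOpenRestrict (hinj.toPartialEquiv (mk N M') W)
      hcont.continuousOn (hopen.domRestrict hW) hW
  let f : OpenPartialHomeomorph (RealTorus N M') (Fin n → ℝ) :=
    g.symm.trans e.toHomeomorph.toOpenPartialHomeomorph
  have hs : f.source = mk N M' '' W := by
    simp only [f, OpenPartialHomeomorph.trans_source, Homeomorph.toOpenPartialHomeomorph_source,
      preimage_univ, inter_univ]
    rfl
  refine ⟨⟨n, f.toPartialEquiv, f.open_source, f.continuousOn, f.continuousOn_symm,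
    isOpenRationalPolyhedralSet_of_isOpen f.open_target⟩,
    ⟨b, W, hW, hinj, hs, fun w hw => ?_⟩, hs⟩
  have : g.symm (mk N M' w) = w := g.left_inv (x := w) hw
  show e (g.symm (mk N M' w)) = _
  rw [this]
  rfl

/-- Near every point, `V → V / M'` is injective. -/
theorem exists_injOn {V : Type u} [NormedAddCommGroup V] [NormedSpace ℝ V]
    (N M' : Submodule ℤ V) [DiscreteTopology M'] (v : V) :
    ∃ W : Set V, IsOpen W ∧ v ∈ W ∧ InjOn (mk N M') W := by
  have h : {(0 : M')} ∈ 𝓝 (0 : M') := (isOpen_discrete _).mem_nhds rfl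
  rw [Metric.mem_nhds_iff] at h
  obtain ⟨ε, hε, hb⟩ := h
  refine ⟨Metric.ball v (ε / 2), Metric.isOpen_ball, Metric.mem_ball_self (half_pos hε), ?_⟩
  intro x hx y hy hxy
  rw [mk_eq_mk_iff] at hxy
  have hm : (⟨y - x, hxy⟩ : M') ∈ Metric.ball (0 : M') ε := by
    rw [mem_ball_zero_iff]
    show ‖y - x‖ < ε
    rw [← dist_eq_norm]
    calc dist y x ≤ dist y v + dist x v := dist_triangle_right _ _ _
      _ < ε / 2 + ε / 2 := add_lt_add hy hx
      _ = ε := add_halves ε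
  have := congrArg Subtype.val (hb hm)
  exact (sub_eq_zero.1 this).symm

theorem standardCharts_isAtlas {V : Type u} [NormedAddCommGroup V] [NormedSpace ℝ V]
    [FiniteDimensional ℝ V] (N M' : Submodule ℤ V) [DiscreteTopology N] [IsZLattice ℝ N]
    [DiscreteTopology M'] :
    IsPolyhedralAtlas {c : PolyhedralChart (RealTorus N M') | IsStandardChart N M' c} := by
  constructor
  · intro x
    obtain ⟨v, rfl⟩ : ∃ v, mk N M' v = x := QuotientAddGroup.mk_surjective x
    obtain ⟨W, hW, hv, hinj⟩ := exists_injOn N M' v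
    have : Module.Finite ℤ N := ZLattice.module_finite ℝ N
    have : Module.Free ℤ N := ZLattice.module_free ℝ N
    obtain ⟨c, hc, hs⟩ := exists_standardChart N M' (Module.finBasis ℤ N) hW hinj
    exact ⟨c, hc, hs ▸ mem_image_of_mem _ hv⟩
  · rintro c ⟨b, W, hW, hinj, hs, hc⟩ c' ⟨b', W', hW', hinj', hs', hc'⟩ _ ⟨x, ⟨hx, hx'⟩, rfl⟩
    rw [hs] at hx
    rw [hs'] at hx'
    obtain ⟨w, hw, rfl⟩ := hx
    obtain ⟨w', hw', hww⟩ := hx'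
    set B := b.ofZLatticeBasis ℝ N with hB
    set B' := b'.ofZLatticeBasis ℝ N with hB'
    rw [← hww, hc' w' hw']
    let e' : V ≃L[ℝ] (Fin c'.dim → ℝ) := B'.equivFun.toContinuousLinearEquiv
    -- translate by the lattice vector relating the two lifts of the point
    have hmem : w - w' ∈ M' := (mk_eq_mk_iff N M' w' w).1 hww
    let O : Set V := W' ∩ (fun v => v + (w - w')) ⁻¹' W
    have hO : IsOpen O := hW'.inter (hW.preimage (continuous_id.add continuous_const))
    refine ⟨e'.symm ⁻¹' O, hO.preimage e'.symm.continuous, ?_, ?_⟩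
    · show e'.symm (e' w') ∈ O
      rw [e'.symm_apply_apply]
      exact ⟨hw', by simpa using hw⟩
    let A : Matrix (Fin c.dim) (Fin c'.dim) ℤ := fun i j => b.repr (b' j) i
    refine ⟨zAffine A (B.equivFun (w - w')), ⟨_, _, rfl⟩, ?_⟩
    have hA : A.map (fun z : ℤ => (z : ℝ)) = B.toMatrix B' := by
      ext i j
      simp only [Module.Basis.toMatrix_apply, hB, hB',
        Module.Basis.ofZLatticeBasis_apply, Module.Basis.ofZLatticeBasis_repr_apply]
      rfl
    rintro y ⟨hy, -⟩
    obtain ⟨z, rfl⟩ := e'.surjective y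
    have hz : z ∈ O := by simpa using hy
    have hez : e' z = c'.map (mk N M' z) := (hc' z hz.1).symm
    have hzs : mk N M' z ∈ c'.map.source := hs' ▸ mem_image_of_mem _ hz.1
    have hzz : mk N M' z = mk N M' (z + (w - w')) := by
      rw [mk_eq_mk_iff]
      simpa using hmem
    have h1 : (c.map ∘ c'.map.symm) (e' z) = B.equivFun (z + (w - w')) := by
      rw [Function.comp_apply, hez, c'.map.left_inv hzs, hzz]
      exact hc _ hz.2
    rw [h1, map_add]
    show _ = (A.map (fun z : ℤ => (z : ℝ))).mulVec (e' z) + _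
    rw [hA]
    congr 1
    exact (B'.toMatrix_mulVec_repr B z).symm

/-- The rational polyhedral structure of a real torus, for which `V → V / M'` is a local
isomorphism; the integral structure of `V` is given by `N`. -/
instance {V : Type u} [NormedAddCommGroup V] [NormedSpace ℝ V] [FiniteDimensional ℝ V]
    (N M' : Submodule ℤ V) [DiscreteTopology N] [IsZLattice ℝ N] [DiscreteTopology M'] :
    RationalPolyhedralSpace (RealTorus N M') where
  t2 := by
    have : DiscreteTopology M'.toAddSubgroup := inferInstanceAs (DiscreteTopology M')
    have : T3Space (V ⧸ M'.toAddSubgroup) := inferInstance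
    have h : T2Space (V ⧸ M'.toAddSubgroup) := inferInstance
    exact h.t2
  refAtlas := {c | IsStandardChart N M' c}
  isAtlas_refAtlas := standardCharts_isAtlas N M'

end RealTorus

/-- A homomorphism `λ : M' → M = Hom(N, ℤ)` is a polarization on `V / M'` if it comes from a
positive-definite symmetric `ℝ`-bilinear form `Q` on `V`, that is, `Q(u', v) = ⟨λ(u'), v⟩` for
`u' ∈ M'` and `v ∈ N`. -/
def IsPolarization {V : Type u} [NormedAddCommGroup V] [NormedSpace ℝ V]
    (N M' : Submodule ℤ V) (lam : M' →ₗ[ℤ] Module.Dual ℤ N) : Prop :=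
  ∃ Q : LinearMap.BilinForm ℝ V, (∀ x y, Q x y = Q y x) ∧
    (∀ (u : M') (v : N), Q (u : V) (v : V) = (lam u v : ℝ)) ∧
    ∀ x, x ≠ 0 → 0 < Q x x

/-- The real torus `V / M'` with integral structure `N` is a tropical abelian variety. -/
def IsTropicalAbelianVariety {V : Type u} [NormedAddCommGroup V] [NormedSpace ℝ V]
    (N M' : Submodule ℤ V) : Prop :=
  ∃ lam : M' →ₗ[ℤ] Module.Dual ℤ N, IsPolarization N M' lam

/-! From a polarization to an embedding. Let `Q` be integral on `M' × N`, and let `N*` be the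
lattice of vectors pairing integrally with `N`, so that `M' ⊆ N*`. Each class `z + M'` in `N*` has a
theta function `v ↦ (dist(v, z + M')² - Q(v, v)) / 2`. It is a locally finite minimum of affine
functions with slopes `-Q(z + u, ·)`, and its factors of automorphy do not depend on `z`, so all
classes give sections of one bundle. Replacing `Q` by a large multiple makes `N*` as fine as desired
relative to `M'`. Then near each `v` there is a `z ∈ N*` such that `z` and all `z + ε i`, for the
basis `ε` dual to a basis of `N`, are the unique closest points to `v` in their classes. The
differences of the theta functions then contain a full set of coordinates: this gives unimodularity
(`exists_leftInverse_of_minimizers`) and injectivity (`sub_mem_of_latticeDistSq_sub_eq`), and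
compactness of the torus gives an embedding (`admitsFaithfulEmbedding_twistedBundle`).

From an injective map to a polarization. Since `V` is simply connected, the sections pull back to
global functions `Θ k` (`exists_global_of_local`) with `Θ k (v + u) = Θ k v + g u v`, where `g u` is
affine, integral on `N`, and common to all `k` (`exists_shift_of_local`). The cocycle relation makes
`(u, u') ↦ -(g u).linear u'` symmetric and bilinear, and concavity makes it positive semidefinite.
If it were degenerate, integrality would put a nonzero `u ∈ M'` in the radical. Along `u` every `Θ
k` would be concave and periodic up to the same constant, hence affine with the same slope, and the
map would collapse the segment from `0` to `u` (`isTropicalAbelianVariety_of_theta`). -/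

/-! ### Polyhedra and faces given by systems over finite index types. -/

theorem isRationalPolyhedron_of_finite {ι : Type*} [Finite ι] {n : ℕ} (v : ι → Fin n → ℤ)
    (b : ι → ℝ) : IsRationalPolyhedron {x | ∀ i, b i ≤ (fun j => (v i j : ℝ)) ⬝ᵥ x} := by
  obtain ⟨k, ⟨e⟩⟩ := Finite.exists_equiv_fin ι
  refine ⟨k, fun i => v (e.symm i), fun i => b (e.symm i), ?_⟩
  ext x
  simp only [polyhedron, mem_ofPred_eq]
  exact ⟨fun h i => h _, fun h i => by simpa using h (e i)⟩

theorem isFace_of_finite {ι : Type*} [Finite ι] {n : ℕ} (v : ι → Fin n → ℝ)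
    (b : ι → ℝ) (J : Set ι) :
    IsFace {x | (∀ i, b i ≤ v i ⬝ᵥ x) ∧ ∀ i ∈ J, v i ⬝ᵥ x = b i} {x | ∀ i, b i ≤ v i ⬝ᵥ x} := by
  obtain ⟨k, ⟨e⟩⟩ := Finite.exists_equiv_fin ι
  refine ⟨k, fun i => v (e.symm i), fun i => b (e.symm i), e.symm ⁻¹' J, ?_, ?_⟩
  · ext x
    simp only [polyhedron, mem_ofPred_eq]
    exact ⟨fun h i => h _, fun h i => by simpa using h (e i)⟩
  · ext x
    simp only [mem_ofPred_eq, mem_preimage]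
    refine and_congr Iff.rfl ⟨fun h i hi => h _ hi, fun h i hi => ?_⟩
    simpa using h (e i) (by simpa using hi)

/-! ## Hyperplane arrangements -/

/-- The cell of the arrangement of the hyperplanes `⟨v i, x⟩ = b i` on which the `i`-th form is at
least `b i` for `i ∈ P` and at most `b i` for `i ∈ M`. -/
def arrangementCell {ι : Type*} {n : ℕ} (v : ι → Fin n → ℤ) (b : ι → ℝ) (P M : Set ι) :
    Set (Fin n → ℝ) :=
  {x | (∀ i ∈ P, b i ≤ (fun j => (v i j : ℝ)) ⬝ᵥ x) ∧ ∀ i ∈ M, (fun j => (v i j : ℝ)) ⬝ᵥ x ≤ b i}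

section Arrangement

variable {ι : Type*} {n : ℕ} (v : ι → Fin n → ℤ) (b : ι → ℝ)

theorem arrangementCell_eq (P M : Set ι) : arrangementCell v b P M =
    {x | ∀ i : P ⊕ M, Sum.elim (fun i : P => b i) (fun i : M => - b i) i ≤
      (fun j => ((Sum.elim (fun i : P => v i) (fun i : M => - v i) i j : ℤ) : ℝ)) ⬝ᵥ x} := by
  ext x
  have h : ∀ i, (fun j => -(v i j : ℝ)) ⬝ᵥ x = - ((fun j => (v i j : ℝ)) ⬝ᵥ x) := fun i =>
    neg_dotProduct (fun j => (v i j : ℝ)) x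
  simp [arrangementCell, h]

theorem isRationalPolyhedron_arrangementCell [Finite ι] (P M : Set ι) :
    IsRationalPolyhedron (arrangementCell v b P M) := by
  rw [arrangementCell_eq]
  exact isRationalPolyhedron_of_finite _ _

theorem isFace_arrangementCell [Finite ι] {P M K : Set ι} (hK : K ⊆ P ∪ M) :
    IsFace (arrangementCell v b (P ∪ K) (M ∪ K)) (arrangementCell v b P M) := by
  have := isFace_of_finite
    (fun i : P ⊕ M => fun j => ((Sum.elim (fun i : P => v i) (fun i : M => - v i) i j : ℤ) : ℝ))
    (Sum.elim (fun i : P => b i) (fun i : M => - b i))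
    {i | Sum.elim (fun i : P => (i : ι)) (fun i : M => (i : ι)) i ∈ K}
  rw [← arrangementCell_eq] at this
  convert this using 1
  have h : ∀ i (x : Fin n → ℝ),
      (fun j => -(v i j : ℝ)) ⬝ᵥ x = - ((fun j => (v i j : ℝ)) ⬝ᵥ x) := fun i x =>
    neg_dotProduct (fun j => (v i j : ℝ)) x
  ext x
  simp only [arrangementCell, mem_ofPred_eq, Sum.forall, Sum.elim_inl, Sum.elim_inr, Subtype.forall,
    Pi.neg_apply, Int.cast_neg, h, neg_le_neg_iff, neg_inj, mem_union]
  constructor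
  · rintro ⟨h1, h2⟩
    exact ⟨⟨fun i hi => h1 i (.inl hi), fun i hi => h2 i (.inl hi)⟩,
      fun i _ hi => le_antisymm (h2 i (.inr hi)) (h1 i (.inr hi)),
      fun i _ hi => le_antisymm (h2 i (.inr hi)) (h1 i (.inr hi))⟩
  · rintro ⟨⟨h1, h2⟩, h3, h4⟩
    have h5 : ∀ i ∈ K, (fun j => (v i j : ℝ)) ⬝ᵥ x = b i := fun i hi =>
      (hK hi).elim (fun hP => h3 i hP hi) (fun hM => h4 i hM hi)
    exact ⟨fun i hi => hi.elim (h1 i) fun hi => (h5 i hi).ge,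
      fun i hi => hi.elim (h2 i) fun hi => (h5 i hi).le⟩

/-- An index of `P'` missing from `P` lies in `M`, so the second cell forces equality there;
likewise for `M'` and `M`. Hence the intersection arises from the first cell by turning inequalities
into equalities, which makes it a face. -/
theorem arrangementCell_inter {P M P' M' : Set ι} (h : P ∪ M = univ) :
    arrangementCell v b P M ∩ arrangementCell v b P' M' =
      arrangementCell v b (P ∪ ((P' \ P) ∪ (M' \ M))) (M ∪ ((P' \ P) ∪ (M' \ M))) := by
  have h' : ∀ i, i ∈ P ∨ i ∈ M := fun i => (h.symm ▸ mem_univ i : i ∈ P ∪ M)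
  ext x
  simp only [arrangementCell, mem_inter_iff, mem_ofPred_eq, mem_union, mem_sdiff]
  constructor
  · rintro ⟨⟨h1, h2⟩, h3, h4⟩
    constructor
    · rintro i (hi | ⟨hi, -⟩ | ⟨-, hi⟩)
      exacts [h1 i hi, h3 i hi, h1 i ((h' i).resolve_right hi)]
    · rintro i (hi | ⟨-, hi⟩ | ⟨hi, -⟩)
      exacts [h2 i hi, h2 i ((h' i).resolve_left hi), h4 i hi]
  · rintro ⟨h1, h2⟩
    refine ⟨⟨fun i hi => h1 i (.inl hi), fun i hi => h2 i (.inl hi)⟩, fun i hi => ?_, fun i hi => ?_⟩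
    · by_cases hP : i ∈ P
      exacts [h1 i (.inl hP), h1 i (.inr (.inl ⟨hi, hP⟩))]
    · by_cases hM : i ∈ M
      exacts [h2 i (.inl hM), h2 i (.inr (.inr ⟨hi, hM⟩))]

/-- A nonempty face of a cell is the cell on which the forms vanishing on the face are required to
vanish. -/
theorem face_arrangementCell_eq [Finite ι] {P M : Set ι} (h : P ∪ M = univ)
    {τ : Set (Fin n → ℝ)} (hτ : IsFace τ (arrangementCell v b P M)) (hne : τ.Nonempty) :
    ∃ K : Set ι, τ = arrangementCell v b (P ∪ K) (M ∪ K) := by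
  classical
  have : Fintype ι := Fintype.ofFinite ι
  have hPM : ∀ i, i ∈ P ∨ i ∈ M := fun i => (h.symm ▸ mem_univ i : i ∈ P ∪ M)
  obtain ⟨k, w, c, J, hσ, rfl⟩ := hτ
  set σ := arrangementCell v b P M with hσdef
  set τ : Set (Fin n → ℝ) := {x | x ∈ σ ∧ ∀ i ∈ J, w i ⬝ᵥ x = c i} with hτdef
  let g : ι → (Fin n → ℝ) → ℝ := fun i x => (fun j => (v i j : ℝ)) ⬝ᵥ x - b i
  have hg : ∀ i x y (s t : ℝ), s + t = 1 → g i (s • x + t • y) = s * g i x + t * g i y := by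
    intro i x y s t hst
    simp only [g, dotProduct_add, dotProduct_smul, smul_eq_mul]
    linear_combination (b i) * hst
  have hgP : ∀ x ∈ σ, ∀ i ∈ P, 0 ≤ g i x := fun x hx i hi => sub_nonneg.2 (hx.1 i hi)
  have hgM : ∀ x ∈ σ, ∀ i ∈ M, g i x ≤ 0 := fun x hx i hi => sub_nonpos.2 (hx.2 i hi)
  have hσmem : ∀ x, (∀ i ∈ P, 0 ≤ g i x) → (∀ i ∈ M, g i x ≤ 0) → x ∈ σ := fun x h1 h2 =>
    ⟨fun i hi => sub_nonneg.1 (h1 i hi), fun i hi => sub_nonpos.1 (h2 i hi)⟩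
  let K : Set ι := {i | ∀ x ∈ τ, g i x = 0}
  -- a point of `τ` at which only the forms in `K` vanish
  have hp : ∀ T : Finset ι, ∃ p ∈ τ, ∀ i ∈ T, i ∉ K → g i p ≠ 0 := by
    intro T
    induction T using Finset.induction with
    | empty => exact ⟨_, hne.some_mem, by simp⟩
    | insert i T _ ih =>
      obtain ⟨p, hpτ, hp⟩ := ih
      by_cases hi : i ∈ K
      · refine ⟨p, hpτ, fun j hj hjK => ?_⟩
        rcases Finset.mem_insert.1 hj with rfl | hj
        exacts [(hjK hi).elim, hp j hj hjK]
      obtain ⟨x, hxτ, hx⟩ : ∃ x ∈ τ, g i x ≠ 0 := by simpa [K] using hi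
      have hmid : ∀ l, g l ((1 / 2 : ℝ) • p + (1 / 2 : ℝ) • x) = 1 / 2 * g l p + 1 / 2 * g l x :=
        fun l => hg l p x _ _ (by norm_num)
      -- Each form has constant sign on the cell, so no cancellation occurs at a midpoint.
      have hz : ∀ l, 1 / 2 * g l p + 1 / 2 * g l x = 0 → g l p = 0 ∧ g l x = 0 := by
        intro l hl
        rcases hPM l with hl' | hl'
        · have := hgP p hpτ.1 l hl'
          have := hgP x hxτ.1 l hl'
          constructor <;> linarith
        · have := hgM p hpτ.1 l hl'
          have := hgM x hxτ.1 l hl'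
          constructor <;> linarith
      refine ⟨(1 / 2 : ℝ) • p + (1 / 2 : ℝ) • x, ⟨hσmem _ (fun l hl => ?_) fun l hl => ?_, ?_⟩, ?_⟩
      · rw [hmid]
        have := hgP p hpτ.1 l hl
        have := hgP x hxτ.1 l hl
        linarith
      · rw [hmid]
        have := hgM p hpτ.1 l hl
        have := hgM x hxτ.1 l hl
        linarith
      · intro j hj
        rw [dotProduct_add, dotProduct_smul, dotProduct_smul, hpτ.2 j hj, hxτ.2 j hj, smul_eq_mul]
        ring
      · intro j hj hjK h0
        rw [hmid] at h0
        rcases Finset.mem_insert.1 hj with rfl | hj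
        exacts [hx (hz _ h0).2, hp j hj hjK (hz _ h0).1]
  obtain ⟨p, hpτ, hp⟩ := hp Finset.univ
  refine ⟨K, Subset.antisymm (fun x hx => ⟨fun i hi => ?_, fun i hi => ?_⟩) fun x hx => ?_⟩
  · exact hi.elim (hx.1.1 i) fun hi => (sub_eq_zero.1 (hi x hx)).ge
  · exact hi.elim (hx.1.2 i) fun hi => (sub_eq_zero.1 (hi x hx)).le
  have hxσ : x ∈ σ := ⟨fun i hi => hx.1 i (.inl hi), fun i hi => hx.2 i (.inl hi)⟩
  have hxK : ∀ i ∈ K, g i x = 0 := fun i hi =>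
    sub_eq_zero.2 (le_antisymm (hx.2 i (.inr hi)) (hx.1 i (.inr hi)))
  refine ⟨hxσ, ?_⟩
  -- the segment from `x` to `p` can be prolonged slightly beyond `p` inside the cell
  have hev : ∀ᶠ δ : ℝ in 𝓝[>] 0, ∀ i, i ∉ K → 0 ≤ ((1 + δ) * g i p - δ * g i x) * g i p := by
    refine Filter.eventually_all.2 fun i => ?_
    by_cases hi : i ∈ K
    · simp [hi]
    have ht : Filter.Tendsto (fun δ : ℝ => ((1 + δ) * g i p - δ * g i x) * g i p) (𝓝[>] 0)
        (𝓝 (((1 + 0) * g i p - 0 * g i x) * g i p)) :=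
      (Continuous.tendsto (by fun_prop) 0).mono_left nhdsWithin_le_nhds
    have hpos : 0 < ((1 + 0) * g i p - 0 * g i x) * g i p := by
      have := mul_self_pos.2 (hp i (Finset.mem_univ i) hi)
      simpa using this
    filter_upwards [ht.eventually (lt_mem_nhds hpos)] with δ hδ _ using hδ.le
  obtain ⟨δ, hδ, hδ0⟩ := (hev.and self_mem_nhdsWithin).exists
  have hδ0 : 0 < δ := hδ0
  have hy : ∀ i, g i ((1 + δ) • p + (-δ) • x) = (1 + δ) * g i p - δ * g i x := fun i => by
    rw [hg i p x _ _ (by ring)]; ring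
  have hyσ : (1 + δ) • p + (-δ) • x ∈ σ := by
    refine hσmem _ (fun i hi => ?_) fun i hi => ?_
    · rw [hy]
      by_cases hiK : i ∈ K
      · rw [hxK i hiK, hiK p hpτ]; simp
      · exact nonneg_of_mul_nonneg_left (hδ i hiK)
          (lt_of_le_of_ne (hgP p hpτ.1 i hi) (hp i (Finset.mem_univ i) hiK).symm)
    · rw [hy]
      by_cases hiK : i ∈ K
      · rw [hxK i hiK, hiK p hpτ]; simp
      · have := lt_of_le_of_ne (hgM p hpτ.1 i hi) (hp i (Finset.mem_univ i) hiK)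
        have h2 := hδ i hiK
        nlinarith
  -- The form `w j` equals `c j` at `p` and is at least `c j` at `x` and at the point beyond `p`; as
  -- `p` lies between these two, equality holds at `x`.
  intro j hj
  have hj1 : c j ≤ w j ⬝ᵥ x := by rw [hσ] at hxσ; exact hxσ j
  have hj2 : c j ≤ w j ⬝ᵥ ((1 + δ) • p + (-δ) • x) := by rw [hσ] at hyσ; exact hyσ j
  rw [dotProduct_add, dotProduct_smul, dotProduct_smul, hpτ.2 j hj, smul_eq_mul, smul_eq_mul] at hj2
  nlinarith

/-- A finite arrangement of rational hyperplanes subdivides `ℝⁿ` into a rational polyhedral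
complex. -/
theorem isRationalPolyhedralComplex_arrangement [Finite ι] :
    IsRationalPolyhedralComplex
      (insert ∅ {σ | ∃ P M : Set ι, P ∪ M = univ ∧ σ = arrangementCell v b P M}) := by
  have hR : ∀ σ ∈ insert ∅ {σ | ∃ P M : Set ι, P ∪ M = univ ∧ σ = arrangementCell v b P M},
      IsRationalPolyhedron σ := by
    rintro σ (rfl | ⟨P, M, -, rfl⟩)
    · exact (isRationalPolyhedralComplex_univ n).rational ∅ (by simp)
    · exact isRationalPolyhedron_arrangementCell v b P M
  refine ⟨⟨fun σ hσ => ?_, ?_, ?_, ?_⟩, hR⟩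
  · obtain ⟨k, v, b, h⟩ := hR σ hσ
    exact ⟨k, _, b, h⟩
  · have hfin : Set.Finite
        (insert ∅ {σ | ∃ P M : Set ι, P ∪ M = univ ∧ σ = arrangementCell v b P M}) := by
      refine Set.Finite.insert _ ((Set.finite_range fun PM : Set ι × Set ι =>
        arrangementCell v b PM.1 PM.2).subset ?_)
      rintro σ ⟨P, M, -, rfl⟩
      exact ⟨(P, M), rfl⟩
    have := hfin.to_subtype
    exact locallyFinite_of_finite _
  · rintro σ hσ τ hτ
    -- `IsFace` allows empty faces, which is why `∅` was added to the cells.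
    rcases τ.eq_empty_or_nonempty with rfl | hne
    · exact .inl rfl
    rcases hσ with rfl | ⟨P, M, hPM, rfl⟩
    · obtain ⟨k, v, b, J, -, rfl⟩ := hτ
      exact (hne.some_mem.1).elim
    · obtain ⟨K, rfl⟩ := face_arrangementCell_eq v b hPM hτ hne
      refine .inr ⟨_, _, eq_univ_of_univ_subset ?_, rfl⟩
      rw [← hPM]
      exact union_subset_union subset_union_left subset_union_left
  · rintro σ (rfl | ⟨P, M, hPM, rfl⟩) σ' (rfl | ⟨P', M', hPM', rfl⟩) hne
    · simp at hne
    · simp at hne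
    · simp at hne
    · constructor
      · rw [arrangementCell_inter v b hPM]
        exact isFace_arrangementCell v b (hPM ▸ subset_univ _)
      · rw [inter_comm, arrangementCell_inter v b hPM']
        exact isFace_arrangementCell v b (hPM' ▸ subset_univ _)

theorem exists_complex_sign [Finite ι] :
    ∃ C : Set (Set (Fin n → ℝ)), IsRationalPolyhedralComplex C ∧ ⋃₀ C = univ ∧
      ∀ σ ∈ C, ∀ i, (∀ x ∈ σ, b i ≤ (fun j => (v i j : ℝ)) ⬝ᵥ x) ∨
        ∀ x ∈ σ, (fun j => (v i j : ℝ)) ⬝ᵥ x ≤ b i := by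
  refine ⟨_, isRationalPolyhedralComplex_arrangement v b, eq_univ_of_forall fun x => ?_, ?_⟩
  · refine ⟨arrangementCell v b {i | b i ≤ (fun j => (v i j : ℝ)) ⬝ᵥ x}
      {i | (fun j => (v i j : ℝ)) ⬝ᵥ x ≤ b i}, .inr ⟨_, _, ?_, rfl⟩, fun i hi => hi, fun i hi => hi⟩
    exact eq_univ_of_forall fun i => le_total (b i) ((fun j => (v i j : ℝ)) ⬝ᵥ x)
  · rintro σ (rfl | ⟨P, M, hPM, rfl⟩) i
    · simp
    · rcases (hPM.symm ▸ mem_univ i : i ∈ P ∪ M) with hi | hi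
      · exact .inl fun x hx => hx.1 i hi
      · exact .inr fun x hx => hx.2 i hi

end Arrangement

/-- On the cells of a suitable rational polyhedral complex, each of finitely many finite families
of `ℤ`-affine functions has a smallest member. -/
theorem exists_complex_min {κ ι : Type*} [Finite κ] [Finite ι] [Nonempty ι] {n : ℕ}
    (a : κ → ι → Fin n → ℤ) (c : κ → ι → ℝ) :
    ∃ C : Set (Set (Fin n → ℝ)), IsRationalPolyhedralComplex C ∧ ⋃₀ C = univ ∧
      ∀ σ ∈ C, ∀ k, ∃ i, ∀ j, ∀ x ∈ σ,
        (fun l => (a k i l : ℝ)) ⬝ᵥ x + c k i ≤ (fun l => (a k j l : ℝ)) ⬝ᵥ x + c k j := by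
  -- The hyperplanes are the loci where two members of one family agree. On a cell any two members
  -- are then comparable, so a finite family has a smallest one.
  obtain ⟨C, hC, hC', h⟩ := exists_complex_sign
    (fun p : κ × ι × ι => a p.1 p.2.1 - a p.1 p.2.2) (fun p => c p.1 p.2.2 - c p.1 p.2.1)
  refine ⟨C, hC, hC', fun σ hσ k => ?_⟩
  have hsub : ∀ i j (x : Fin n → ℝ), (fun l => (((a k i - a k j) l : ℤ) : ℝ)) ⬝ᵥ x =
      (fun l => (a k i l : ℝ)) ⬝ᵥ x - (fun l => (a k j l : ℝ)) ⬝ᵥ x := by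
    intro i j x
    rw [← sub_dotProduct]
    congr 1
    ext l
    simp
  let r : ι → ι → Prop := fun i j => ∀ x ∈ σ,
        (fun l => (a k j l : ℝ)) ⬝ᵥ x + c k j ≤ (fun l => (a k i l : ℝ)) ⬝ᵥ x + c k i
  have : IsTrans ι r := ⟨fun i j l h1 h2 x hx => (h2 x hx).trans (h1 x hx)⟩
  have htot : ∀ i j, r i j ∨ r j i := by
    intro i j
    rcases h σ hσ (k, i, j) with h | h
    · left
      intro x hx
      have := h x hx
      rw [hsub] at this
      linarith
    · right
      intro x hx
      have := h x hx
      rw [hsub] at this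
      linarith
  have hd : Directed r (id : ι → ι) := fun i j => by
    rcases htot i j with h | h
    · exact ⟨j, h, fun x _ => le_rfl⟩
    · exact ⟨i, fun x _ => le_rfl, h⟩
  obtain ⟨z, hz⟩ := hd.finite_le (id : ι → ι)
  exact ⟨z, fun j x hx => hz j x hx⟩

theorem isPiecewiseZAffine_of_min {ι : Type*} [Finite ι] [Nonempty ι] {n : ℕ}
    (a : ι → Fin n → ℤ) (c : ι → ℝ) {f : (Fin n → ℝ) → ℝ}
    (hle : ∀ x i, f x ≤ (fun l => (a i l : ℝ)) ⬝ᵥ x + c i)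
    (heq : ∀ x, ∃ i, f x = (fun l => (a i l : ℝ)) ⬝ᵥ x + c i) :
    IsPiecewiseZAffine f := by
  obtain ⟨C, hC, hC', h⟩ := exists_complex_min (fun _ : Unit => a) (fun _ => c)
  refine ⟨C, hC.toIsPolyhedralComplex, hC', fun σ hσ => ?_⟩
  obtain ⟨i, hi⟩ := h σ hσ ()
  refine ⟨zAffine (Matrix.of fun _ => a i) (fun _ => c i), ⟨_, _, rfl⟩, fun x hx => ?_⟩
  obtain ⟨j, hj⟩ := heq x
  exact le_antisymm (hle x i) (hj ▸ hi j x hx)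

/-- If `k x = A y` with `k ≠ 0`, then `y = k (B x)`, hence `x = A (B x)`: the image of `A` is
saturated. -/
theorem isUnimodularZAffine_of_leftInverse {m n : ℕ} (A : Matrix (Fin n) (Fin m) ℤ)
    (B : Matrix (Fin m) (Fin n) ℤ) (h : B * A = 1) (b : Fin n → ℝ) :
    IsUnimodularZAffine (zAffine A b) := by
  refine ⟨A, b, rfl, ?_, ?_⟩
  · apply le_antisymm
    · simpa using A.rank_le_card_width
    · have := Matrix.rank_mul_le_right B A
      rwa [h, Matrix.rank_one, Fintype.card_fin] at this
  · have : Module.IsTorsionFree ℤ ((Fin n → ℤ) ⧸ LinearMap.range A.mulVecLin) := by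
      refine Module.IsTorsionFree.of_smul_eq_zero fun k x hx => ?_
      obtain ⟨x, rfl⟩ := Submodule.Quotient.mk_surjective _ x
      rw [← Submodule.Quotient.mk_smul, Submodule.Quotient.mk_eq_zero] at hx
      obtain ⟨y, hy⟩ := hx
      rw [Matrix.mulVecLin_apply] at hy
      by_cases hk : k = 0
      · exact .inl hk
      right
      rw [Submodule.Quotient.mk_eq_zero]
      refine ⟨B.mulVec x, ?_⟩
      have h1 : k • B.mulVec x = y := by
        rw [← Matrix.mulVec_smul, ← hy, Matrix.mulVec_mulVec, h, Matrix.one_mulVec]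
      have h2 : k • A.mulVec (B.mulVec x) = k • x := by
        rw [← Matrix.mulVec_smul, h1, hy]
      rw [Matrix.mulVecLin_apply]
      exact smul_right_injective _ hk h2
    exact this

/-! ### Locally midpoint concave functions of one variable. -/

/-- If `h` were negative somewhere, its leftmost minimizer `d` on `[a, b]` would be an interior
point, and the midpoint inequality at `d` would make `d - δ` a minimizer too. -/
theorem nonneg_of_locally_midpoint_concave {h : ℝ → ℝ} (hc : Continuous h)
    (hl : ∀ t, ∀ᶠ δ in 𝓝[>] (0 : ℝ), h (t - δ) + h (t + δ) ≤ 2 * h t) {a b : ℝ}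
    (ha : 0 ≤ h a) (hb : 0 ≤ h b) {t : ℝ} (ht : t ∈ Icc a b) : 0 ≤ h t := by
  by_contra! hneg
  obtain ⟨c, hc1, hc2⟩ := isCompact_Icc.exists_isMinOn ⟨t, ht⟩ hc.continuousOn
  have hm : h c < 0 := (hc2 ht).trans_lt hneg
  have hS : IsCompact (Icc a b ∩ h ⁻¹' {h c}) :=
    isCompact_Icc.inter_right (isClosed_singleton.preimage hc)
  obtain ⟨d, ⟨hd1, hd2⟩, hd3⟩ := hS.exists_isLeast ⟨c, hc1, rfl⟩
  have hd2 : h d = h c := hd2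
  have had : a < d := lt_of_le_of_ne hd1.1 (by rintro rfl; linarith)
  have hdb : d < b := lt_of_le_of_ne hd1.2 (by rintro rfl; linarith)
  have h1 : ∀ᶠ δ in 𝓝[>] (0 : ℝ), δ < d - a :=
    nhdsWithin_le_nhds (gt_mem_nhds (sub_pos.2 had))
  have h2 : ∀ᶠ δ in 𝓝[>] (0 : ℝ), δ < b - d :=
    nhdsWithin_le_nhds (gt_mem_nhds (sub_pos.2 hdb))
  obtain ⟨δ, ⟨⟨h3, h1⟩, h2⟩, h0⟩ := (((hl d).and h1).and h2 |>.and self_mem_nhdsWithin).exists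
  have h0 : 0 < δ := h0
  have h4 : d - δ ∈ Icc a b := ⟨by linarith, by linarith⟩
  have h5 : d + δ ∈ Icc a b := ⟨by linarith, by linarith⟩
  have h6 : h c ≤ h (d - δ) := hc2 h4
  have h7 : h c ≤ h (d + δ) := hc2 h5
  have h8 : h (d - δ) = h c := by linarith
  have := hd3 ⟨h4, h8⟩
  linarith

theorem add_le_two_mul_of_locally_midpoint_concave {h : ℝ → ℝ} (hc : Continuous h)
    (hl : ∀ t, ∀ᶠ δ in 𝓝[>] (0 : ℝ), h (t - δ) + h (t + δ) ≤ 2 * h t) :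
    h (-1) + h 1 ≤ 2 * h 0 := by
  have := nonneg_of_locally_midpoint_concave
    (h := fun t => h t - ((h 1 + h (-1)) / 2 + t * ((h 1 - h (-1)) / 2))) (by fun_prop)
    (fun t => (hl t).mono fun δ hδ => by linarith) (a := -1) (b := 1) (t := 0)
    (by linarith) (by linarith) (by norm_num)
  linarith

/-- The function `h t - t * c` has period 1 and is concave, so it is constant: over `[s, s + 1]` its
end values agree, hence it stays above its value at `s`. Taking `s = 0` and `s = t` gives the two
inequalities. -/
theorem eq_of_locally_midpoint_concave {h : ℝ → ℝ} (hc : Continuous h)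
    (hl : ∀ t, ∀ᶠ δ in 𝓝[>] (0 : ℝ), h (t - δ) + h (t + δ) ≤ 2 * h t) {c : ℝ}
    (hper : ∀ t, h (t + 1) = h t + c) {t : ℝ} (ht : t ∈ Icc (0 : ℝ) 1) : h t = h 0 + t * c := by
  have key : ∀ s, ∀ t ∈ Icc s (s + 1), h s - s * c ≤ h t - t * c := by
    intro s t ht
    have := nonneg_of_locally_midpoint_concave
      (h := fun t => h t - t * c - (h s - s * c)) (by fun_prop)
      (fun t => (hl t).mono fun δ hδ => by linarith) (a := s) (b := s + 1)
      (by linarith) (by linarith [hper s]) ht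
    linarith
  have h1 := key 0 t ⟨ht.1, by linarith [ht.2]⟩
  have h2 := key t 1 ⟨ht.2, by linarith [ht.1]⟩
  have h3 := hper 0
  rw [zero_add] at h3
  linarith

/-! ### Passing from local to global on the simply connected space `V`. -/

section Affine

variable {V : Type*} [NormedAddCommGroup V] [NormedSpace ℝ V]

theorem AffineMap.eq_of_eventuallyEq {g g' : V →ᵃ[ℝ] ℝ} {v : V} (h : ∀ᶠ w in 𝓝 v, g w = g' w) :
    g = g' := by
  ext x
  have ht : Filter.Tendsto (fun t : ℝ => AffineMap.lineMap v x t) (𝓝 0) (𝓝 v) := by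
    have : Continuous (fun t : ℝ => AffineMap.lineMap v x t : ℝ → V) := by
      simp only [AffineMap.lineMap_apply]
      fun_prop
    simpa using this.tendsto 0
  have h1 : ∀ᶠ t : ℝ in 𝓝[≠] 0, g (AffineMap.lineMap v x t) = g' (AffineMap.lineMap v x t) :=
    nhdsWithin_le_nhds (ht.eventually h)
  obtain ⟨t, h2, h3⟩ := (h1.and self_mem_nhdsWithin).exists
  have h3 : t ≠ 0 := h3
  have h4 := h.self_of_nhds
  rw [AffineMap.apply_lineMap, AffineMap.apply_lineMap, h4, AffineMap.lineMap_apply,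
    AffineMap.lineMap_apply] at h2
  simp only [vsub_eq_sub, vadd_eq_add, smul_eq_mul, add_left_inj] at h2
  have := mul_left_cancel₀ h3 h2
  linarith

/-- Affine functions on `V` whose linear part is integral on `N`. -/
def integralAffineMaps (N : Submodule ℤ V) : AddSubgroup (V →ᵃ[ℝ] ℝ) where
  carrier := {g | ∀ n ∈ N, ∃ z : ℤ, g.linear n = z}
  zero_mem' n _ := ⟨0, by simp⟩
  add_mem' {g g'} hg hg' n hn := by
    obtain ⟨z, hz⟩ := hg n hn
    obtain ⟨z', hz'⟩ := hg' n hn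
    exact ⟨z + z', by simp [hz, hz']⟩
  neg_mem' {g} hg n hn := by
    obtain ⟨z, hz⟩ := hg n hn
    exact ⟨-z, by simp [hz]⟩

/-- A family of functions on `V` that is given locally up to affine functions in `G` comes from a
global family: the torsors of local choices form a covering of the simply connected space `V`. -/
theorem exists_global_of_local {κ ι : Type*} [Nonempty κ] (G : AddSubgroup (V →ᵃ[ℝ] ℝ))
    (W : ι → Set V) (hW : ∀ i, IsOpen (W i)) (hcov : ∀ v, ∃ i, v ∈ W i) (F : κ → ι → V → ℝ)
    (hF : ∀ i j v, v ∈ W i → v ∈ W j → ∃ g ∈ G, ∀ᶠ w in 𝓝 v, ∀ k, F k i w = F k j w + g w) :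
    ∃ Θ : κ → V → ℝ, ∀ i, ∀ v ∈ W i, ∃ g ∈ G, ∀ᶠ w in 𝓝 v, ∀ k, Θ k w = F k i w + g w := by
  classical
  have hD : ∀ i j v, ∃ g : G, v ∈ W i → v ∈ W j → ∀ᶠ w in 𝓝 v, ∀ k,
      F k i w = F k j w + (g : V →ᵃ[ℝ] ℝ) w := by
    intro i j v
    by_cases h : v ∈ W i ∧ v ∈ W j
    · obtain ⟨g, hg, h'⟩ := hF i j v h.1 h.2
      exact ⟨⟨g, hg⟩, fun _ _ => h'⟩
    · exact ⟨0, fun h1 h2 => (h ⟨h1, h2⟩).elim⟩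
  choose D hD using hD
  let k₀ : κ := Classical.arbitrary κ
  -- An affine function is determined by its germ, so a single index `k₀` already fixes the
  -- transition.
  have huniq : ∀ i j v (g : G), v ∈ W i → v ∈ W j →
      (∀ᶠ w in 𝓝 v, ∀ k, F k i w = F k j w + (g : V →ᵃ[ℝ] ℝ) w) → D i j v = g := by
    intro i j v g hi hj h
    refine Subtype.ext (AffineMap.eq_of_eventuallyEq (v := v) ?_)
    filter_upwards [h, hD i j v hi hj] with w h1 h2
    have := h1 k₀
    have := h2 k₀
    linarith
  -- With `G` discrete, the locally constant transitions glue to a covering of `V` with fibre `G`.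
  let _ : TopologicalSpace G := ⊥
  have : DiscreteTopology G := ⟨rfl⟩
  choose idx hidx using hcov
  let Z : FiberBundleCore ι V G :=
    { baseSet := W
      isOpen_baseSet := hW
      indexAt := idx
      mem_baseSet_at := hidx
      coordChange := fun i j v a => a + D i j v
      coordChange_self := by
        intro i x hx a
        rw [huniq i i x 0 hx hx (by simp), add_zero]
      continuousOn_coordChange := by
        intro i j
        refine continuousOn_snd.add (f := fun p : V × G => p.2) ?_
        rintro ⟨v, a⟩ ⟨⟨hi, hj⟩, -⟩
        have hev : ∀ᶠ w in 𝓝 v, D i j w = D i j v := by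
          filter_upwards [(hD i j v hi hj).eventually_nhds, (hW i).mem_nhds hi,
            (hW j).mem_nhds hj] with w h1 h2 h3
          exact huniq i j w _ h2 h3 h1
        have hev' : ∀ᶠ p : V × G in 𝓝 (v, a), D i j p.1 = D i j v :=
          (continuous_fst.tendsto (v, a)).eventually hev
        exact ((continuousAt_const (y := D i j v)).congr
          (hev'.mono fun _ h => h.symm)).continuousWithinAt
      coordChange_comp := by
        rintro i j k x ⟨⟨hi, hj⟩, hk⟩ a
        have : D i k x = D i j x + D j k x := by
          refine huniq i k x _ hi hk ?_
          filter_upwards [hD i j x hi hj, hD j k x hj hk] with w h1 h2 l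
          rw [h1, h2]
          simp only [AddSubgroup.coe_add, AffineMap.coe_add, Pi.add_apply]
          ring
        rw [this, add_assoc] }
  have hcovm : IsCoveringMap Z.proj := FiberBundle.isCoveringMap (F := G) (E := Z.Fiber)
  -- Lifting the identity of `V` gives a global section of the covering; its fibre component is the
  -- correction that makes the local families agree.
  obtain ⟨s, ⟨-, hs⟩, -⟩ := hcovm.existsUnique_continuousMap_lifts (A := V) (ContinuousMap.id V)
    (0 : V) (⟨0, (0 : G)⟩ : Z.TotalSpace) rfl
  have hs' : ∀ v, (s v).1 = v := fun v => congrFun hs v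
  let σ : V → G := fun v => (s v).2
  refine ⟨fun k v => F k (idx v) v + (σ v : V →ᵃ[ℝ] ℝ) v, fun i v hv => ?_⟩
  have ha : ∀ w, (Z.localTriv i (s w)).2 = σ w + D (idx w) i w := by
    intro w
    rw [FiberBundleCore.localTriv_apply]
    show σ w + D (idx (s w).1) i (s w).1 = _
    rw [hs']
  have hcont : ContinuousAt (fun w => (Z.localTriv i (s w)).2) v := by
    have hmem : s v ∈ (Z.localTriv i).source := by
      rw [Bundle.Trivialization.mem_source]
      show (s v).1 ∈ W i
      rw [hs']
      exact hv
    exact continuousAt_snd.comp (((Z.localTriv i).continuousAt hmem).comp s.continuous.continuousAt)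
  have hev : ∀ᶠ w in 𝓝 v, (Z.localTriv i (s w)).2 = (Z.localTriv i (s v)).2 :=
    hcont.eventually ((isOpen_discrete {(Z.localTriv i (s v)).2}).mem_nhds rfl)
  refine ⟨(σ v + D (idx v) i v : G), SetLike.coe_mem _, ?_⟩
  filter_upwards [hev, (hW i).mem_nhds hv] with w h1 h2 k
  rw [ha, ha] at h1
  rw [← h1, (hD (idx w) i w (hidx w) h2).self_of_nhds k]
  simp only [AddSubgroup.coe_add, AffineMap.coe_add, Pi.add_apply]
  ring

/-- A shift that changes a family of functions locally by functions in `G` does so globally. -/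
theorem exists_shift_of_local {κ : Type*} [Nonempty κ] (G : AddSubgroup (V →ᵃ[ℝ] ℝ))
    (Θ : κ → V → ℝ) (u : V)
    (h : ∀ v, ∃ g ∈ G, ∀ᶠ w in 𝓝 v, ∀ k, Θ k (w + u) = Θ k w + g w) :
    ∃ g ∈ G, ∀ v k, Θ k (v + u) = Θ k v + g v := by
  choose g hgG hg using h
  let k₀ : κ := Classical.arbitrary κ
  have hloc : IsLocallyConstant g := by
    rw [IsLocallyConstant.iff_eventually_eq]
    intro v
    filter_upwards [(hg v).eventually_nhds] with w hw
    refine AffineMap.eq_of_eventuallyEq (v := w) ?_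
    filter_upwards [hw, hg w] with x h1 h2
    have := h1 k₀
    have := h2 k₀
    linarith
  refine ⟨g 0, hgG 0, fun v k => ?_⟩
  rw [hloc.apply_eq_of_isPreconnected isPreconnected_univ (mem_univ 0) (mem_univ v)]
  exact (hg v).self_of_nhds k

end Affine

/-! ### From quasi-periodic concave functions to a polarization. -/

section Polarization

variable {V : Type*} [NormedAddCommGroup V] [NormedSpace ℝ V]

theorem LinearMap.BilinForm.continuous_apply_self [FiniteDimensional ℝ V]
    (Q : LinearMap.BilinForm ℝ V) : Continuous fun x => Q x x := by
  have h : ∀ x, Q x x = LinearMap.toContinuousBilinearMap Q x x := fun x => rfl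
  simp only [h]
  fun_prop

theorem ZLattice.exists_mem_norm_sub_le [FiniteDimensional ℝ V] (L : Submodule ℤ V)
    [DiscreteTopology L] [IsZLattice ℝ L] : ∃ C : ℝ, ∀ x : V, ∃ u ∈ L, ‖x - u‖ ≤ C := by
  have : Module.Finite ℤ L := ZLattice.module_finite ℝ L
  have : Module.Free ℤ L := ZLattice.module_free ℝ L
  let B := (Module.finBasis ℤ L).ofZLatticeBasis ℝ L
  refine ⟨∑ i, ‖B i‖, fun x => ⟨ZSpan.floor B x, ?_, ZSpan.norm_fract_le B x⟩⟩
  exact (Module.Basis.ofZLatticeBasis_span ℝ L (Module.finBasis ℤ L)).le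
    (SetLike.coe_mem (ZSpan.floor B x))

/-- Lattice directions are dense: a lattice point at bounded distance from `(n + 1) • x`, divided by
`n + 1`, tends to `x`. -/
theorem nonneg_of_nonneg_on_lattice [FiniteDimensional ℝ V] (L : Submodule ℤ V)
    [DiscreteTopology L] [IsZLattice ℝ L] (Q : LinearMap.BilinForm ℝ V)
    (h : ∀ u ∈ L, 0 ≤ Q u u) (x : V) : 0 ≤ Q x x := by
  obtain ⟨C, hC⟩ := ZLattice.exists_mem_norm_sub_le L
  choose u hu huC using fun n : ℕ => hC (((n : ℝ) + 1) • x)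
  have hlim : Filter.Tendsto (fun n : ℕ => ((n : ℝ) + 1)⁻¹ • u n) Filter.atTop (𝓝 x) := by
    rw [tendsto_iff_norm_sub_tendsto_zero]
    have h0 : Filter.Tendsto (fun n : ℕ => ((n : ℝ) + 1)⁻¹ * C) Filter.atTop (𝓝 0) := by
      simpa [one_div] using (tendsto_one_div_add_atTop_nhds_zero_nat (𝕜 := ℝ)).mul_const C
    refine squeeze_zero (fun _ => norm_nonneg _) (fun n => ?_) h0
    have hn : (n : ℝ) + 1 ≠ 0 := by positivity
    have : ((n : ℝ) + 1)⁻¹ • u n - x = -(((n : ℝ) + 1)⁻¹ • (((n : ℝ) + 1) • x - u n)) := by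
      rw [smul_sub, inv_smul_smul₀ hn, neg_sub]
    rw [this, norm_neg, norm_smul, Real.norm_of_nonneg (by positivity)]
    exact mul_le_mul_of_nonneg_left (huC n) (by positivity)
  refine ge_of_tendsto ((Q.continuous_apply_self.tendsto x).comp hlim) (.of_forall fun n => ?_)
  simp only [Function.comp_apply, map_smul, LinearMap.smul_apply, smul_eq_mul]
  have := h _ (hu n)
  positivity

theorem exists_intPairing (N M' : Submodule ℤ V) (Q : LinearMap.BilinForm ℝ V)
    (h : ∀ u ∈ M', ∀ v ∈ N, ∃ z : ℤ, Q u v = z) :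
    ∃ lam : M' →ₗ[ℤ] Module.Dual ℤ N, ∀ (u : M') (v : N), Q (u : V) (v : V) = (lam u v : ℝ) := by
  choose f hf using fun (u : M') (v : N) => h u u.2 v v.2
  refine ⟨LinearMap.mk₂ ℤ f (fun a b c => ?_) (fun a b c => ?_) (fun a b c => ?_)
    (fun a b c => ?_), fun u v => hf u v⟩ <;> apply Int.cast_injective (α := ℝ)
  · simp [← hf]
  · simp [← hf]
  · simp [← hf]
  · simp [← hf]

/-- By Cauchy–Schwarz, isotropic vectors of a positive semidefinite form lie in its radical. -/
theorem apply_eq_zero_of_apply_self_eq_zero (Q : LinearMap.BilinForm ℝ V)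
    (hs : ∀ x y, Q x y = Q y x) (h : ∀ x, 0 ≤ Q x x) {x : V} (hx : Q x x = 0) (y : V) :
    Q x y = 0 := by
  have h1 := Q.apply_mul_apply_le_of_forall_zero_le h x y
  rw [hx, zero_mul, hs y x] at h1
  exact mul_self_eq_zero.1 (le_antisymm h1 (mul_self_nonneg _))

/-- A family of continuous, locally concave functions on `V`, quasi-periodic with respect to `M'`
with common integral factors of automorphy and not all varying linearly along a lattice vector,
yields a polarization. -/
theorem isTropicalAbelianVariety_of_theta [FiniteDimensional ℝ V]
    (N M' : Submodule ℤ V) [DiscreteTopology N] [IsZLattice ℝ N]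
    [DiscreteTopology M'] [IsZLattice ℝ M'] {κ : Type*} [Nonempty κ] (Θ : κ → V → ℝ)
    (hcont : ∀ k, Continuous (Θ k))
    (hconc : ∀ k v x, ∀ᶠ δ in 𝓝[>] (0 : ℝ), Θ k (v - δ • x) + Θ k (v + δ • x) ≤ 2 * Θ k v)
    (hper : ∀ u ∈ M', ∃ g ∈ integralAffineMaps N, ∀ v k, Θ k (v + u) = Θ k v + g v)
    (hsep : ∀ u ∈ M', u ≠ 0 → ∀ c : ℝ, ¬ ∀ t ∈ Icc (0 : ℝ) 1, ∀ k, Θ k (t • u) = Θ k 0 + t * c) :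
    IsTropicalAbelianVariety N M' := by
  classical
  have hline : ∀ k u, Continuous (fun t : ℝ => Θ k (t • u)) := fun k u =>
    (hcont k).comp (by fun_prop)
  have hlineconc : ∀ k u (t : ℝ), ∀ᶠ δ in 𝓝[>] (0 : ℝ),
      Θ k ((t - δ) • u) + Θ k ((t + δ) • u) ≤ 2 * Θ k (t • u) := fun k u t =>
    (hconc k (t • u) u).mono fun δ hδ => by rwa [sub_smul, add_smul]
  let k₀ : κ := Classical.arbitrary κ
  choose g hgN hg using fun u : M' => hper u u.2
  have hlin : ∀ u x y, g u (x + y) = g u x + (g u).linear y := fun u x y => by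
    have := (g u).map_vadd x y
    rw [vadd_eq_add, vadd_eq_add, add_comm] at this
    rw [this, add_comm]
  have hlin0 : ∀ u x, (g u).linear x = g u x - g u 0 := fun u x => by
    have := hlin u 0 x
    rw [zero_add] at this
    linarith
  -- The cocycle relation for translation by `u + u'`. Exchanging `u` and `u'` in it gives the
  -- symmetry `hsymm`, and taking linear parts gives the additivity used for `Λ`.
  have hadd : ∀ u u' v, g (u + u') v = g u (v + u') + g u' v := fun u u' v => by
    have h1 := hg (u + u') v k₀
    have h2 := hg u (v + u') k₀
    have h3 := hg u' v k₀
    rw [show v + ((u + u' : M') : V) = v + u' + u by push_cast; abel, h2, h3] at h1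
    linarith
  have hsymm : ∀ u u' : M', (g u).linear u' = (g u').linear u := fun u u' => by
    have h1 := hadd u u' 0
    have h2 := hadd u' u 0
    rw [add_comm u' u, h1, hlin, hlin] at h2
    linarith
  let Λ : M' →ₗ[ℤ] (V →ₗ[ℝ] ℝ) := (AddMonoidHom.mk' (fun u => (g u).linear) (fun u u' => by
    ext x
    rw [LinearMap.add_apply, hlin0, hlin0 u, hlin0 u', hadd, hadd, hlin, hlin]
    ring)).toIntLinearMap
  have hΛ : ∀ u, Λ u = (g u).linear := fun u => rfl
  have : Module.Finite ℤ M' := ZLattice.module_finite ℝ M'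
  have : Module.Free ℤ M' := ZLattice.module_free ℝ M'
  have : Module.Finite ℤ N := ZLattice.module_finite ℝ N
  have : Module.Free ℤ N := ZLattice.module_free ℝ N
  let bM := Module.finBasisOfFinrankEq ℤ M' (ZLattice.rank ℝ M')
  let bN := Module.finBasisOfFinrankEq ℤ N (ZLattice.rank ℝ N)
  let B := bM.ofZLatticeBasis ℝ M'
  let BN := bN.ofZLatticeBasis ℝ N
  have hB : ∀ i, B i = bM i := fun i => bM.ofZLatticeBasis_apply ℝ M' i
  have hBN : ∀ i, BN i = bN i := fun i => bN.ofZLatticeBasis_apply ℝ N i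
  -- The real extension of `-Λ`; the sign turns concavity of the `Θ k` into positivity.
  let Q : LinearMap.BilinForm ℝ V := -(B.constr ℝ (fun i => Λ (bM i)))
  have hQΛ : ∀ u : M', Q u = - Λ u := by
    have : (Q.restrictScalars ℤ).comp M'.subtype = -Λ := by
      refine bM.ext fun i => ?_
      simp only [LinearMap.comp_apply, Submodule.subtype_apply, LinearMap.restrictScalars_apply,
        LinearMap.neg_apply]
      rw [← hB]
      simp only [Q, LinearMap.neg_apply, Module.Basis.constr_basis]
    exact fun u => LinearMap.congr_fun this u
  have hQsymm : ∀ x y, Q x y = Q y x := by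
    have : Q = Q.flip := by
      refine LinearMap.BilinForm.ext_basis B fun i j => ?_
      show Q (B i) (B j) = Q (B j) (B i)
      rw [hB, hB, hQΛ, hQΛ, LinearMap.neg_apply, LinearMap.neg_apply, hΛ, hΛ, hsymm]
    intro x y
    conv_lhs => rw [this]
    rfl
  have hQnonneg : ∀ x, 0 ≤ Q x x := by
    refine nonneg_of_nonneg_on_lattice M' Q fun u hu => ?_
    -- The second difference of `Θ k₀` at `0` along `u` is `(g u).linear u = -Q u u`.
    have h1 := add_le_two_mul_of_locally_midpoint_concave (hline k₀ u) (hlineconc k₀ u)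
    have h2 := hg ⟨u, hu⟩ 0 k₀
    have h3 := hg ⟨u, hu⟩ (-u) k₀
    have h4 := hlin ⟨u, hu⟩ (-u) u
    simp only [neg_smul, one_smul, zero_smul, zero_add, neg_add_cancel] at h1 h2 h3 h4
    have h5 : Q u u = -((g ⟨u, hu⟩).linear u) := LinearMap.congr_fun (hQΛ ⟨u, hu⟩) u
    rw [h5]
    linarith
  have hQint : ∀ u ∈ M', ∀ v ∈ N, ∃ z : ℤ, Q u v = z := by
    intro u hu v hv
    obtain ⟨z, hz⟩ := hgN ⟨u, hu⟩ v hv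
    refine ⟨-z, ?_⟩
    have : Q u v = -((g ⟨u, hu⟩).linear v) := LinearMap.congr_fun (hQΛ ⟨u, hu⟩) v
    rw [this, hz, Int.cast_neg]
  obtain ⟨lam, hlam⟩ := exists_intPairing N M' Q hQint
  refine ⟨lam, Q, hQsymm, hlam, fun x hx => lt_of_le_of_ne (hQnonneg x) fun h0 => ?_⟩
  have hQx := apply_eq_zero_of_apply_self_eq_zero Q hQsymm hQnonneg h0.symm
  -- In `ℤ`-bases of `M'` and `N` the form has an integral matrix. A real vector in the radical
  -- makes its determinant vanish, and then there is also an integral kernel vector, that is, a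
  -- nonzero element of `M'` in the radical.
  let A : Matrix (Fin (Module.finrank ℝ V)) (Fin (Module.finrank ℝ V)) ℤ :=
    Matrix.of fun i j => lam (bM i) (bN j)
  have hAR : (A.map (fun z : ℤ => (z : ℝ))).det = 0 := by
    refine Matrix.exists_vecMul_eq_zero_iff.1 ⟨B.repr x, fun h => hx ?_, ?_⟩
    · exact B.repr.map_eq_zero_iff.1 (DFunLike.coe_injective h)
    · ext j
      have h1 := hQx (bN j : V)
      rw [← B.sum_repr x] at h1
      simp only [map_sum, map_smul, LinearMap.sum_apply, LinearMap.smul_apply, smul_eq_mul, hB,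
        hlam] at h1
      simpa [Matrix.vecMul, dotProduct, A] using h1
  have hA : A.det = 0 := by
    have : ((A.det : ℤ) : ℝ) = 0 := by
      rw [← hAR]
      exact (Int.castRingHom ℝ).map_det A
    exact_mod_cast this
  obtain ⟨y, hy, hyA⟩ := Matrix.exists_vecMul_eq_zero_iff.2 hA
  let u : M' := ∑ i, y i • bM i
  have hu : u ≠ 0 := fun h => hy (funext fun i => by
    have := congrArg (fun w => bM.repr w i) h
    simpa [u, Finsupp.single_apply] using this)
  have hΛu : Λ u = 0 := by
    refine BN.ext fun j => ?_
    have h1 : Q u (bN j) = -(Λ u (bN j)) := LinearMap.congr_fun (hQΛ u) (bN j)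
    rw [hlam] at h1
    have h2 : lam u (bN j) = 0 := by
      have := congrFun hyA j
      simpa [Matrix.vecMul, dotProduct, A, u] using this
    rw [h2] at h1
    rw [hBN, LinearMap.zero_apply]
    simpa using h1
  have hgc : ∀ v, g u v = g u 0 := fun v => by
    have := hlin0 u v
    rw [← hΛ, hΛu, LinearMap.zero_apply] at this
    linarith
  -- Translation by `u` adds the same constant to every `Θ k`, so all of them are affine along `u`
  -- with a common slope.
  refine hsep u u.2 (by simpa using hu) (g u 0) fun t ht k => ?_
  have := eq_of_locally_midpoint_concave (hline k u) (hlineconc k u) (c := g u 0)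
    (fun t => by rw [add_smul, one_smul, hg, hgc]) ht
  simpa using this

end Polarization

/-! ### Affine functions with integral linear part. -/

section IntegralAffine

variable {V : Type*} [NormedAddCommGroup V] [NormedSpace ℝ V]

theorem const_mem_integralAffineMaps (N : Submodule ℤ V) (c : ℝ) :
    AffineMap.const ℝ V c ∈ integralAffineMaps N := fun n _ => ⟨0, by simp⟩

theorem exists_integralAffineMaps_comp {N : Submodule ℤ V} {d : ℕ} {g : Fin d → V →ᵃ[ℝ] ℝ}
    (hg : ∀ i, g i ∈ integralAffineMaps N) (k : Fin d → ℤ) (c : ℝ) :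
    ∃ h ∈ integralAffineMaps N, ∀ w, h w = (fun i => (k i : ℝ)) ⬝ᵥ (fun i => g i w) + c := by
  refine ⟨∑ i, k i • g i + AffineMap.const ℝ V c, add_mem (sum_mem fun i _ =>
    zsmul_mem (hg i) _) (const_mem_integralAffineMaps N c), fun w => ?_⟩
  have h : ∀ s : Finset (Fin d), (∑ i ∈ s, k i • g i : V →ᵃ[ℝ] ℝ) w = ∑ i ∈ s, (k i : ℝ) * g i w := by
    intro s
    induction s using Finset.induction with
    | empty => simp
    | insert i s hi ih =>
      rw [Finset.sum_insert hi, Finset.sum_insert hi, ← ih, AffineMap.coe_add, Pi.add_apply]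
      congr 1
      simp
  rw [AffineMap.coe_add, Pi.add_apply, h]
  simp [dotProduct]

theorem exists_integralAffineMaps_coord (N : Submodule ℤ V) [FiniteDimensional ℝ V]
    [DiscreteTopology N] [IsZLattice ℝ N] {n : ℕ} (b : Module.Basis (Fin n) ℤ N) (i : Fin n) :
    ∃ g ∈ integralAffineMaps N, ∀ w, g w = (b.ofZLatticeBasis ℝ N).equivFun w i := by
  refine ⟨((b.ofZLatticeBasis ℝ N).coord i).toAffineMap, fun v hv => ⟨b.repr ⟨v, hv⟩ i, ?_⟩,
    fun w => rfl⟩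
  exact b.ofZLatticeBasis_repr_apply ℝ N ⟨v, hv⟩ i

end IntegralAffine

/-! ### Charts of the torus read on `V`. -/

namespace RealTorus

variable {V : Type u} [NormedAddCommGroup V] [NormedSpace ℝ V]

theorem continuous_mk (N M' : Submodule ℤ V) : Continuous (mk N M') :=
  QuotientAddGroup.continuous_mk

theorem isOpenMap_mk (N M' : Submodule ℤ V) : IsOpenMap (mk N M') :=
  QuotientAddGroup.isOpenMap_coe

theorem mk_surjective (N M' : Submodule ℤ V) : Function.Surjective (mk N M') :=
  QuotientAddGroup.mk_surjective

theorem mk_add_of_mem (N M' : Submodule ℤ V) (v : V) {u : V} (hu : u ∈ M') :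
    mk N M' (v + u) = mk N M' v := by
  rw [eq_comm, mk_eq_mk_iff]
  simpa using hu

variable [FiniteDimensional ℝ V] (N M' : Submodule ℤ V) [DiscreteTopology N] [IsZLattice ℝ N]

/-- The local inverse of `V → V / M'` over the image of an open set on which this map is
injective, followed by the coordinates with respect to a `ℤ`-basis of `N`. -/
noncomputable def stdHomeomorph {n : ℕ} (b : Module.Basis (Fin n) ℤ N) {W : Set V} (hW : IsOpen W)
    (hinj : InjOn (mk N M') W) : OpenPartialHomeomorph (RealTorus N M') (Fin n → ℝ) :=
  (OpenPartialHomeomorph.ofContinuousOpenRestrict (hinj.toPartialEquiv (mk N M') W)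
    (continuous_mk N M').continuousOn ((isOpenMap_mk N M').domRestrict hW) hW).symm.trans
    (b.ofZLatticeBasis ℝ N).equivFun.toContinuousLinearEquiv.toHomeomorph.toOpenPartialHomeomorph

/-- The standard chart attached to a `ℤ`-basis of `N` and an open set on which `V → V / M'` is
injective. -/
noncomputable abbrev stdChart {n : ℕ} (b : Module.Basis (Fin n) ℤ N) {W : Set V} (hW : IsOpen W)
    (hinj : InjOn (mk N M') W) : PolyhedralChart (RealTorus N M') where
  dim := n
  map := (stdHomeomorph N M' b hW hinj).toPartialEquiv
  isOpen_source := (stdHomeomorph N M' b hW hinj).open_source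
  continuousOn_map := (stdHomeomorph N M' b hW hinj).continuousOn
  continuousOn_symm := (stdHomeomorph N M' b hW hinj).continuousOn_symm
  target_polyhedral :=
    isOpenRationalPolyhedralSet_of_isOpen (stdHomeomorph N M' b hW hinj).open_target

variable {N M'} {n : ℕ} (b : Module.Basis (Fin n) ℤ N) {W : Set V} (hW : IsOpen W)
  (hinj : InjOn (mk N M') W)

theorem stdChart_source : (stdChart N M' b hW hinj).map.source = mk N M' '' W := by
  simp only [stdChart, stdHomeomorph, OpenPartialHomeomorph.trans_source,
    Homeomorph.toOpenPartialHomeomorph_source, preimage_univ, inter_univ]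
  rfl

theorem stdChart_map_mk {w : V} (hw : w ∈ W) :
    (stdChart N M' b hW hinj).map (mk N M' w) = (b.ofZLatticeBasis ℝ N).equivFun w := by
  have h : (OpenPartialHomeomorph.ofContinuousOpenRestrict (hinj.toPartialEquiv (mk N M') W)
    (continuous_mk N M').continuousOn ((isOpenMap_mk N M').domRestrict hW) hW).symm
      (mk N M' w) = w := (OpenPartialHomeomorph.ofContinuousOpenRestrict
      (hinj.toPartialEquiv (mk N M') W) (continuous_mk N M').continuousOn
      ((isOpenMap_mk N M').domRestrict hW) hW).left_inv (x := w) hw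
  show (b.ofZLatticeBasis ℝ N).equivFun ((OpenPartialHomeomorph.ofContinuousOpenRestrict
    (hinj.toPartialEquiv (mk N M') W) (continuous_mk N M').continuousOn
    ((isOpenMap_mk N M').domRestrict hW) hW).symm (mk N M' w)) = _
  rw [h]

theorem stdChart_isStandardChart : IsStandardChart N M' (stdChart N M' b hW hinj) :=
  ⟨b, W, hW, hinj, stdChart_source b hW hinj, fun _ hw => stdChart_map_mk b hW hinj hw⟩

theorem stdChart_target : (stdChart N M' b hW hinj).map.target =
    (b.ofZLatticeBasis ℝ N).equivFun.symm ⁻¹' W := by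
  rw [← (stdChart N M' b hW hinj).map.image_source_eq_target, stdChart_source, image_image]
  ext y
  constructor
  · rintro ⟨w, hw, rfl⟩
    show (b.ofZLatticeBasis ℝ N).equivFun.symm ((stdChart N M' b hW hinj).map (mk N M' w)) ∈ W
    rwa [stdChart_map_mk b hW hinj hw, LinearEquiv.symm_apply_apply]
  · intro hy
    exact ⟨_, hy, (stdChart_map_mk b hW hinj hy).trans (LinearEquiv.apply_symm_apply _ _)⟩

theorem stdChart_symm_apply {y : Fin n → ℝ} (hy : (b.ofZLatticeBasis ℝ N).equivFun.symm y ∈ W) :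
    (stdChart N M' b hW hinj).map.symm y = mk N M' ((b.ofZLatticeBasis ℝ N).equivFun.symm y) := by
  have h := stdChart_map_mk b hW hinj hy
  rw [LinearEquiv.apply_symm_apply] at h
  have hs : mk N M' ((b.ofZLatticeBasis ℝ N).equivFun.symm y) ∈
      (stdChart N M' b hW hinj).map.source := by
    rw [stdChart_source]
    exact mem_image_of_mem _ hy
  rw [← (stdChart N M' b hW hinj).map.left_inv hs, h]

/-- Every chart of a real torus, read on the universal covering, is locally given by affine
functions that are integral on `N`. -/
theorem exists_chart_comp_mk [DiscreteTopology M'] {A : Set (PolyhedralChart (RealTorus N M'))}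
    (hA : IsAtlasOf (RealTorus N M') A) {c : PolyhedralChart (RealTorus N M')} (hc : c ∈ A) {v : V}
    (hv : mk N M' v ∈ c.map.source) :
    ∃ g : Fin c.dim → V →ᵃ[ℝ] ℝ, (∀ i, g i ∈ integralAffineMaps N) ∧
      ∀ᶠ w in 𝓝 v, c.map (mk N M' w) = fun i => g i w := by
  obtain ⟨W, hW, hvW, hinj⟩ := exists_injOn N M' v
  have : Module.Finite ℤ N := ZLattice.module_finite ℝ N
  have : Module.Free ℤ N := ZLattice.module_free ℝ N
  let b := Module.finBasis ℤ N
  let c₀ := stdChart N M' b hW hinj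
  have hc₀ : c₀ ∈ A ∪ RationalPolyhedralSpace.refAtlas := .inr (stdChart_isStandardChart b hW hinj)
  have hs : ∀ w ∈ W, mk N M' w ∈ c₀.map.source := fun w hw => by
    rw [stdChart_source]
    exact mem_image_of_mem _ hw
  obtain ⟨O, hO, hvO, F, ⟨A, β, rfl⟩, hF⟩ := hA.2.transition c (.inl hc) c₀ hc₀
    (c₀.map (mk N M' v)) (mem_image_of_mem _ ⟨hv, hs v hvW⟩)
  choose e he he' using exists_integralAffineMaps_coord N b
  choose g hg hg' using fun i => exists_integralAffineMaps_comp he (A i) (β i)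
  refine ⟨g, hg, ?_⟩
  have h1 : ∀ᶠ w in 𝓝 v, mk N M' w ∈ c.map.source :=
    (continuous_mk N M').continuousAt.eventually (c.isOpen_source.mem_nhds hv)
  have h2 : ∀ᶠ w in 𝓝 v, c₀.map (mk N M' w) ∈ O := by
    have : ContinuousAt (fun w => c₀.map (mk N M' w)) v :=
      (c₀.continuousOn_map.continuousAt (c₀.isOpen_source.mem_nhds (hs v hvW))).comp
        (continuous_mk N M').continuousAt
    exact this.eventually (hO.mem_nhds hvO)
  filter_upwards [h1, h2, hW.mem_nhds hvW] with w h1 h2 h3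
  have h4 := hF ⟨h2, mem_image_of_mem _ ⟨h1, hs w h3⟩⟩
  rw [Function.comp_apply, c₀.map.left_inv (hs w h3), stdChart_map_mk b hW hinj h3] at h4
  rw [h4]
  ext i
  rw [hg']
  simp only [zAffine, Pi.add_apply, Matrix.mulVec, he']
  rfl

end RealTorus

/-! ### Sections pulled back to `V`; an injective map yields a polarization. -/

namespace TropicalLineBundle

open RealTorus

variable {V : Type u} [NormedAddCommGroup V] [NormedSpace ℝ V] [FiniteDimensional ℝ V]
  {N M' : Submodule ℤ V} [DiscreteTopology N] [IsZLattice ℝ N] [DiscreteTopology M']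

/-- A section of a line bundle in a chart of the bundle, pulled back to `V`. -/
noncomputable def pullback (L : TropicalLineBundle (RealTorus N M')) (s : RealTorus N M' → L.Total)
    (c : LineBundleChart L.proj) (v : V) : ℝ :=
  (c.triv (s (RealTorus.mk N M' v))).2.untopD 0

variable (L : TropicalLineBundle (RealTorus N M'))

/-- Such a section is finite over the chart, so the default value `0` in `pullback` does not
intervene there. -/
theorem coe_pullback {s : RealTorus N M' → L.Total} (hs : s ∈ L.nontrivialRegularSections)
    {c : LineBundleChart L.proj} (hc : c ∈ L.atlas) {v : V}
    (hv : RealTorus.mk N M' v ∈ c.chart.map.source) :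
    (L.pullback s c v : TropNum) = (c.triv (s (RealTorus.mk N M' v))).2 := by
  have h := L.value_ne_top hs hc hv
  rw [pullback]
  lift (c.triv (s (RealTorus.mk N M' v))).2 to ℝ using h with r
  rfl

/-- The order of quantifiers matters: `g` and the neighbourhood come from the transition map of the
bundle and serve all sections at once, so that one correction globalizes them simultaneously. -/
theorem exists_pullback_eq_add {c c' : LineBundleChart L.proj} (hc : c ∈ L.atlas)
    (hc' : c' ∈ L.atlas) {v : V} (hv : RealTorus.mk N M' v ∈ c.chart.map.source)
    (hv' : RealTorus.mk N M' v ∈ c'.chart.map.source) :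
    ∃ g ∈ integralAffineMaps N, ∀ᶠ w in 𝓝 v, ∀ s : L.nontrivialRegularSections,
      L.pullback s c w = L.pullback s c' w + g w := by
  obtain ⟨t, ht, hct⟩ := L.transition c hc c' hc' ⟨_, hv, hv'⟩
  obtain ⟨g, hg, hgc⟩ := exists_chart_comp_mk L.isAtlas (mem_image_of_mem _ hc') hv'
  obtain ⟨O, hO, hvO, F, ⟨A, β, rfl⟩, hF⟩ := ht _ (mem_image_of_mem _ ⟨hv, hv'⟩)
  obtain ⟨h, hh, hh'⟩ := exists_integralAffineMaps_comp hg (A 0) (β 0)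
  refine ⟨h, hh, ?_⟩
  have h1 : ∀ᶠ w in 𝓝 v, RealTorus.mk N M' w ∈ c.chart.map.source :=
    (continuous_mk N M').continuousAt.eventually (c.chart.isOpen_source.mem_nhds hv)
  have h1' : ∀ᶠ w in 𝓝 v, RealTorus.mk N M' w ∈ c'.chart.map.source :=
    (continuous_mk N M').continuousAt.eventually (c'.chart.isOpen_source.mem_nhds hv')
  have h2 : ∀ᶠ w in 𝓝 v, c'.chart.map (RealTorus.mk N M' w) ∈ O := by
    have : ContinuousAt (fun w => c'.chart.map (RealTorus.mk N M' w)) v :=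
      (c'.chart.continuousOn_map.continuousAt (c'.chart.isOpen_source.mem_nhds hv')).comp
        (continuous_mk N M').continuousAt
    exact this.eventually (hO.mem_nhds hvO)
  filter_upwards [h1, h1', h2, hgc] with w h1 h1' h2 h3 s
  have h4 : t (c'.chart.map (RealTorus.mk N M' w)) = h w := by
    have h5 := congrFun (hF ⟨h2, mem_image_of_mem _ ⟨h1, h1'⟩⟩) 0
    refine h5.trans ?_
    rw [h3, hh']
    rfl
  have hp : L.proj (s.1 (RealTorus.mk N M' w)) = RealTorus.mk N M' w := s.2.1.1 _
  have hmem : s.1 (RealTorus.mk N M' w) ∈ c'.triv.source := by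
    rw [c'.triv.mem_source, hp, c'.baseSet_eq]
    exact h1'
  have h6 : c'.triv (s.1 (RealTorus.mk N M' w)) = (RealTorus.mk N M' w, (c'.triv (s.1 (RealTorus.mk N M' w))).2) := by
    refine Prod.ext ?_ rfl
    rw [c'.triv.coe_fst hmem, hp]
  have h7 : c'.triv.toOpenPartialHomeomorph.symm (RealTorus.mk N M' w, (c'.triv (s.1 (RealTorus.mk N M' w))).2) =
      s.1 (RealTorus.mk N M' w) := by
    rw [← h6]
    exact c'.triv.toOpenPartialHomeomorph.left_inv hmem
  have h8 := congrArg Prod.snd (hct _ ⟨h1, h1'⟩ (c'.triv (s.1 (RealTorus.mk N M' w))).2)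
  rw [h7, h4, ← L.coe_pullback s.2 hc h1, ← L.coe_pullback s.2 hc' h1'] at h8
  exact WithTop.coe_injective h8

/-- Near `v` the chart is affine on `V`, and concavity is preserved by composition with an affine
map. -/
theorem exists_concaveOn_pullback {s : RealTorus N M' → L.Total}
    (hs : s ∈ L.nontrivialRegularSections) {c : LineBundleChart L.proj} (hc : c ∈ L.atlas) {v : V}
    (hv : RealTorus.mk N M' v ∈ c.chart.map.source) :
    ∃ ε > 0, ConcaveOn ℝ (Metric.ball v ε) (L.pullback s c) := by
  obtain ⟨f, hf, hconc, -⟩ := (hs.1.2.resolve_left hs.2) c hc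
  obtain ⟨g, hg, hgc⟩ := exists_chart_comp_mk L.isAtlas (mem_image_of_mem _ hc) hv
  obtain ⟨O, hO, hvO, C, hC, F, hF, hfF⟩ := hconc _ (c.chart.map.map_source hv)
  have h1 : ∀ᶠ w in 𝓝 v, RealTorus.mk N M' w ∈ c.chart.map.source :=
    (continuous_mk N M').continuousAt.eventually (c.chart.isOpen_source.mem_nhds hv)
  have h2 : ∀ᶠ w in 𝓝 v, c.chart.map (RealTorus.mk N M' w) ∈ O := by
    have : ContinuousAt (fun w => c.chart.map (RealTorus.mk N M' w)) v :=
      (c.chart.continuousOn_map.continuousAt (c.chart.isOpen_source.mem_nhds hv)).comp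
        (continuous_mk N M').continuousAt
    exact this.eventually (hO.mem_nhds hvO)
  obtain ⟨ε, hε, h⟩ := Metric.eventually_nhds_iff_ball.1 ((h1.and h2).and hgc)
  have hmem : ∀ w ∈ Metric.ball v ε, (fun i => g i w) ∈ C ∧
      L.pullback s c w = F (fun i => g i w) := by
    intro w hw
    obtain ⟨⟨h1, h2⟩, h3⟩ := h w hw
    rw [← h3]
    have h4 := c.chart.map.map_source h1
    refine ⟨hC ⟨h2, h4⟩, ?_⟩
    rw [← hfF ⟨h2, h4⟩]
    have h5 := hf _ h4
    rw [inChart, c.chart.map.left_inv h1, ← L.coe_pullback hs hc h1] at h5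
    exact_mod_cast h5
  refine ⟨ε, hε, convex_ball v ε, fun x hx y hy a b ha hb hab => ?_⟩
  have hxy := convex_ball v ε hx hy ha hb hab
  rw [(hmem x hx).2, (hmem y hy).2, (hmem _ hxy).2]
  have : (fun i => g i (a • x + b • y)) = a • (fun i => g i x) + b • (fun i => g i y) := by
    ext i
    exact Convex.combo_affine_apply hab
  rw [this]
  exact hF.2 (hmem x hx).1 (hmem y hy).1 ha hb hab

/-- The pullbacks in the bundle charts glue to global `Θ k`, up to integral affine functions common
to all `k`. Such functions affect neither local concavity nor the projective point, so the `Θ k`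
satisfy the hypotheses of `isTropicalAbelianVariety_of_theta`, with separation coming from
injectivity. -/
theorem isTropicalAbelianVariety_of_injective [IsZLattice ℝ M'] {m : ℕ}
    (s : Fin (m + 1) → L.nontrivialRegularSections) (hinj : Function.Injective (L.toTP s)) :
    IsTropicalAbelianVariety N M' := by
  have hopen : ∀ c : L.atlas, IsOpen (RealTorus.mk N M' ⁻¹' c.1.chart.map.source) := fun c =>
    c.1.chart.isOpen_source.preimage (continuous_mk N M')
  have hcov : ∀ v, ∃ c : L.atlas, v ∈ RealTorus.mk N M' ⁻¹' c.1.chart.map.source := fun v => by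
    obtain ⟨c, hc, hv⟩ := L.exists_chart (RealTorus.mk N M' v)
    exact ⟨⟨c, hc⟩, hv⟩
  obtain ⟨Θ, hΘ⟩ := exists_global_of_local (integralAffineMaps N)
    (fun c : L.atlas => RealTorus.mk N M' ⁻¹' c.1.chart.map.source) hopen hcov
    (fun (k : Fin (m + 1)) c => L.pullback (s k) c) (fun c c' v hc hc' => by
      obtain ⟨g, hg, h⟩ := L.exists_pullback_eq_add c.2 c'.2 hc hc'
      exact ⟨g, hg, h.mono fun w hw k => hw (s k)⟩)
  have hconc : ∀ k v, ∃ ε > 0, ConcaveOn ℝ (Metric.ball v ε) (Θ k) := by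
    intro k v
    obtain ⟨c, hc⟩ := hcov v
    obtain ⟨ε, hε, h⟩ := L.exists_concaveOn_pullback (s k).2 c.2 hc
    obtain ⟨g, -, hg⟩ := hΘ c v hc
    obtain ⟨ε', hε', h'⟩ := Metric.eventually_nhds_iff_ball.1 hg
    refine ⟨min ε ε', lt_min hε hε', ConcaveOn.congr (f := L.pullback (s k) c + ⇑g) ?_ ?_⟩
    · refine (h.subset (Metric.ball_subset_ball (min_le_left _ _)) (convex_ball _ _)).add ?_
      refine ⟨convex_ball _ _, fun x _ y _ a b _ _ hab => ?_⟩
      rw [Convex.combo_affine_apply hab]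
    · intro w hw
      exact (h' w (Metric.ball_subset_ball (min_le_right _ _) hw) k).symm
  have htoTP : ∀ v, L.toTP s (RealTorus.mk N M' v) =
      TropicalProjectiveSpace.mk (fun k => (Θ k v : TropNum)) ⟨0, WithTop.coe_ne_top⟩ := by
    intro v
    obtain ⟨c, hc⟩ := hcov v
    obtain ⟨g, -, hg⟩ := hΘ c v hc
    rw [L.toTP_eq s c.2 hc]
    refine Quotient.sound ⟨g v, fun k => ?_⟩
    show (Θ k v : TropNum) = (g v : TropNum) + (c.1.triv ((s k).1 (RealTorus.mk N M' v))).2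
    rw [← L.coe_pullback (s k).2 c.2 hc, hg.self_of_nhds k, add_comm, WithTop.coe_add]
  refine isTropicalAbelianVariety_of_theta N M' Θ (fun k => ?_) (fun k v x => ?_) (fun u hu => ?_)
    (fun u hu hu0 c hlin => ?_)
  · refine continuous_iff_continuousAt.2 fun v => ?_
    obtain ⟨ε, hε, h⟩ := hconc k v
    exact (h.continuousOn Metric.isOpen_ball).continuousAt (Metric.ball_mem_nhds v hε)
  · obtain ⟨ε, hε, h⟩ := hconc k v
    have h1 : ∀ᶠ δ : ℝ in 𝓝[>] 0, v - δ • x ∈ Metric.ball v ε := nhdsWithin_le_nhds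
      ((Continuous.continuousAt (f := fun δ : ℝ => v - δ • x) (by fun_prop)).eventually
        (Metric.isOpen_ball.mem_nhds (by simpa using hε)))
    have h2 : ∀ᶠ δ : ℝ in 𝓝[>] 0, v + δ • x ∈ Metric.ball v ε := nhdsWithin_le_nhds
      ((Continuous.continuousAt (f := fun δ : ℝ => v + δ • x) (by fun_prop)).eventually
        (Metric.isOpen_ball.mem_nhds (by simpa using hε)))
    filter_upwards [h1, h2] with δ h1 h2
    have h3 := h.2 h1 h2 (show (0 : ℝ) ≤ 1 / 2 by norm_num) (show (0 : ℝ) ≤ 1 / 2 by norm_num)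
      (by norm_num)
    have h4 : (1 / 2 : ℝ) • (v - δ • x) + (1 / 2 : ℝ) • (v + δ • x) = v := by
      module
    rw [h4, smul_eq_mul, smul_eq_mul] at h3
    linarith
  · refine exists_shift_of_local _ Θ u fun v => ?_
    obtain ⟨c, hc⟩ := hcov v
    have hc' : v + u ∈ RealTorus.mk N M' ⁻¹' c.1.chart.map.source := by
      rw [mem_preimage, mk_add_of_mem N M' v hu]
      exact hc
    obtain ⟨g, hgN, hg⟩ := hΘ c v hc
    obtain ⟨g', hgN', hg'⟩ := hΘ c (v + u) hc'
    -- The pullback in a fixed chart is periodic, so only the corrections differ: `g'` evaluated at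
    -- `w + u` against `g` at `w`.
    refine ⟨g' + AffineMap.const ℝ V (g'.linear u) - g,
      sub_mem (add_mem hgN' (const_mem_integralAffineMaps N _)) hgN, ?_⟩
    have hev : ∀ᶠ w in 𝓝 v, ∀ k, Θ k (w + u) = L.pullback (s k) c (w + u) + g' (w + u) :=
      (Continuous.continuousAt (f := fun w => w + u) (by fun_prop)).eventually hg'
    filter_upwards [hg, hev] with w h1 h2 k
    have h3 : L.pullback (s k) c (w + u) = L.pullback (s k) c w := by
      rw [pullback, mk_add_of_mem N M' w hu, pullback]
    have h4 : g' (w + u) = g' w + g'.linear u := by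
      have := g'.map_vadd w u
      rw [vadd_eq_add, vadd_eq_add, add_comm] at this
      rw [this, add_comm]
    rw [h1, h2, h3, h4]
    simp only [AffineMap.coe_sub, AffineMap.coe_add, Pi.sub_apply, Pi.add_apply,
      AffineMap.const_apply]
    ring
  -- Adding `t * c` to all coordinates fixes the projective point, so the whole segment has one
  -- image, although small multiples of `u` remain distinct from `0` in the torus.
  · have hmk : ∀ t ∈ Icc (0 : ℝ) 1, RealTorus.mk N M' (t • u) = RealTorus.mk N M' 0 := by
      intro t ht
      refine hinj ?_
      rw [htoTP, htoTP]
      symm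
      refine Quotient.sound ⟨t * c, fun k => ?_⟩
      show (Θ k (t • u) : TropNum) = ((t * c : ℝ) : TropNum) + (Θ k 0 : TropNum)
      rw [hlin t ht k, add_comm, WithTop.coe_add]
    obtain ⟨W, hW, h0, hWinj⟩ := exists_injOn N M' (0 : V)
    have h1 : ∀ᶠ t : ℝ in 𝓝[>] 0, t • u ∈ W := nhdsWithin_le_nhds
      ((Continuous.continuousAt (f := fun t : ℝ => t • u) (by fun_prop)).eventually
        (hW.mem_nhds (by simpa using h0)))
    obtain ⟨t, ht, ht0, ht1⟩ := (h1.and (Ioo_mem_nhdsGT (zero_lt_one' ℝ))).exists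
    have := hWinj ht h0 (hmk t ⟨ht0.le, ht1.le⟩)
    exact (smul_ne_zero ht0.ne' hu0) this

end TropicalLineBundle

/-! ## Tropical projective space and translation of tropical numbers -/

theorem continuous_tropNum_add : Continuous fun p : TropNum × ℝ => p.1 + (p.2 : TropNum) := by
  refine continuous_iff_continuousAt.2 fun ⟨a, r⟩ => ?_
  induction a using WithTop.recTopCoe with
  | top =>
    rw [ContinuousAt, top_add, WithTop.tendsto_nhds_top_iff]
    intro c
    have h1 : ∀ᶠ p : TropNum × ℝ in 𝓝 (⊤, r), ((c - (r - 1) : ℝ) : TropNum) < p.1 :=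
      (continuous_fst.tendsto (⊤, r)).eventually (lt_mem_nhds (WithTop.coe_lt_top _))
    have h2 : ∀ᶠ p : TropNum × ℝ in 𝓝 (⊤, r), r - 1 < p.2 :=
      (continuous_snd.tendsto ((⊤ : TropNum), r)).eventually (lt_mem_nhds (sub_one_lt r))
    filter_upwards [h1, h2] with ⟨a, s⟩ h1 h2
    induction a using WithTop.recTopCoe with
    | top => simp
    | coe a =>
      have h1 : c - (r - 1) < a := WithTop.coe_lt_coe.1 h1
      have h2 : r - 1 < s := h2
      show (c : TropNum) < (a : TropNum) + (s : TropNum)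
      rw [← WithTop.coe_add, WithTop.coe_lt_coe]
      linarith
  | coe a =>
    have h := (WithTop.isOpenEmbedding_coe (ι := ℝ)).prodMap (.id : IsOpenEmbedding (id : ℝ → ℝ))
    refine (h.continuousAt_iff (x := (a, r))).1 ?_
    have : (fun p : TropNum × ℝ => p.1 + (p.2 : TropNum)) ∘ Prod.map ((↑) : ℝ → TropNum) id =
        fun p : ℝ × ℝ => ((p.1 + p.2 : ℝ) : TropNum) := by
      ext1 p
      simp
    rw [this]
    exact (WithTop.continuous_coe.comp continuous_add).continuousAt

namespace TropicalProjectiveSpace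

variable {m : ℕ}

/-- The default in `untopD` is harmless, since all entries are required to be finite. -/
theorem mk_eq_ofAffine_iff (a : Fin (m + 1) → TropNum) (h : ∃ i, a i ≠ ⊤) (o : Fin m → ℝ) :
    mk a h = ofAffine o ↔
      (∀ i, a i ≠ ⊤) ∧ ∀ i : Fin m, (a i.succ).untopD 0 - (a 0).untopD 0 = o i := by
  constructor
  · intro he
    obtain ⟨c, hc⟩ := Quotient.exact he.symm
    have h0 : a 0 = (c : TropNum) := by simpa using hc 0
    have h1 : ∀ i : Fin m, a i.succ = ((c + o i : ℝ) : TropNum) := fun i => by simpa using hc i.succ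
    constructor
    · intro i
      refine Fin.cases ?_ (fun i => ?_) i
      · rw [h0]
        exact WithTop.coe_ne_top
      · rw [h1]
        exact WithTop.coe_ne_top
    · intro i
      rw [h0, h1]
      simp
  · rintro ⟨h1, h2⟩
    lift a to Fin (m + 1) → ℝ using h1
    symm
    refine Quotient.sound ⟨a 0, Fin.cases ?_ fun i => ?_⟩
    · simp
    · have := h2 i
      simp only [WithTop.untopD_coe] at this
      show ((a i.succ : ℝ) : TropNum) = (a 0 : TropNum) + ((o i : ℝ) : TropNum)
      rw [← WithTop.coe_add, ← this]
      simp

/-- Tuples without infinite entries form an open set on which the differences with the zeroth entry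
are continuous; the cone over the image of an open set is therefore open. -/
theorem isOpenEmbedding_ofAffine : IsOpenEmbedding (ofAffine (m := m)) := by
  refine .of_continuous_injective_isOpenMap ?_ ?_ ?_
  · refine continuous_quotient_mk'.comp (Continuous.subtype_mk (continuous_pi fun i => ?_) _)
    refine Fin.cases ?_ (fun i => ?_) i
    · exact continuous_const
    · exact WithTop.continuous_coe.comp (continuous_apply i)
  · intro a a' h
    have := ((mk_eq_ofAffine_iff _ _ a').1 h).2
    ext i
    simpa using this i
  · intro O hO
    let T : Set {a : Fin (m + 1) → TropNum // ∃ i, a i ≠ ⊤} := {a | ∀ i, a.1 i ≠ ⊤}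
    have hT : IsOpen T := by
      have : T = ⋂ i, (fun a : {a : Fin (m + 1) → TropNum // ∃ i, a i ≠ ⊤} => a.1 i) ⁻¹' {⊤}ᶜ := by
        ext a
        simp [T]
      rw [this]
      exact isOpen_iInter_of_finite fun i => isOpen_compl_singleton.preimage
        ((continuous_apply i).comp continuous_subtype_val)
    let ρ : {a : Fin (m + 1) → TropNum // ∃ i, a i ≠ ⊤} → (Fin m → ℝ) :=
      fun a i => (a.1 i.succ).untopD 0 - (a.1 0).untopD 0
    have hρ : ContinuousOn ρ T := by
      have h : ∀ i, ContinuousOn (fun a : {a : Fin (m + 1) → TropNum // ∃ i, a i ≠ ⊤} =>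
          (a.1 i).untopD 0) T := fun i =>
        (WithTop.continuousOn_untopD (0 : ℝ)).comp
          ((continuous_apply i).comp continuous_subtype_val).continuousOn fun a ha => ha i
      exact continuousOn_pi.2 fun i => (h _).sub (h _)
    have hopen := hρ.isOpen_inter_preimage hT hO
    have hset : (Quotient.mk (tropProjSetoid m)) ⁻¹' (ofAffine '' O) = T ∩ ρ ⁻¹' O := by
      ext ⟨a, ha⟩
      constructor
      · rintro ⟨o, ho, he⟩
        obtain ⟨h1, h2⟩ := (mk_eq_ofAffine_iff a ha o).1 he.symm
        refine ⟨h1, ?_⟩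
        have : ρ ⟨a, ha⟩ = o := funext h2
        rwa [mem_preimage, this]
      · rintro ⟨h1, h2⟩
        exact ⟨_, h2, ((mk_eq_ofAffine_iff a ha _).2 ⟨h1, fun i => rfl⟩).symm⟩
    rw [← hset] at hopen
    exact hopen

end TropicalProjectiveSpace

/-- The trivialization of `X × 𝕋` over an open set `U`, twisted by a function on `U`. -/
noncomputable def twistedTrivialization {X : Type u} [TopologicalSpace X] {U : Set X}
    (hU : IsOpen U) {g : X → ℝ} (hg : ContinuousOn g U) :
    Bundle.Trivialization TropNum (Prod.fst : X × TropNum → X) where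
  toFun p := (p.1, p.2 + (g p.1 : TropNum))
  invFun p := (p.1, p.2 + ((-g p.1 : ℝ) : TropNum))
  source := Prod.fst ⁻¹' U
  target := U ×ˢ univ
  map_source' p hp := ⟨hp, mem_univ _⟩
  map_target' p hp := hp.1
  left_inv' p _ := by
    refine Prod.ext rfl ?_
    simp only [add_assoc, ← WithTop.coe_add, add_neg_cancel, WithTop.coe_zero, add_zero]
  right_inv' p _ := by
    refine Prod.ext rfl ?_
    simp only [add_assoc, ← WithTop.coe_add, neg_add_cancel, WithTop.coe_zero, add_zero]
  open_source := hU.preimage continuous_fst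
  open_target := hU.prod isOpen_univ
  continuousOn_toFun := by
    have h : ContinuousOn (fun p : X × TropNum => g p.1) (Prod.fst ⁻¹' U) :=
      hg.comp continuousOn_fst fun p hp => hp
    exact continuousOn_fst.prodMk
      (continuous_tropNum_add.comp_continuousOn (continuousOn_snd.prodMk h))
  continuousOn_invFun := by
    have h : ContinuousOn (fun p : X × TropNum => -g p.1) (U ×ˢ univ) :=
      (hg.comp continuousOn_fst fun p hp => hp.1).neg
    exact continuousOn_fst.prodMk
      (continuous_tropNum_add.comp_continuousOn (continuousOn_snd.prodMk h))
  baseSet := U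
  open_baseSet := hU
  source_eq := rfl
  target_eq := rfl
  proj_toFun _ _ := rfl

/-! ### The line bundle attached to a quasi-periodic function. -/

namespace RealTorus

variable {V : Type u} [NormedAddCommGroup V] [NormedSpace ℝ V] [FiniteDimensional ℝ V]
  (N M' : Submodule ℤ V) [DiscreteTopology N] [IsZLattice ℝ N]

/-- A large closed ball meets every coset of `M'`. Compactness later turns an injective continuous
map to `ℝᵐ` into an embedding. -/
instance [DiscreteTopology M'] [IsZLattice ℝ M'] : CompactSpace (RealTorus N M') := by
  obtain ⟨C, hC⟩ := ZLattice.exists_mem_norm_sub_le M'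
  have : ProperSpace V := FiniteDimensional.proper ℝ V
  refine ⟨?_⟩
  have h : mk N M' '' Metric.closedBall 0 C = univ := by
    refine eq_univ_of_forall fun x => ?_
    obtain ⟨v, rfl⟩ := mk_surjective N M' x
    obtain ⟨u, hu, huC⟩ := hC v
    refine ⟨v - u, by simpa using huC, ?_⟩
    rw [sub_eq_add_neg, mk_add_of_mem N M' v (neg_mem hu)]
  rw [← h]
  exact (isCompact_closedBall _ _).image (continuous_mk N M')

variable {N M'} {n : ℕ} (b : Module.Basis (Fin n) ℤ N)

/-- The standard charts with respect to a fixed basis, over the members of a family of open sets. -/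
def stdCharts (b : Module.Basis (Fin n) ℤ N) (M' : Submodule ℤ V) (P : Set V → Prop) :
    Set (PolyhedralChart (RealTorus N M')) :=
  {c | ∃ (W : Set V) (hW : IsOpen W) (hinj : InjOn (mk N M') W), P W ∧
    c = stdChart N M' b hW hinj}

theorem isAtlasOf_stdCharts [DiscreteTopology M'] {P : Set V → Prop}
    (hP : ∀ v, ∃ W, IsOpen W ∧ v ∈ W ∧ InjOn (mk N M') W ∧ P W) :
    IsAtlasOf (RealTorus N M') (stdCharts b M' P) := by
  have hsub : stdCharts b M' P ⊆ RationalPolyhedralSpace.refAtlas := by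
    rintro c ⟨W, hW, hinj, -, rfl⟩
    exact stdChart_isStandardChart b hW hinj
  refine ⟨⟨fun x => ?_, fun c hc c' hc' => ?_⟩, ?_⟩
  · obtain ⟨v, rfl⟩ := mk_surjective N M' x
    obtain ⟨W, hW, hv, hinj, hPW⟩ := hP v
    refine ⟨_, ⟨W, hW, hinj, hPW, rfl⟩, ?_⟩
    rw [stdChart_source]
    exact mem_image_of_mem _ hv
  · exact (standardCharts_isAtlas N M').transition c (hsub hc) c' (hsub hc')
  · rw [union_eq_self_of_subset_left hsub]
    exact RationalPolyhedralSpace.isAtlas_refAtlas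

/-- The chart of `X × 𝕋` over a standard chart, twisted by a function on `V`. -/
noncomputable def twistedChart {g : V → ℝ} (hg : Continuous g) {W : Set V} (hW : IsOpen W)
    (hinj : InjOn (mk N M') W) :
    LineBundleChart (Prod.fst : RealTorus N M' × TropNum → RealTorus N M') where
  chart := stdChart N M' b hW hinj
  triv := twistedTrivialization (stdChart N M' b hW hinj).isOpen_source
    (g := fun x => g ((b.ofZLatticeBasis ℝ N).equivFun.symm ((stdChart N M' b hW hinj).map x)))
    ((hg.comp (LinearMap.continuous_of_finiteDimensional
      (b.ofZLatticeBasis ℝ N).equivFun.symm.toLinearMap)).comp_continuousOn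
      (stdChart N M' b hW hinj).continuousOn_map)
  baseSet_eq := rfl

theorem twistedChart_triv_mk {g : V → ℝ} (hg : Continuous g) {W : Set V} (hW : IsOpen W)
    (hinj : InjOn (mk N M') W) {w : V} (hw : w ∈ W) (a : TropNum) :
    (twistedChart b hg hW hinj).triv (mk N M' w, a) = (mk N M' w, a + (g w : TropNum)) := by
  show (mk N M' w, a + (g ((b.ofZLatticeBasis ℝ N).equivFun.symm
    ((stdChart N M' b hW hinj).map (mk N M' w))) : TropNum)) = _
  rw [stdChart_map_mk b hW hinj hw, LinearEquiv.symm_apply_apply]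

theorem twistedChart_triv_symm_mk {g : V → ℝ} (hg : Continuous g) {W : Set V} (hW : IsOpen W)
    (hinj : InjOn (mk N M') W) {w : V} (hw : w ∈ W) (a : TropNum) :
    (twistedChart b hg hW hinj).triv.toOpenPartialHomeomorph.symm (mk N M' w, a) =
      (mk N M' w, a + ((-g w : ℝ) : TropNum)) := by
  show (mk N M' w, a + ((-g ((b.ofZLatticeBasis ℝ N).equivFun.symm
    ((stdChart N M' b hW hinj).map (mk N M' w))) : ℝ) : TropNum)) = _
  rw [stdChart_map_mk b hW hinj hw, LinearEquiv.symm_apply_apply]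

/-- The line bundle on `V / M'` whose sections are the functions on `V` that differ from `g` by a
periodic function. Here translation by a lattice vector changes `g` by an integral affine
function. -/
noncomputable def twistedBundle [DiscreteTopology M'] {g : V → ℝ} (hg : Continuous g)
    (hper : ∀ u ∈ M', ∃ (k : Fin n → ℤ) (c : ℝ), ∀ y,
      g ((b.ofZLatticeBasis ℝ N).equivFun.symm y + u) =
        g ((b.ofZLatticeBasis ℝ N).equivFun.symm y) + ((fun j => (k j : ℝ)) ⬝ᵥ y + c)) :
    TropicalLineBundle (RealTorus N M') where
  Total := RealTorus N M' × TropNum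
  topTotal := inferInstance
  proj := Prod.fst
  continuous_proj := continuous_fst
  atlas := {c | ∃ (W : Set V) (hW : IsOpen W) (hinj : InjOn (mk N M') W),
    c = twistedChart b hg hW hinj}
  isAtlas := by
    convert isAtlasOf_stdCharts b (M' := M') (P := fun _ => True) (fun v => ?_) using 1
    · ext c
      constructor
      · rintro ⟨_, ⟨W, hW, hinj, rfl⟩, rfl⟩
        exact ⟨W, hW, hinj, trivial, rfl⟩
      · rintro ⟨W, hW, hinj, -, rfl⟩
        exact ⟨_, ⟨W, hW, hinj, rfl⟩, rfl⟩
    · obtain ⟨W, hW, hv, hinj⟩ := exists_injOn N M' v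
      exact ⟨W, hW, hv, hinj, trivial⟩
  transition := by
    rintro _ ⟨W, hW, hinj, rfl⟩ _ ⟨W', hW', hinj', rfl⟩ -
    let e := (b.ofZLatticeBasis ℝ N).equivFun
    have hecont : Continuous e.symm :=
      LinearMap.continuous_of_finiteDimensional e.symm.toLinearMap
    let c := stdChart N M' b hW hinj
    let c' := stdChart N M' b hW' hinj'
    -- The change of `g` between the lifts chosen by the two charts; locally these differ by a fixed
    -- lattice vector, so `hper` makes it integral affine.
    refine ⟨fun y => g (e.symm (c.map (mk N M' (e.symm y)))) - g (e.symm y), ?_, ?_⟩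
    · rintro _ ⟨x, ⟨hx, hx'⟩, rfl⟩
      change x ∈ c.map.source at hx
      change x ∈ c'.map.source at hx'
      change ∃ O, _ ∧ c'.map x ∈ O ∧ _
      rw [stdChart_source] at hx hx'
      obtain ⟨w, hw, rfl⟩ := hx
      obtain ⟨w', hw', hww⟩ := hx'
      have hu : w - w' ∈ M' := (mk_eq_mk_iff N M' w' w).1 hww
      obtain ⟨k, κ, hk⟩ := hper _ hu
      rw [← hww, stdChart_map_mk b hW' hinj' hw']
      refine ⟨(fun y => e.symm y + (w - w')) ⁻¹' W, hW.preimage (by fun_prop), ?_,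
        zAffine (Matrix.of fun _ => k) (fun _ => κ), ⟨_, _, rfl⟩, ?_⟩
      · show e.symm (e w') + (w - w') ∈ W
        rw [e.symm_apply_apply]
        simpa using hw
      · rintro y ⟨hy, -⟩
        have hy : e.symm y + (w - w') ∈ W := hy
        ext i
        show g (e.symm (c.map (mk N M' (e.symm y)))) - g (e.symm y) =
          (fun j => (k j : ℝ)) ⬝ᵥ y + κ
        rw [← mk_add_of_mem N M' _ hu, stdChart_map_mk b hW hinj hy, e.symm_apply_apply]
        exact sub_eq_of_eq_add' (hk y)
    · rintro x ⟨hx, hx'⟩ a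
      change x ∈ c.map.source at hx
      change x ∈ c'.map.source at hx'
      change (twistedChart b hg hW hinj).triv
        ((twistedChart b hg hW' hinj').triv.toOpenPartialHomeomorph.symm (x, a)) =
        (x, a + ((g (e.symm (c.map (mk N M' (e.symm (c'.map x))))) -
          g (e.symm (c'.map x)) : ℝ) : TropNum))
      rw [stdChart_source] at hx hx'
      obtain ⟨w, hw, rfl⟩ := hx
      obtain ⟨w', hw', hww⟩ := hx'
      rw [← hww, twistedChart_triv_symm_mk b hg hW' hinj' hw', stdChart_map_mk b hW' hinj' hw',
        e.symm_apply_apply, hww, twistedChart_triv_mk b hg hW hinj hw,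
        stdChart_map_mk b hW hinj hw, e.symm_apply_apply, add_assoc, ← WithTop.coe_add]
      congr 3
      ring

end RealTorus

/-! ### Sections of the twisted bundle and a criterion for faithful embeddings. -/

namespace RealTorus

variable {V : Type u} [NormedAddCommGroup V] [NormedSpace ℝ V]
  {N M' : Submodule ℤ V}

/-- The function on `V / M'` induced by a periodic function on `V`. -/
noncomputable def descend (N M' : Submodule ℤ V) (f : V → ℝ) (x : RealTorus N M') : ℝ :=
  f (Function.surjInv (mk_surjective N M') x)

theorem descend_mk {f : V → ℝ} (hf : ∀ u ∈ M', ∀ v, f (v + u) = f v) (v : V) :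
    descend N M' f (mk N M' v) = f v := by
  have h := (mk_eq_mk_iff N M' _ _).1 (Function.surjInv_eq (mk_surjective N M') (mk N M' v)).symm
  have := hf _ h v
  rwa [add_sub_cancel] at this

variable [FiniteDimensional ℝ V] [DiscreteTopology N] [IsZLattice ℝ N] [DiscreteTopology M']
  {n : ℕ} (b : Module.Basis (Fin n) ℤ N) {g : V → ℝ}
  (hg : Continuous g)
  (hper : ∀ u ∈ M', ∃ (k : Fin n → ℤ) (c : ℝ), ∀ y,
      g ((b.ofZLatticeBasis ℝ N).equivFun.symm y + u) =
        g ((b.ofZLatticeBasis ℝ N).equivFun.symm y) + ((fun j => (k j : ℝ)) ⬝ᵥ y + c))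

/-- The section of `twistedBundle` given by a function on `V` that differs from `g` by a periodic
function. -/
noncomputable def twistedSection (Θ : V → ℝ) :
    RealTorus N M' → (twistedBundle b hg hper).Total :=
  fun x => (x, (descend N M' (fun v => Θ v - g v) x : TropNum))

theorem twistedChart_triv_twistedSection {Θ : V → ℝ}
    (hΘ : ∀ u ∈ M', ∀ v, Θ (v + u) - g (v + u) = Θ v - g v) {W : Set V} (hW : IsOpen W)
    (hinj : InjOn (mk N M') W) {w : V} (hw : w ∈ W) :
    ((twistedChart b hg hW hinj).triv (twistedSection b hg hper Θ (mk N M' w))).2 =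
      (Θ w : TropNum) := by
  rw [twistedSection, twistedChart_triv_mk b hg hW hinj hw, descend_mk hΘ, ← WithTop.coe_add,
    sub_add_cancel]

/-- The twisted trivialization adds `g` back, so in every chart the section reads as `Θ` itself. -/
theorem twistedSection_mem {Θ : V → ℝ}
    (hΘ : ∀ u ∈ M', ∀ v, Θ (v + u) - g (v + u) = Θ v - g v) (hconc : ConcaveOn ℝ univ Θ)
    (hpl : ∀ p : Fin n → ℝ, ∃ O, IsOpen O ∧ p ∈ O ∧ ∃ F, IsPiecewiseZAffine F ∧
      EqOn (fun y => Θ ((b.ofZLatticeBasis ℝ N).equivFun.symm y)) F O) :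
    twistedSection b hg hper Θ ∈ (twistedBundle b hg hper).nontrivialRegularSections := by
  let e := (b.ofZLatticeBasis ℝ N).equivFun
  have hchart : ∀ {W : Set V} (hW : IsOpen W) (hinj : InjOn (mk N M') W), ∀ y : Fin n → ℝ,
      e.symm y ∈ W → (twistedBundle b hg hper).inChart (twistedSection b hg hper Θ)
        (twistedChart b hg hW hinj) y = (Θ (e.symm y) : TropNum) := by
    intro W hW hinj y hy
    show ((twistedChart b hg hW hinj).triv (twistedSection b hg hper Θ
      ((stdChart N M' b hW hinj).map.symm y))).2 = _
    rw [stdChart_symm_apply b hW hinj hy]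
    exact twistedChart_triv_twistedSection b hg hper hΘ hW hinj hy
  refine ⟨⟨fun x => rfl, .inr ?_⟩, fun hinf => ?_⟩
  · rintro _ ⟨W, hW, hinj, rfl⟩
    refine ⟨fun y => Θ (e.symm y), fun y hy => ?_, fun p _ => ?_, fun p _ => ?_⟩
    · change y ∈ (stdChart N M' b hW hinj).map.target at hy
      rw [stdChart_target] at hy
      exact hchart hW hinj y hy
    · refine ⟨univ, isOpen_univ, mem_univ _, univ, subset_univ _, fun y => Θ (e.symm y), ?_,
        fun _ _ => rfl⟩
      exact hconc.comp_linearMap e.symm.toLinearMap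
    · obtain ⟨O, hO, hp, F, hF, h⟩ := hpl p
      exact ⟨O, hO, hp, F, hF, h.mono inter_subset_left⟩
  · obtain ⟨W, hW, hv, hinj⟩ := exists_injOn N M' (0 : V)
    have h1 : e.symm (e 0) ∈ W := by rwa [e.symm_apply_apply]
    have h2 := hinf (twistedChart b hg hW hinj) ⟨W, hW, hinj, rfl⟩ (e 0) (by
      change e 0 ∈ (stdChart N M' b hW hinj).map.target
      rw [stdChart_target]
      exact h1)
    have h3 := hchart hW hinj (e 0) h1
    exact WithTop.coe_ne_top (h3.symm.trans h2)

/-- Finitely many functions that differ from `g` by periodic functions define a faithful embedding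
if their differences separate the points of `V / M'` and are locally unimodular. -/
theorem admitsFaithfulEmbedding_twistedBundle [IsZLattice ℝ M'] {m : ℕ} (Θ : Fin (m + 1) → V → ℝ)
    (hΘ : ∀ k, ∀ u ∈ M', ∀ v, Θ k (v + u) - g (v + u) = Θ k v - g v)
    (hconc : ∀ k, ConcaveOn ℝ univ (Θ k))
    (hpl : ∀ k, ∀ p : Fin n → ℝ, ∃ O, IsOpen O ∧ p ∈ O ∧ ∃ F, IsPiecewiseZAffine F ∧
      EqOn (fun y => Θ k ((b.ofZLatticeBasis ℝ N).equivFun.symm y)) F O)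
    (hsep : ∀ v w, (∀ k, Θ k v - Θ 0 v = Θ k w - Θ 0 w) → w - v ∈ M')
    (huni : ∀ v, ∃ O : Set V, IsOpen O ∧ v ∈ O ∧ ∀ W ⊆ O, IsOpen W →
      IsUnimodularOn (fun y (i : Fin m) => Θ i.succ ((b.ofZLatticeBasis ℝ N).equivFun.symm y) -
        Θ 0 ((b.ofZLatticeBasis ℝ N).equivFun.symm y))
        ((b.ofZLatticeBasis ℝ N).equivFun.symm ⁻¹' W)) :
    (twistedBundle b hg hper).AdmitsFaithfulEmbedding := by
  let s : Fin (m + 1) → (twistedBundle b hg hper).nontrivialRegularSections := fun k =>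
    ⟨twistedSection b hg hper (Θ k), twistedSection_mem b hg hper (hΘ k) (hconc k) (hpl k)⟩
  let f : Fin m → V → ℝ := fun i v => Θ i.succ v - Θ 0 v
  have hfper : ∀ i, ∀ u ∈ M', ∀ v, f i (v + u) = f i v := by
    intro i u hu v
    have := hΘ i.succ u hu v
    have := hΘ 0 u hu v
    simp only [f]
    linarith
  let ψ : RealTorus N M' → (Fin m → ℝ) := fun x i => descend N M' (f i) x
  have hψ : ∀ v, ψ (mk N M' v) = fun i => f i v := fun v =>
    funext fun i => descend_mk (hfper i) v
  have hΘcont : ∀ k, Continuous (Θ k) := fun k =>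
    continuousOn_univ.1 ((hconc k).continuousOn isOpen_univ)
  have hψcont : Continuous ψ := by
    have hq : IsQuotientMap (mk N M') :=
      (isOpenMap_mk N M').isQuotientMap (continuous_mk N M') (mk_surjective N M')
    rw [hq.continuous_iff]
    have : ψ ∘ mk N M' = fun v i => f i v := funext hψ
    rw [this]
    exact continuous_pi fun i => (hΘcont _).sub (hΘcont _)
  have hψinj : Function.Injective ψ := by
    intro x y hxy
    obtain ⟨v, rfl⟩ := mk_surjective N M' x
    obtain ⟨w, rfl⟩ := mk_surjective N M' y
    rw [hψ, hψ] at hxy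
    refine (mk_eq_mk_iff N M' v w).2 (hsep v w fun k => ?_)
    refine Fin.cases ?_ (fun i => ?_) k
    · simp
    · exact congrFun hxy i
  have hφ : ∀ x, (twistedBundle b hg hper).toTP s x = TropicalProjectiveSpace.ofAffine (ψ x) := by
    intro x
    obtain ⟨v, rfl⟩ := mk_surjective N M' x
    obtain ⟨W, hW, hv, hinj⟩ := exists_injOn N M' v
    rw [(twistedBundle b hg hper).toTP_eq s (c := twistedChart b hg hW hinj) ⟨W, hW, hinj, rfl⟩
      (x := mk N M' v) (by
        change mk N M' v ∈ (stdChart N M' b hW hinj).map.source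
        rw [stdChart_source]
        exact mem_image_of_mem _ hv)]
    have hval : ∀ k, ((twistedChart b hg hW hinj).triv ((s k).1 (mk N M' v))).2 =
        (Θ k v : TropNum) := fun k =>
      twistedChart_triv_twistedSection b hg hper (hΘ k) hW hinj hv
    refine (TropicalProjectiveSpace.mk_eq_ofAffine_iff _ _ _).2 ⟨fun k => ?_, fun i => ?_⟩
    · exact fun h => WithTop.coe_ne_top ((hval k).symm.trans h)
    · exact (congrArg₂ (fun a b : TropNum => a.untopD 0 - b.untopD 0) (hval i.succ) (hval 0)).trans
        (congrFun (hψ v) i).symm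
  refine ⟨m, s, ⟨ψ, hφ, stdCharts b M' fun W => ∃ O : Set V, W ⊆ O ∧ ∀ W ⊆ O, IsOpen W →
      IsUnimodularOn (fun y (i : Fin m) => Θ i.succ ((b.ofZLatticeBasis ℝ N).equivFun.symm y) -
        Θ 0 ((b.ofZLatticeBasis ℝ N).equivFun.symm y))
        ((b.ofZLatticeBasis ℝ N).equivFun.symm ⁻¹' W), isAtlasOf_stdCharts b fun v => ?_, ?_⟩, ?_⟩
  · obtain ⟨W, hW, hv, hinj⟩ := exists_injOn N M' v
    obtain ⟨O, hO, hvO, h⟩ := huni v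
    exact ⟨W ∩ O, hW.inter hO, ⟨hv, hvO⟩, hinj.mono inter_subset_left, O, inter_subset_right, h⟩
  · rintro _ ⟨W, hW, hinj, ⟨O, hWO, h⟩, rfl⟩
    obtain ⟨C, hC, hC', hCF⟩ := h W hWO hW
    rw [← stdChart_target b hW hinj] at hC' hCF
    refine ⟨C, hC, hC', fun σ hσ => ?_⟩
    obtain ⟨F, hF, hF'⟩ := hCF σ hσ
    refine ⟨F, hF, fun y hy => Eq.trans ?_ (hF' hy)⟩
    have hy2 := hy.2
    rw [stdChart_target] at hy2
    rw [Function.comp_apply, stdChart_symm_apply b hW hinj hy2, hψ]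
  · have : (twistedBundle b hg hper).toTP s = TropicalProjectiveSpace.ofAffine ∘ ψ := funext hφ
    rw [this]
    exact TropicalProjectiveSpace.isOpenEmbedding_ofAffine.isEmbedding.comp
      (hψcont.isClosedEmbedding hψinj).isEmbedding

end RealTorus

/-! ### The norm of a positive-definite form. -/

section QNorm

variable {V : Type*} [NormedAddCommGroup V] [NormedSpace ℝ V] {Q : LinearMap.BilinForm ℝ V}

theorem sqrt_apply_self_add_le (hs : ∀ x y, Q x y = Q y x) (h0 : ∀ x, 0 ≤ Q x x) (x y : V) :
    √(Q (x + y) (x + y)) ≤ √(Q x x) + √(Q y y) := by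
  refine Real.sqrt_le_iff.2 ⟨by positivity, ?_⟩
  have h1 := Q.apply_mul_apply_le_of_forall_zero_le h0 x y
  rw [hs y x] at h1
  have h2 : Q x y ≤ √(Q x x) * √(Q y y) := by
    rw [← Real.sqrt_mul (h0 x)]
    exact Real.le_sqrt_of_sq_le (by rw [sq]; exact h1)
  have h3 := Real.sq_sqrt (h0 x)
  have h4 := Real.sq_sqrt (h0 y)
  simp only [map_add, LinearMap.add_apply, hs y x]
  nlinarith

theorem sqrt_apply_self_neg (x : V) : √(Q (-x) (-x)) = √(Q x x) := by simp

theorem sqrt_apply_self_sum_le (hs : ∀ x y, Q x y = Q y x) (h0 : ∀ x, 0 ≤ Q x x) {ι : Type*}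
    (s : Finset ι) (c : ι → ℝ) (hc : ∀ i, |c i| ≤ 1) (ε : ι → V) :
    √(Q (∑ i ∈ s, c i • ε i) (∑ i ∈ s, c i • ε i)) ≤ ∑ i ∈ s, √(Q (ε i) (ε i)) := by
  classical
  induction s using Finset.induction with
  | empty => simp
  | insert i s hi ih =>
    rw [Finset.sum_insert hi, Finset.sum_insert hi]
    refine (sqrt_apply_self_add_le hs h0 _ _).trans (add_le_add ?_ ih)
    refine Real.sqrt_le_sqrt ?_
    simp only [map_smul, LinearMap.smul_apply, smul_eq_mul]
    rw [← mul_assoc]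
    refine mul_le_of_le_one_left (h0 _) ?_
    rw [← abs_mul_abs_self]
    exact mul_le_one₀ (hc i) (abs_nonneg _) (hc i)

theorem exists_le_sqrt_apply_self [FiniteDimensional ℝ V] (hpos : ∀ x, x ≠ 0 → 0 < Q x x) :
    ∃ α > 0, ∀ x, α * ‖x‖ ≤ √(Q x x) := by
  have : ProperSpace V := FiniteDimensional.proper ℝ V
  -- The unit sphere is empty when `V` is trivial.
  by_cases hne : (Metric.sphere (0 : V) 1).Nonempty
  · obtain ⟨x₀, hx₀, hmin⟩ := (isCompact_sphere (0 : V) 1).exists_isMinOn hne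
      (Real.continuous_sqrt.comp Q.continuous_apply_self).continuousOn
    have hx₀' : x₀ ≠ 0 := by
      rintro rfl
      simp at hx₀
    refine ⟨√(Q x₀ x₀), Real.sqrt_pos.2 (hpos _ hx₀'), fun x => ?_⟩
    by_cases hx : x = 0
    · simp [hx]
    have hx' := norm_pos_iff.2 hx
    have h1 : √(Q x₀ x₀) ≤ √(Q (‖x‖⁻¹ • x) (‖x‖⁻¹ • x)) := hmin (by simp [norm_smul, hx])
    simp only [map_smul, LinearMap.smul_apply, smul_eq_mul] at h1
    rw [← mul_assoc, Real.sqrt_mul (by positivity), Real.sqrt_mul_self (by positivity),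
      inv_mul_eq_div] at h1
    exact (le_div_iff₀ hx').1 h1
  · refine ⟨1, one_pos, fun x => ?_⟩
    by_cases hx : x = 0
    · simp [hx]
    exact (hne ⟨‖x‖⁻¹ • x, by simp [norm_smul, hx]⟩).elim

theorem exists_sqrt_apply_self_le [FiniteDimensional ℝ V] (Q : LinearMap.BilinForm ℝ V) :
    ∃ β ≥ 0, ∀ x, √(Q x x) ≤ β * ‖x‖ := by
  refine ⟨√‖LinearMap.toContinuousBilinearMap Q‖, Real.sqrt_nonneg _, fun x => ?_⟩
  rw [← Real.sqrt_mul_self (norm_nonneg x),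
    ← Real.sqrt_mul (norm_nonneg (LinearMap.toContinuousBilinearMap Q)), ← mul_assoc]
  exact Real.sqrt_le_sqrt ((le_abs_self _).trans
    ((LinearMap.toContinuousBilinearMap Q).le_opNorm₂ x x))

end QNorm

/-! ### Tropical theta functions as distances to lattice cosets. -/

section Theta

variable {V : Type*} [NormedAddCommGroup V] [NormedSpace ℝ V]

/-- The squared distance from `v` to `z + M'` with respect to a quadratic form. -/
noncomputable def latticeDistSq (Q : LinearMap.BilinForm ℝ V) (M' : Submodule ℤ V) (z v : V) : ℝ :=
  ⨅ u : M', Q (v - z - u) (v - z - u)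

/-- The tropical theta function `v ↦ min_{u ∈ M'} (Q(z + u, z + u) / 2 - Q(z + u, v))`. -/
noncomputable def tropicalTheta (Q : LinearMap.BilinForm ℝ V) (M' : Submodule ℤ V) (z v : V) : ℝ :=
  (latticeDistSq Q M' z v - Q v v) / 2

/-- The vectors of `V` whose pairing with `N` is integral. -/
def dualLattice (Q : LinearMap.BilinForm ℝ V) (N : Submodule ℤ V) : AddSubgroup V where
  carrier := {z | ∀ v ∈ N, ∃ k : ℤ, Q z v = k}
  zero_mem' _ _ := ⟨0, by simp⟩
  add_mem' {x y} hx hy v hv := by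
    obtain ⟨k, hk⟩ := hx v hv
    obtain ⟨l, hl⟩ := hy v hv
    exact ⟨k + l, by simp [hk, hl]⟩
  neg_mem' {x} hx v hv := by
    obtain ⟨k, hk⟩ := hx v hv
    exact ⟨-k, by simp [hk]⟩

variable {Q : LinearMap.BilinForm ℝ V} {M' : Submodule ℤ V}

theorem latticeDistSq_le (h0 : ∀ x, 0 ≤ Q x x) (z v : V) (u : M') :
    latticeDistSq Q M' z v ≤ Q (v - z - u) (v - z - u) :=
  ciInf_le ⟨0, by rintro _ ⟨u, rfl⟩; exact h0 _⟩ u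

theorem latticeDistSq_le_self (h0 : ∀ x, 0 ≤ Q x x) (z v : V) :
    latticeDistSq Q M' z v ≤ Q (v - z) (v - z) := by
  simpa using latticeDistSq_le (M' := M') h0 z v 0

theorem latticeDistSq_add_left (z v : V) (u : M') :
    latticeDistSq Q M' (z + u) v = latticeDistSq Q M' z v := by
  refine Equiv.iInf_congr (Equiv.addRight u) fun w => ?_
  have : v - z - ((w + u : M') : V) = v - (z + u) - w := by push_cast; abel
  rw [Equiv.coe_addRight, this]

theorem latticeDistSq_add_right (z v : V) (u : M') :
    latticeDistSq Q M' z (v + u) = latticeDistSq Q M' z v := by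
  refine Equiv.iInf_congr (Equiv.subRight u) fun w => ?_
  have : v - z - ((w - u : M') : V) = v + u - z - w := by push_cast; abel
  rw [Equiv.subRight_apply, this]

/-- The distance to `z + M'` is periodic and the remaining term `-Q v v / 2` does not involve `z`;
hence all theta functions are sections of one bundle. -/
theorem tropicalTheta_add_sub (z z' v : V) {u : V} (hu : u ∈ M') :
    tropicalTheta Q M' z (v + u) - tropicalTheta Q M' z' (v + u) =
      tropicalTheta Q M' z v - tropicalTheta Q M' z' v := by
  have h := fun z => latticeDistSq_add_right (Q := Q) z v (⟨u, hu⟩ : M')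
  simp only at h
  simp only [tropicalTheta, h]
  ring

theorem tropicalTheta_add (hs : ∀ x y, Q x y = Q y x) (z v : V) {u : V} (hu : u ∈ M') :
    tropicalTheta Q M' z (v + u) = tropicalTheta Q M' z v + (-(Q u v) - Q u u / 2) := by
  have h := latticeDistSq_add_right (Q := Q) z v (⟨u, hu⟩ : M')
  simp only at h
  simp only [tropicalTheta, h, map_add, LinearMap.add_apply, hs v u]
  ring

/-- The quadratic term in `v` cancels, so each candidate closest point contributes an affine
function of `v`. -/
theorem half_sub_eq (hs : ∀ x y, Q x y = Q y x) (v z u : V) :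
    (Q (v - z - u) (v - z - u) - Q v v) / 2 = -(Q (z + u) v) + Q (z + u) (z + u) / 2 := by
  rw [sub_sub]
  simp only [map_sub, LinearMap.sub_apply, hs v (z + u)]
  ring

theorem tropicalTheta_le (hs : ∀ x y, Q x y = Q y x) (h0 : ∀ x, 0 ≤ Q x x) (z v : V) (u : M') :
    tropicalTheta Q M' z v ≤ -(Q (z + u) v) + Q (z + u) (z + u) / 2 := by
  rw [← half_sub_eq hs, tropicalTheta]
  linarith [latticeDistSq_le h0 z v u]

theorem tropicalTheta_eq_of_latticeDistSq_eq (hs : ∀ x y, Q x y = Q y x) {z v : V} {u : M'}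
    (h : latticeDistSq Q M' z v = Q (v - z - u) (v - z - u)) :
    tropicalTheta Q M' z v = -(Q (z + u) v) + Q (z + u) (z + u) / 2 := by
  rw [← half_sub_eq hs, tropicalTheta, h]

/-- A point closer to `v` than half the minimal length of `M'` is the only closest point to `v` in
its class modulo `M'`. -/
theorem eq_zero_of_latticeDistSq_eq (hs : ∀ x y, Q x y = Q y x) (h0 : ∀ x, 0 ≤ Q x x) {r : ℝ}
    (hr : ∀ u ∈ M', u ≠ 0 → r ≤ √(Q u u)) {v w : V} (hvw : √(Q (v - w) (v - w)) < r / 2) {u : M'}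
    (hu : latticeDistSq Q M' w v = Q (v - w - u) (v - w - u)) : u = 0 := by
  by_contra hne
  have h1 := hr u u.2 (by simpa using hne)
  have h2 : Q (v - w - u) (v - w - u) ≤ Q (v - w) (v - w) :=
    hu ▸ latticeDistSq_le_self h0 w v
  have h3 := Real.sqrt_le_sqrt h2
  have h4 := sqrt_apply_self_add_le hs h0 (v - w) (-(v - w - u))
  rw [sqrt_apply_self_neg, neg_sub, add_sub_cancel] at h4
  linarith

variable [FiniteDimensional ℝ V] [DiscreteTopology M'] [IsZLattice ℝ M']

theorem finite_norm_le (M' : Submodule ℤ V) [DiscreteTopology M'] [IsZLattice ℝ M'] (R : ℝ) :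
    {u : M' | ‖(u : V)‖ ≤ R}.Finite := by
  have : ProperSpace V := FiniteDimensional.proper ℝ V
  have : Module.Finite ℤ M' := ZLattice.module_finite ℝ M'
  have : Module.Free ℤ M' := ZLattice.module_free ℝ M'
  have h := ZSpan.setFinite_inter ((Module.finBasis ℤ M').ofZLatticeBasis ℝ M')
    (Metric.isBounded_closedBall (x := (0 : V)) (r := R))
  rw [Module.Basis.ofZLatticeBasis_span ℝ M'] at h
  refine Set.Finite.of_finite_image (f := Subtype.val) (h.subset ?_) Subtype.val_injective.injOn
  rintro _ ⟨u, hu, rfl⟩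
  exact ⟨by simpa using hu, u.2⟩

/-- A lattice vector `w` that does better than `0` has `Q`-length at most twice that of `v - z`,
which is bounded on the ball; only finitely many `w` qualify. -/
theorem exists_finset_latticeDistSq_eq (hs : ∀ x y, Q x y = Q y x)
    (hpos : ∀ x, x ≠ 0 → 0 < Q x x) (z v₀ : V) :
    ∃ S : Finset M', ∀ v ∈ Metric.ball v₀ 1, ∃ u ∈ S,
      latticeDistSq Q M' z v = Q (v - z - u) (v - z - u) := by
  have h0 : ∀ x, 0 ≤ Q x x := fun x => by
    by_cases hx : x = 0
    · simp [hx]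
    · exact (hpos x hx).le
  obtain ⟨α, hα, hαQ⟩ := exists_le_sqrt_apply_self hpos
  obtain ⟨β, hβ, hβQ⟩ := exists_sqrt_apply_self_le Q
  have hfin := finite_norm_le M' (2 * (β * (‖v₀‖ + 1 + ‖z‖)) / α)
  refine ⟨hfin.toFinset, fun v hv => ?_⟩
  have hS0 : (0 : M') ∈ hfin.toFinset := by
    rw [Set.Finite.mem_toFinset]
    show ‖((0 : M') : V)‖ ≤ _
    rw [Submodule.coe_zero, norm_zero]
    positivity
  obtain ⟨u, huS, hmin⟩ := hfin.toFinset.exists_min_image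
    (fun u : M' => Q (v - z - u) (v - z - u)) ⟨0, hS0⟩
  refine ⟨u, huS, le_antisymm (latticeDistSq_le h0 z v u) (le_ciInf fun w => ?_)⟩
  by_cases hw : w ∈ hfin.toFinset
  · exact hmin w hw
  refine (hmin 0 hS0).trans ?_
  by_contra! hlt
  simp only [Submodule.coe_zero, sub_zero] at hlt
  refine hw ?_
  rw [Set.Finite.mem_toFinset]
  show ‖(w : V)‖ ≤ _
  rw [le_div_iff₀ hα, mul_comm]
  have h1 : √(Q (v - z) (v - z)) ≤ β * (‖v₀‖ + 1 + ‖z‖) := by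
    refine (hβQ _).trans (mul_le_mul_of_nonneg_left ?_ hβ)
    have hv' : ‖v - v₀‖ < 1 := by rwa [← dist_eq_norm]
    calc ‖v - z‖ ≤ ‖v‖ + ‖z‖ := norm_sub_le _ _
      _ ≤ ‖v₀‖ + 1 + ‖z‖ := by
        have := norm_add_le v₀ (v - v₀)
        rw [add_sub_cancel] at this
        linarith
  have h2 := Real.sqrt_le_sqrt hlt.le
  have h3 := sqrt_apply_self_add_le hs h0 (v - z) (-(v - z - w))
  rw [sqrt_apply_self_neg, neg_sub, add_sub_cancel] at h3
  linarith [hαQ w]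

theorem exists_finset_latticeDistSq_eq_of_finite {κ : Type*} [Finite κ]
    (hs : ∀ x y, Q x y = Q y x) (hpos : ∀ x, x ≠ 0 → 0 < Q x x) (z : κ → V) (v₀ : V) :
    ∃ S : Finset M', ∀ v ∈ Metric.ball v₀ 1, ∀ k, ∃ u ∈ S,
      latticeDistSq Q M' (z k) v = Q (v - z k - u) (v - z k - u) := by
  classical
  have := Fintype.ofFinite κ
  choose S hS using fun k => exists_finset_latticeDistSq_eq (M' := M') hs hpos (z k) v₀
  refine ⟨Finset.univ.biUnion S, fun v hv k => ?_⟩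
  obtain ⟨u, hu, h⟩ := hS k v hv
  exact ⟨u, Finset.mem_biUnion.2 ⟨k, Finset.mem_univ k, hu⟩, h⟩

theorem exists_latticeDistSq_eq (hs : ∀ x y, Q x y = Q y x) (hpos : ∀ x, x ≠ 0 → 0 < Q x x)
    (z v : V) : ∃ u : M', latticeDistSq Q M' z v = Q (v - z - u) (v - z - u) := by
  obtain ⟨S, hS⟩ := exists_finset_latticeDistSq_eq (M' := M') hs hpos z v
  obtain ⟨u, -, hu⟩ := hS v (Metric.mem_ball_self one_pos)
  exact ⟨u, hu⟩

/-- A minimum of affine functions is concave: the affine function attaining it at the intermediate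
point bounds it at both ends. -/
theorem concaveOn_tropicalTheta (hs : ∀ x y, Q x y = Q y x) (hpos : ∀ x, x ≠ 0 → 0 < Q x x)
    (z : V) : ConcaveOn ℝ univ (tropicalTheta Q M' z) := by
  have h0 : ∀ x, 0 ≤ Q x x := fun x => by
    by_cases hx : x = 0
    · simp [hx]
    · exact (hpos x hx).le
  refine ⟨convex_univ, fun x _ y _ a c ha hc hac => ?_⟩
  obtain ⟨u, hu⟩ := exists_latticeDistSq_eq (M' := M') hs hpos z (a • x + c • y)
  rw [tropicalTheta_eq_of_latticeDistSq_eq hs hu]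
  have h1 := mul_le_mul_of_nonneg_left (tropicalTheta_le hs h0 z x u) ha
  have h2 := mul_le_mul_of_nonneg_left (tropicalTheta_le hs h0 z y u) hc
  simp only [map_add, map_smul, LinearMap.add_apply, smul_eq_mul] at h1 h2 ⊢
  refine (add_le_add h1 h2).trans (le_of_eq ?_)
  linear_combination (Q z z + Q z u + Q u z + Q u u) / 2 * hac

theorem latticeDistSq_eq_self (hs : ∀ x y, Q x y = Q y x) (hpos : ∀ x, x ≠ 0 → 0 < Q x x)
    (h0 : ∀ x, 0 ≤ Q x x) {r : ℝ}
    (hr : ∀ u ∈ M', u ≠ 0 → r ≤ √(Q u u)) {v w : V} (hvw : √(Q (v - w) (v - w)) < r / 2) :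
    latticeDistSq Q M' w v = Q (v - w) (v - w) := by
  obtain ⟨u, hu⟩ := exists_latticeDistSq_eq (M' := M') hs hpos w v
  have := eq_zero_of_latticeDistSq_eq hs h0 hr hvw hu
  rw [hu, this]
  simp

end Theta

/-! ### Separation and unimodularity when the dual lattice is fine. -/

section FineTheta

variable {V : Type*} [NormedAddCommGroup V] [NormedSpace ℝ V] [FiniteDimensional ℝ V]
  {Q : LinearMap.BilinForm ℝ V} {N M' : Submodule ℤ V} [DiscreteTopology N] [IsZLattice ℝ N]
  {n : ℕ} (b : Module.Basis (Fin n) ℤ N) {ε : Fin n → V}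

theorem eq_of_forall_apply_basis_eq (hpos : ∀ x, x ≠ 0 → 0 < Q x x) {x y : V}
    (h : ∀ j, Q x (b j) = Q y (b j)) : x = y := by
  have h1 : Q (x - y) = 0 := by
    refine (b.ofZLatticeBasis ℝ N).ext fun j => ?_
    rw [b.ofZLatticeBasis_apply ℝ N, map_sub, LinearMap.sub_apply, h, sub_self,
      LinearMap.zero_apply]
  by_contra hne
  have := hpos (x - y) (sub_ne_zero.2 hne)
  rw [h1] at this
  simp at this

theorem sum_apply_smul_dual (hpos : ∀ x, x ≠ 0 → 0 < Q x x)
    (hε : ∀ i j, Q (ε i) (b j) = if i = j then 1 else 0) (x : V) :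
    ∑ i, Q x (b i) • ε i = x := by
  refine eq_of_forall_apply_basis_eq b hpos fun j => ?_
  simp [hε]

theorem apply_equivFun_symm {w : V} {k : Fin n → ℤ} (hk : ∀ j, Q w (b j) = k j) (y : Fin n → ℝ) :
    Q w ((b.ofZLatticeBasis ℝ N).equivFun.symm y) = (fun j => (k j : ℝ)) ⬝ᵥ y := by
  rw [Module.Basis.equivFun_symm_apply]
  simp [dotProduct, b.ofZLatticeBasis_apply ℝ N, hk, mul_comm]

theorem dual_mem_dualLattice (hε : ∀ i j, Q (ε i) (b j) = if i = j then 1 else 0) (i : Fin n) :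
    ε i ∈ dualLattice Q N := by
  intro v hv
  refine ⟨b.repr ⟨v, hv⟩ i, ?_⟩
  have h1 : (b.ofZLatticeBasis ℝ N).equivFun.symm (fun j => (b.repr ⟨v, hv⟩ j : ℝ)) = v := by
    rw [LinearEquiv.symm_apply_eq]
    ext j
    exact (b.ofZLatticeBasis_repr_apply ℝ N ⟨v, hv⟩ j).symm
  have h2 : ∀ j, Q (ε i) (b j) = ((Pi.single i 1 : Fin n → ℤ) j : ℝ) := by
    intro j
    rw [hε]
    by_cases h : i = j
    · subst h; simp
    · simp [h, Ne.symm h]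
  have h3 := apply_equivFun_symm b h2 (fun j => (b.repr ⟨v, hv⟩ j : ℝ))
  rw [h1] at h3
  have h4 : (fun j => ((Pi.single i 1 : Fin n → ℤ) j : ℝ)) = Pi.single i 1 := by
    ext j
    by_cases h : j = i
    · subst h; simp
    · simp [h]
  rw [h3, h4]
  simp

/-- Rounding down the coordinates of `v` in the dual basis `ε` leaves coefficients in `[0, 1)`. -/
theorem exists_mem_dualLattice_sqrt_le (hs : ∀ x y, Q x y = Q y x)
    (hpos : ∀ x, x ≠ 0 → 0 < Q x x) (h0 : ∀ x, 0 ≤ Q x x)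
    (hε : ∀ i j, Q (ε i) (b j) = if i = j then 1 else 0) (v : V) :
    ∃ z ∈ dualLattice Q N, √(Q (v - z) (v - z)) ≤ ∑ i, √(Q (ε i) (ε i)) := by
  refine ⟨∑ i, ⌊Q v (b i)⌋ • ε i, sum_mem fun i _ => zsmul_mem (dual_mem_dualLattice b hε i) _, ?_⟩
  have h : v - ∑ i, ⌊Q v (b i)⌋ • ε i = ∑ i, Int.fract (Q v (b i)) • ε i := by
    conv_lhs => rw [← sum_apply_smul_dual b hpos hε v]
    rw [← Finset.sum_sub_distrib]
    refine Finset.sum_congr rfl fun i _ => ?_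
    rw [sum_apply_smul_dual b hpos hε v, Int.fract, sub_smul, Int.cast_smul_eq_zsmul]
  rw [h]
  refine sqrt_apply_self_sum_le hs h0 _ _ (fun i => ?_) _
  rw [abs_of_nonneg (Int.fract_nonneg _)]
  exact (Int.fract_lt_one _).le

/-- Where the slopes of the closest points are used, the differences of the theta functions form a
unimodular matrix. -/
theorem exists_leftInverse_of_minimizers (hs : ∀ x y, Q x y = Q y x)
    (hpos : ∀ x, x ≠ 0 → 0 < Q x x) (h0 : ∀ x, 0 ≤ Q x x)
    (hε : ∀ i j, Q (ε i) (b j) = if i = j then 1 else 0) {r : ℝ}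
    (hr : ∀ u ∈ M', u ≠ 0 → r ≤ √(Q u u)) (hR : 4 * ∑ i, √(Q (ε i) (ε i)) < r)
    {m : ℕ} {ζ : Fin (m + 1) → V} (hζ : ∀ z ∈ dualLattice Q N, ∃ k, ∃ u : M', z = ζ k + u)
    (v : V) (u : Fin (m + 1) → M')
    (hu : ∀ k, latticeDistSq Q M' (ζ k) v = Q (v - ζ k - u k) (v - ζ k - u k))
    (α : Fin (m + 1) → Fin n → ℤ) (hα : ∀ k j, Q (ζ k + u k) (b j) = α k j) :
    ∃ B : Matrix (Fin n) (Fin m) ℤ,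
      B * Matrix.of (fun i j => -α (Fin.succ i) j - -α 0 j) = 1 := by
  set A : Matrix (Fin m) (Fin n) ℤ := Matrix.of (fun i j => -α (Fin.succ i) j - -α 0 j) with hA
  have hR0 : 0 ≤ ∑ i, √(Q (ε i) (ε i)) := Finset.sum_nonneg fun i _ => Real.sqrt_nonneg _
  -- Differences with index `0` are rows of `A`, or zero for `k = 0`.
  have hrow : ∀ k, ∃ ρ : Fin m → ℤ, Matrix.vecMul ρ A = fun j => -α k j - -α 0 j := by
    intro k
    refine Fin.cases ⟨0, ?_⟩ (fun i => ⟨Pi.single i 1, ?_⟩) k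
    · ext j
      simp
    · rw [Matrix.single_one_vecMul]
      rfl
  choose ρ hρ using hrow
  -- Such a `w` is the only closest point to `v` in its class, so the minimizer chosen for that
  -- class is `w` itself.
  have hclose : ∀ w ∈ dualLattice Q N, √(Q (v - w) (v - w)) < r / 2 →
      ∃ k, ∀ j, Q w (b j) = α k j := by
    intro w hw hvw
    obtain ⟨k, t, rfl⟩ := hζ w hw
    refine ⟨k, fun j => ?_⟩
    have h1 : latticeDistSq Q M' (ζ k + t) v =
        Q (v - (ζ k + t) - (u k - t : M')) (v - (ζ k + t) - (u k - t : M')) := by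
      rw [latticeDistSq_add_left, hu]
      have : v - (ζ k + t) - ((u k - t : M') : V) = v - ζ k - u k := by push_cast; abel
      rw [this]
    have h2 := sub_eq_zero.1 (eq_zero_of_latticeDistSq_eq hs h0 hr hvw h1)
    rw [← h2, hα]
  obtain ⟨z, hz, hvz⟩ := exists_mem_dualLattice_sqrt_le b hs hpos h0 hε v
  obtain ⟨k₀, hk₀⟩ := hclose z hz (by linarith)
  -- Both `v - z` and `ε i` have length at most the sum in `hR`, so `z + ε i` is within `r / 2` of
  -- `v`; this explains the factor 4.
  have hε' : ∀ i, ∃ k, ∀ j, Q (z + ε i) (b j) = α k j := by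
    intro i
    refine hclose _ (add_mem hz (dual_mem_dualLattice b hε i)) ?_
    have h1 := sqrt_apply_self_add_le hs h0 (v - z) (-(ε i))
    rw [sqrt_apply_self_neg, ← sub_eq_add_neg, sub_sub] at h1
    have h2 : √(Q (ε i) (ε i)) ≤ ∑ i, √(Q (ε i) (ε i)) :=
      Finset.single_le_sum (f := fun i => √(Q (ε i) (ε i))) (fun i _ => Real.sqrt_nonneg _)
        (Finset.mem_univ i)
    linarith
  choose κ hκ using hε'
  -- The slopes at `z + ε i` and `z` differ by the `i`-th unit vector; the order of subtraction
  -- accounts for the signs in `A`.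
  refine ⟨Matrix.of fun i => ρ k₀ - ρ (κ i), ?_⟩
  ext i j
  rw [Matrix.mul_apply_eq_vecMul]
  show Matrix.vecMul (ρ k₀ - ρ (κ i)) A j = _
  rw [Matrix.sub_vecMul, hρ, hρ, Pi.sub_apply, Matrix.one_apply]
  have h1 := hκ i j
  rw [map_add, LinearMap.add_apply, hk₀, hε] at h1
  have h2 : α k₀ j + (if i = j then 1 else 0) = α (κ i) j := by
    have : ((α k₀ j + (if i = j then 1 else 0) : ℤ) : ℝ) = (α (κ i) j : ℝ) := by
      rw [← h1]
      push_cast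
      rfl
    exact_mod_cast this
  rw [← h2]
  ring

variable [DiscreteTopology M'] [IsZLattice ℝ M']

/-- Finitely many elements represent the dual lattice modulo `M'`. -/
theorem exists_fin_representatives (hpos : ∀ x, x ≠ 0 → 0 < Q x x)
    (hε : ∀ i j, Q (ε i) (b j) = if i = j then 1 else 0)
    (hM : ∀ u ∈ M', u ∈ dualLattice Q N) :
    ∃ (m : ℕ) (ζ : Fin (m + 1) → V), (∀ k, ζ k ∈ dualLattice Q N) ∧
      ∀ z ∈ dualLattice Q N, ∃ k, ∃ u : M', z = ζ k + u := by
  obtain ⟨C, hC⟩ := ZLattice.exists_mem_norm_sub_le M'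
  let f : (Fin n → ℤ) → V := fun k => ∑ i, k i • ε i
  have hf : ∀ z ∈ dualLattice Q N, ∃ k : Fin n → ℤ, (∀ i, Q z (b i) = k i) ∧ f k = z := by
    intro z hz
    choose k hk using fun i => hz (b i) (b i).2
    refine ⟨k, hk, ?_⟩
    conv_rhs => rw [← sum_apply_smul_dual b hpos hε z]
    exact Finset.sum_congr rfl fun i _ => by rw [hk, Int.cast_smul_eq_zsmul]
  let Z : Set V := {z | z ∈ dualLattice Q N ∧ ‖z‖ ≤ C}
  have hfin : Z.Finite := by
    -- A dual vector of bounded norm has bounded integral coordinates `Q z (b i)`.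
    let q := ‖LinearMap.toContinuousBilinearMap Q‖
    let K : Fin n → ℤ := fun i => ⌈q * C * ‖(b i : V)‖⌉
    refine ((Set.finite_Icc (-K) K).image f).subset ?_
    rintro z ⟨hz, hzC⟩
    obtain ⟨k, hk, hkz⟩ := hf z hz
    have hbound : ∀ i, |(k i : ℝ)| ≤ K i := fun i => by
      rw [← hk]
      refine (((LinearMap.toContinuousBilinearMap Q).le_opNorm₂ z (b i)).trans ?_).trans
        (Int.le_ceil _)
      exact mul_le_mul_of_nonneg_right (mul_le_mul_of_nonneg_left hzC
        (ContinuousLinearMap.opNorm_nonneg _))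
        (norm_nonneg _)
    refine ⟨k, ⟨fun i => ?_, fun i => ?_⟩, hkz⟩
    · have := (abs_le.1 (hbound i)).1
      exact_mod_cast this
    · have := (abs_le.1 (hbound i)).2
      exact_mod_cast this
  have hrep : ∀ z ∈ dualLattice Q N, ∃ x ∈ Z, ∃ u : M', z = x + u := by
    intro z hz
    obtain ⟨u, hu, huC⟩ := hC z
    exact ⟨z - u, ⟨sub_mem hz (hM u hu), huC⟩, ⟨u, hu⟩, by simp⟩
  obtain ⟨m, ζ, -, hζ⟩ := hfin.fin_param
  obtain ⟨x, hx, -⟩ := hrep 0 (zero_mem _)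
  have hm : m ≠ 0 := by
    rintro rfl
    rw [← hζ] at hx
    obtain ⟨i, -⟩ := hx
    exact i.elim0
  obtain ⟨m, rfl⟩ := Nat.exists_eq_succ_of_ne_zero hm
  refine ⟨m, ζ, fun k => ?_, fun z hz => ?_⟩
  · have : ζ k ∈ Z := hζ ▸ mem_range_self k
    exact this.1
  · obtain ⟨x, hx, u, hu⟩ := hrep z hz
    rw [← hζ] at hx
    obtain ⟨k, rfl⟩ := hx
    exact ⟨k, u, hu⟩

theorem isPiecewiseZAffine_tropicalTheta (hs : ∀ x y, Q x y = Q y x)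
    (hpos : ∀ x, x ≠ 0 → 0 < Q x x) (hM : ∀ u ∈ M', u ∈ dualLattice Q N) {z : V}
    (hz : z ∈ dualLattice Q N) (p : Fin n → ℝ) :
    ∃ O, IsOpen O ∧ p ∈ O ∧ ∃ F, IsPiecewiseZAffine F ∧
      EqOn (fun y => tropicalTheta Q M' z ((b.ofZLatticeBasis ℝ N).equivFun.symm y)) F O := by
  have h0 : ∀ x, 0 ≤ Q x x := fun x => by
    by_cases hx : x = 0
    · simp [hx]
    · exact (hpos x hx).le
  let e := (b.ofZLatticeBasis ℝ N).equivFun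
  have hecont : Continuous e.symm := LinearMap.continuous_of_finiteDimensional e.symm.toLinearMap
  obtain ⟨S, hS⟩ := exists_finset_latticeDistSq_eq (M' := M') hs hpos z (e.symm p)
  have hne : S.Nonempty := by
    obtain ⟨u, hu, -⟩ := hS _ (Metric.mem_ball_self one_pos)
    exact ⟨u, hu⟩
  choose k hk using fun (u : M') (j : Fin n) => add_mem hz (hM u u.2) (b j) (b j).2
  let ℓ : M' → (Fin n → ℝ) → ℝ := fun u y =>
    (fun j => ((-k u j : ℤ) : ℝ)) ⬝ᵥ y + Q (z + u) (z + u) / 2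
  have hℓ : ∀ u y, ℓ u y = -(Q (z + u) (e.symm y)) + Q (z + u) (z + u) / 2 := fun u y => by
    rw [apply_equivFun_symm b (hk u)]
    simp only [ℓ, Int.cast_neg]
    rw [← neg_dotProduct]
    rfl
  refine ⟨e.symm ⁻¹' Metric.ball (e.symm p) 1, Metric.isOpen_ball.preimage hecont,
    Metric.mem_ball_self one_pos, fun y => S.inf' hne fun u => ℓ u y, ?_, fun y hy => ?_⟩
  · have : Nonempty S := hne.to_subtype
    refine isPiecewiseZAffine_of_min (ι := S) (fun u j => -k u j)
      (fun u => Q (z + u) (z + u) / 2) (fun y u => S.inf'_le (fun u => ℓ u y) u.2) fun y => ?_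
    obtain ⟨u, hu, h⟩ := S.exists_mem_eq_inf' hne fun u => ℓ u y
    exact ⟨⟨u, hu⟩, h⟩
  · obtain ⟨u, hu, h⟩ := hS _ hy
    refine le_antisymm (Finset.le_inf' _ _ fun w _ => ?_) ((S.inf'_le (fun u => ℓ u y) hu).trans ?_)
    · rw [hℓ]
      exact tropicalTheta_le hs h0 z _ w
    · rw [hℓ]
      exact (tropicalTheta_eq_of_latticeDistSq_eq hs h).ge

/-- Theta functions of a sufficiently fine dual lattice separate points modulo `M'`. -/
theorem sub_mem_of_latticeDistSq_sub_eq (hs : ∀ x y, Q x y = Q y x)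
    (hpos : ∀ x, x ≠ 0 → 0 < Q x x) (h0 : ∀ x, 0 ≤ Q x x)
    (hε : ∀ i j, Q (ε i) (b j) = if i = j then 1 else 0) {r : ℝ}
    (hr : ∀ u ∈ M', u ≠ 0 → r ≤ √(Q u u)) (hR : 4 * ∑ i, √(Q (ε i) (ε i)) < r) {v w : V}
    (h : ∀ x ∈ dualLattice Q N, ∀ y ∈ dualLattice Q N,
      latticeDistSq Q M' x v - latticeDistSq Q M' x w =
        latticeDistSq Q M' y v - latticeDistSq Q M' y w) : w - v ∈ M' := by
  set R := ∑ i, √(Q (ε i) (ε i)) with hRdef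
  have hR0 : 0 ≤ R := Finset.sum_nonneg fun i _ => Real.sqrt_nonneg _
  have hεR : ∀ i, √(Q (ε i) (ε i)) ≤ R := fun i =>
    Finset.single_le_sum (f := fun i => √(Q (ε i) (ε i))) (fun i _ => Real.sqrt_nonneg _)
      (Finset.mem_univ i)
  -- When `v` and a translate `w - u` both lie within `R` of `z`, the distances to the classes of
  -- `z` and `z + ε i` are attained at these points. Comparing them gives `Q v (ε i) = Q (w - u) (ε
  -- i)` for all `i`, hence `v = w - u`.
  have key : ∀ v w z : V, z ∈ dualLattice Q N → √(Q (v - z) (v - z)) ≤ R →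
      latticeDistSq Q M' z w ≤ R ^ 2 → (∀ x ∈ dualLattice Q N, ∀ y ∈ dualLattice Q N,
      latticeDistSq Q M' x v - latticeDistSq Q M' x w =
        latticeDistSq Q M' y v - latticeDistSq Q M' y w) → w - v ∈ M' := by
    intro v w z hz hv hw h
    obtain ⟨u, hu⟩ := exists_latticeDistSq_eq (M' := M') hs hpos z w
    have hw' : √(Q (w - u - z) (w - u - z)) ≤ R := by
      rw [hu, sub_right_comm] at hw
      exact Real.sqrt_le_iff.2 ⟨hR0, hw⟩
    have hwu : ∀ x, latticeDistSq Q M' x w = latticeDistSq Q M' x (w - u) := fun x => by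
      have := latticeDistSq_add_right (Q := Q) x (w - u) u
      rwa [sub_add_cancel] at this
    have hnear : ∀ v, √(Q (v - z) (v - z)) ≤ R → latticeDistSq Q M' z v = Q (v - z) (v - z) ∧
        ∀ i, latticeDistSq Q M' (z + ε i) v = Q (v - (z + ε i)) (v - (z + ε i)) := by
      intro v hv
      refine ⟨latticeDistSq_eq_self hs hpos h0 hr (by linarith), fun i =>
        latticeDistSq_eq_self hs hpos h0 hr ?_⟩
      have := sqrt_apply_self_add_le hs h0 (v - z) (-(ε i))
      rw [sqrt_apply_self_neg, ← sub_eq_add_neg, sub_sub] at this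
      linarith [hεR i]
    have hvw : v = w - u := by
      have h1 : ∀ i, Q v (ε i) = Q (w - u) (ε i) := by
        intro i
        have h2 := h z hz (z + ε i) (add_mem hz (dual_mem_dualLattice b hε i))
        rw [hwu, hwu, (hnear v hv).1, (hnear v hv).2, (hnear _ hw').1, (hnear _ hw').2] at h2
        rw [← sub_sub, ← sub_sub (w - u : V)] at h2
        have h3 : ∀ x y : V, Q (x - y) (x - y) = Q x x - 2 * Q x y + Q y y := fun x y => by
          simp only [map_sub, LinearMap.sub_apply, hs y x]
          ring
        rw [h3 (v - z) (ε i), h3 (w - u - z) (ε i)] at h2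
        have h4 : Q (v - z) (ε i) = Q (w - u - z) (ε i) := by linarith
        simp only [map_sub, LinearMap.sub_apply] at h4 ⊢
        linarith
      have h5 : Q (v - (w - u)) (v - (w - u)) = 0 := by
        have h6 : ∀ i, Q (v - (w - u)) (ε i) = 0 := fun i => by
          rw [map_sub, LinearMap.sub_apply, h1, sub_self]
        calc Q (v - (w - u)) (v - (w - u))
            = Q (v - (w - u)) (∑ i, Q (v - (w - u)) (b i) • ε i) := by
              rw [sum_apply_smul_dual b hpos hε]
          _ = 0 := by simp only [map_sum, map_smul, h6, smul_zero, Finset.sum_const_zero]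
      by_contra hne
      exact (hpos _ (sub_ne_zero.2 hne)).ne' h5
    rw [hvw, sub_sub_cancel]
    exact u.2
  obtain ⟨z, hz, hvz⟩ := exists_mem_dualLattice_sqrt_le b hs hpos h0 hε v
  obtain ⟨z', hz', hwz'⟩ := exists_mem_dualLattice_sqrt_le b hs hpos h0 hε w
  have h1 : latticeDistSq Q M' z v ≤ R ^ 2 :=
    (latticeDistSq_le_self h0 z v).trans (Real.sqrt_le_left hR0 |>.1 hvz)
  have h2 : latticeDistSq Q M' z' w ≤ R ^ 2 :=
    (latticeDistSq_le_self h0 z' w).trans (Real.sqrt_le_left hR0 |>.1 hwz')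
  have h3 := h z hz z' hz'
  -- If the class of `z` is far from `w`, equality of the differences makes the class of `z'` close
  -- to `v`, and the roles of `v` and `w` are exchanged.
  rcases le_total (latticeDistSq Q M' z w) (R ^ 2) with h4 | h4
  · exact key v w z hz hvz h4 h
  · have h5 : latticeDistSq Q M' z' v ≤ R ^ 2 := by linarith
    have := key w v z' hz' hwz' h5 fun x hx y hy => by linarith [h x hx y hy]
    rw [← neg_sub]
    exact neg_mem this

/-- On a cell where one candidate is smallest for each class, all theta functions are affine. These
candidates are true minimizers at any point of the cell in `W`, so
`exists_leftInverse_of_minimizers` applies to their slopes. -/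
theorem isUnimodularOn_tropicalTheta (hs : ∀ x y, Q x y = Q y x)
    (hpos : ∀ x, x ≠ 0 → 0 < Q x x) (h0 : ∀ x, 0 ≤ Q x x)
    (hε : ∀ i j, Q (ε i) (b j) = if i = j then 1 else 0)
    (hM : ∀ u ∈ M', u ∈ dualLattice Q N) {r : ℝ}
    (hr : ∀ u ∈ M', u ≠ 0 → r ≤ √(Q u u)) (hR : 4 * ∑ i, √(Q (ε i) (ε i)) < r)
    {m : ℕ} {ζ : Fin (m + 1) → V} (hζN : ∀ k, ζ k ∈ dualLattice Q N)
    (hζ : ∀ z ∈ dualLattice Q N, ∃ k, ∃ u : M', z = ζ k + u) (v₀ : V) {W : Set V}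
    (hW : W ⊆ Metric.ball v₀ 1) (hWo : IsOpen W) :
    IsUnimodularOn (fun y (i : Fin m) =>
      tropicalTheta Q M' (ζ i.succ) ((b.ofZLatticeBasis ℝ N).equivFun.symm y) -
        tropicalTheta Q M' (ζ 0) ((b.ofZLatticeBasis ℝ N).equivFun.symm y))
      ((b.ofZLatticeBasis ℝ N).equivFun.symm ⁻¹' W) := by
  let e := (b.ofZLatticeBasis ℝ N).equivFun
  have hecont : Continuous e.symm := LinearMap.continuous_of_finiteDimensional e.symm.toLinearMap
  obtain ⟨S, hS⟩ := exists_finset_latticeDistSq_eq_of_finite (M' := M') hs hpos ζ v₀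
  have hmin₀ := hS v₀ (Metric.mem_ball_self one_pos)
  have hne : Nonempty S := by
    obtain ⟨u, hu, -⟩ := hmin₀ 0
    exact ⟨⟨u, hu⟩⟩
  choose α hα using fun (k : Fin (m + 1)) (u : M') (j : Fin n) =>
    add_mem (hζN k) (hM u u.2) (b j) (b j).2
  let c : Fin (m + 1) → M' → ℝ := fun k u => Q (ζ k + u) (ζ k + u) / 2
  have hℓ : ∀ k u y, (fun j => ((-α k u j : ℤ) : ℝ)) ⬝ᵥ y + c k u =
      -(Q (ζ k + u) (e.symm y)) + Q (ζ k + u) (ζ k + u) / 2 := fun k u y => by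
    rw [apply_equivFun_symm b (hα k u)]
    simp only [Int.cast_neg, c]
    rw [← neg_dotProduct]
    rfl
  obtain ⟨C, hC, hC', hCmin⟩ := exists_complex_min (κ := Fin (m + 1)) (ι := S)
    (fun k u j => -α k u j) (fun k u => c k u)
  refine ⟨C, hC, ⟨_, hWo.preimage hecont, by rw [hC', inter_univ]⟩, fun σ hσ => ?_⟩
  have hF : ∀ (v : V) (u : Fin (m + 1) → M'),
      (∀ k, latticeDistSq Q M' (ζ k) v = Q (v - ζ k - u k) (v - ζ k - u k)) →
      IsUnimodularZAffine (zAffine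
        (Matrix.of (fun (i : Fin m) j => -α i.succ (u i.succ) j - -α 0 (u 0) j))
        (fun i => c i.succ (u i.succ) - c 0 (u 0))) := by
    intro v u hu
    obtain ⟨B, hB⟩ := exists_leftInverse_of_minimizers b hs hpos h0 hε hr hR hζ v u hu
      (fun k => α k (u k)) (fun k j => hα k (u k) j)
    exact isUnimodularZAffine_of_leftInverse _ B hB _
  rcases (σ ∩ e.symm ⁻¹' W).eq_empty_or_nonempty with hemp | ⟨y₀, hy₀σ, hy₀W⟩
  -- A cell missing `W` still needs some unimodular map; the minimizers at `v₀` provide one.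
  · choose u _ hu using hmin₀
    refine ⟨_, hF v₀ u hu, fun y hy => ?_⟩
    have : y ∈ σ ∩ e.symm ⁻¹' W := hy
    rw [hemp] at this
    exact this.elim
  · choose u hu using hCmin σ hσ
    have hval : ∀ k, ∀ y ∈ σ, e.symm y ∈ W → tropicalTheta Q M' (ζ k) (e.symm y) =
        (fun j => ((-α k (u k) j : ℤ) : ℝ)) ⬝ᵥ y + c k (u k) := by
      intro k y hyσ hyW
      obtain ⟨w, hwS, hw⟩ := hS _ (hW hyW) k
      refine le_antisymm ?_ ?_
      · rw [hℓ]
        exact tropicalTheta_le hs h0 _ _ _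
      · refine (hu k ⟨w, hwS⟩ y hyσ).trans ?_
        rw [hℓ]
        exact (tropicalTheta_eq_of_latticeDistSq_eq hs hw).ge
    refine ⟨_, hF (e.symm y₀) (fun k => u k) fun k => ?_, fun y hy => ?_⟩
    · have h1 := hval k y₀ hy₀σ hy₀W
      rw [hℓ, ← half_sub_eq hs, tropicalTheta] at h1
      linarith
    · ext i
      show tropicalTheta Q M' (ζ i.succ) (e.symm y) - tropicalTheta Q M' (ζ 0) (e.symm y) =
        (fun j => ((-α i.succ (u i.succ) j - -α 0 (u 0) j : ℤ) : ℝ)) ⬝ᵥ y +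
          (c i.succ (u i.succ) - c 0 (u 0))
      rw [hval _ y hy.1 hy.2, hval _ y hy.1 hy.2]
      have : (fun j => ((-α i.succ (u i.succ) j - -α 0 (u 0) j : ℤ) : ℝ)) =
          (fun j => ((-α i.succ (u i.succ) j : ℤ) : ℝ)) - fun j => ((-α 0 (u 0) j : ℤ) : ℝ) := by
        ext j
        push_cast
        rfl
      rw [this, sub_dotProduct]
      ring

end FineTheta

/-! ### A multiple of the polarization gives a faithful embedding. -/

section FaithfulEmbedding

theorem exists_norm_lower_bound {E : Type*} [NormedAddCommGroup E] (M' : Submodule ℤ E)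
    [DiscreteTopology M'] :
    ∃ δ > 0, ∀ u ∈ M', u ≠ 0 → δ ≤ ‖u‖ := by
  have h : {(0 : M')} ∈ 𝓝 (0 : M') := (isOpen_discrete _).mem_nhds rfl
  obtain ⟨δ, hδ, hb⟩ := Metric.mem_nhds_iff.1 h
  refine ⟨δ, hδ, fun u hu hne => ?_⟩
  by_contra! hlt
  have : (⟨u, hu⟩ : M') ∈ Metric.ball (0 : M') δ := by
    rw [mem_ball_zero_iff]
    exact hlt
  exact hne (congrArg Subtype.val (hb this))

variable {V : Type u} [NormedAddCommGroup V] [NormedSpace ℝ V] [FiniteDimensional ℝ V]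
  {Q : LinearMap.BilinForm ℝ V} {N M' : Submodule ℤ V} [DiscreteTopology N] [IsZLattice ℝ N]
  [DiscreteTopology M'] [IsZLattice ℝ M']

/-- If the dual lattice of `N` is sufficiently fine with respect to `M'`, then the theta functions
of all its classes modulo `M'` define a faithful embedding. -/
theorem exists_admitsFaithfulEmbedding_of_fine {n : ℕ} (b : Module.Basis (Fin n) ℤ N)
    {ε : Fin n → V} (hs : ∀ x y, Q x y = Q y x) (hpos : ∀ x, x ≠ 0 → 0 < Q x x)
    (hε : ∀ i j, Q (ε i) (b j) = if i = j then 1 else 0)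
    (hM : ∀ u ∈ M', u ∈ dualLattice Q N) {r : ℝ}
    (hr : ∀ u ∈ M', u ≠ 0 → r ≤ √(Q u u)) (hR : 4 * ∑ i, √(Q (ε i) (ε i)) < r) :
    ∃ L : TropicalLineBundle (RealTorus N M'), L.AdmitsFaithfulEmbedding := by
  have h0 : ∀ x, 0 ≤ Q x x := fun x => by
    by_cases hx : x = 0
    · simp [hx]
    · exact (hpos x hx).le
  obtain ⟨m, ζ, hζN, hζ⟩ := exists_fin_representatives b hpos hε hM
  have hcont : Continuous (tropicalTheta Q M' (ζ 0)) :=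
    continuousOn_univ.1 ((concaveOn_tropicalTheta hs hpos (ζ 0)).continuousOn isOpen_univ)
  have hper : ∀ u ∈ M', ∃ (k : Fin n → ℤ) (c : ℝ), ∀ y,
      tropicalTheta Q M' (ζ 0) ((b.ofZLatticeBasis ℝ N).equivFun.symm y + u) =
        tropicalTheta Q M' (ζ 0) ((b.ofZLatticeBasis ℝ N).equivFun.symm y) +
          ((fun j => (k j : ℝ)) ⬝ᵥ y + c) := by
    intro u hu
    choose k hk using fun j => hM u hu (b j) (b j).2
    refine ⟨-k, -(Q u u / 2), fun y => ?_⟩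
    have : (fun j => ((-k) j : ℝ)) = -fun j => (k j : ℝ) := by
      ext j
      simp
    rw [tropicalTheta_add hs _ _ hu, apply_equivFun_symm b hk, this, neg_dotProduct]
    ring
  refine ⟨_, RealTorus.admitsFaithfulEmbedding_twistedBundle b hcont hper
    (fun k => tropicalTheta Q M' (ζ k)) (fun k u hu v => tropicalTheta_add_sub _ _ v hu)
    (fun k => concaveOn_tropicalTheta hs hpos _)
    (fun k p => isPiecewiseZAffine_tropicalTheta b hs hpos hM (hζN k) p) (fun v w h => ?_)
    (fun v => ⟨Metric.ball v 1, Metric.isOpen_ball, Metric.mem_ball_self one_pos, fun W hW hWo =>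
      isUnimodularOn_tropicalTheta b hs hpos h0 hε hM hr hR hζN hζ v hW hWo⟩)⟩
  refine sub_mem_of_latticeDistSq_sub_eq b hs hpos h0 hε hr hR fun x hx y hy => ?_
  have key : ∀ x ∈ dualLattice Q N, latticeDistSq Q M' x v - latticeDistSq Q M' x w =
      latticeDistSq Q M' (ζ 0) v - latticeDistSq Q M' (ζ 0) w := by
    intro x hx
    obtain ⟨k, u, rfl⟩ := hζ x hx
    have := h k
    simp only [tropicalTheta] at this
    rw [latticeDistSq_add_left, latticeDistSq_add_left]
    linarith
  rw [key x hx, key y hy]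

/-- Definiteness makes `Q` an isomorphism onto the dual space, through which the coordinate
functionals are represented. -/
theorem exists_dual_family (hpos : ∀ x, x ≠ 0 → 0 < Q x x) {n : ℕ}
    (b : Module.Basis (Fin n) ℤ N) :
    ∃ ε : Fin n → V, ∀ i j, Q (ε i) (b j) = if i = j then 1 else 0 := by
  have hinj : Function.Injective Q := by
    rw [injective_iff_map_eq_zero]
    intro x hx
    by_contra hne
    have := hpos x hne
    simp [hx] at this
  have hsurj : Function.Surjective Q :=
    (LinearMap.injective_iff_surjective_of_finrank_eq_finrank
      Subspace.dual_finrank_eq.symm).1 hinj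
  choose ε hε using fun i => hsurj ((b.ofZLatticeBasis ℝ N).coord i)
  refine ⟨ε, fun i j => ?_⟩
  rw [hε, ← b.ofZLatticeBasis_apply ℝ N, Module.Basis.coord_apply, Module.Basis.repr_self,
    Finsupp.single_apply]
  exact if_congr eq_comm rfl rfl

/-- A high multiple of a polarization gives a line bundle with a faithful embedding. -/
theorem exists_admitsFaithfulEmbedding (h : IsTropicalAbelianVariety N M') :
    ∃ L : TropicalLineBundle (RealTorus N M'), L.AdmitsFaithfulEmbedding := by
  obtain ⟨lam, Q, hs, hlam, hpos⟩ := h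
  have : Module.Finite ℤ N := ZLattice.module_finite ℝ N
  have : Module.Free ℤ N := ZLattice.module_free ℝ N
  let b := Module.finBasis ℤ N
  obtain ⟨ε, hε⟩ := exists_dual_family hpos b
  obtain ⟨δ, hδ, hδM⟩ := exists_norm_lower_bound M'
  obtain ⟨α, hα, hαQ⟩ := exists_le_sqrt_apply_self hpos
  -- For `k • Q` the lengths on `M'` grow by `√k`, while the dual basis becomes `k⁻¹ • ε` and its
  -- lengths shrink by `√k`. The bound on `k` is exactly the fineness condition `hR` for `r = √k *
  -- (α * δ)`.
  obtain ⟨k, hk⟩ := exists_nat_gt (4 * (∑ i, √(Q (ε i) (ε i))) / (α * δ))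
  have hk0 : (0 : ℝ) < k := lt_of_le_of_lt (by positivity) hk
  have hk1 : 4 * (∑ i, √(Q (ε i) (ε i))) < k * (α * δ) := (div_lt_iff₀ (by positivity)).1 hk
  have hsk : 0 < √(k : ℝ) := Real.sqrt_pos.2 hk0
  refine exists_admitsFaithfulEmbedding_of_fine (Q := (k : ℝ) • Q) b
    (ε := fun i => (k : ℝ)⁻¹ • ε i) (r := √k * (α * δ)) (fun x y => ?_) (fun x hx => ?_)
    (fun i j => ?_) (fun u hu v hv => ?_) (fun u hu hne => ?_) ?_
  · simp [hs x y]
  · simpa using mul_pos hk0 (hpos x hx)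
  · simp [hε, hk0.ne']
  · refine ⟨k * lam ⟨u, hu⟩ ⟨v, hv⟩, ?_⟩
    have := hlam ⟨u, hu⟩ ⟨v, hv⟩
    simp only at this
    simp [this]
  · simp only [LinearMap.smul_apply, smul_eq_mul]
    rw [Real.sqrt_mul hk0.le]
    exact mul_le_mul_of_nonneg_left
      ((mul_le_mul_of_nonneg_left (hδM u hu hne) hα.le).trans (hαQ u)) hsk.le
  · have hterm : ∀ i, √(((k : ℝ) • Q) ((k : ℝ)⁻¹ • ε i) ((k : ℝ)⁻¹ • ε i)) =
        (√(k : ℝ))⁻¹ * √(Q (ε i) (ε i)) := fun i => by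
      simp only [LinearMap.smul_apply, map_smul, smul_eq_mul]
      rw [← Real.sqrt_inv, ← Real.sqrt_mul (inv_nonneg.2 hk0.le)]
      congr 1
      field_simp
    simp only [hterm]
    rw [← Finset.mul_sum]
    refine lt_of_mul_lt_mul_left ?_ hsk.le
    calc √(k : ℝ) * (4 * ((√(k : ℝ))⁻¹ * ∑ i, √(Q (ε i) (ε i))))
        = (√(k : ℝ) * (√(k : ℝ))⁻¹) * (4 * ∑ i, √(Q (ε i) (ε i))) := by ring
      _ = 4 * ∑ i, √(Q (ε i) (ε i)) := by rw [mul_inv_cancel₀ hsk.ne', one_mul]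
      _ < k * (α * δ) := hk1
      _ = √(k : ℝ) * (√k * (α * δ)) := by
        rw [← mul_assoc (√(k : ℝ)), Real.mul_self_sqrt hk0.le]

end FaithfulEmbedding

/-- For a real torus `X = V / M'` with integral structure `N`, the following are equivalent:
`X` is a tropical abelian variety; some tropical line bundle on `X` admits a faithful embedding;
finitely many nontrivial regular sections of some tropical line bundle on `X` define an injective
map to a tropical projective space. -/
theorem mainTheorem3 {V : Type*} [NormedAddCommGroup V] [NormedSpace ℝ V] [FiniteDimensional ℝ V]
    (N M' : Submodule ℤ V) [DiscreteTopology N] [IsZLattice ℝ N]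
    [DiscreteTopology M'] [IsZLattice ℝ M'] :
    List.TFAE [
      IsTropicalAbelianVariety N M',
      ∃ L : TropicalLineBundle (RealTorus N M'), L.AdmitsFaithfulEmbedding,
      ∃ (L : TropicalLineBundle (RealTorus N M')) (m : ℕ)
        (s : Fin (m + 1) → L.nontrivialRegularSections), Function.Injective (L.toTP s)] := by
  tfae_have 1 → 2 := exists_admitsFaithfulEmbedding
  tfae_have 2 → 3 := fun ⟨L, m, s, h⟩ => ⟨L, m, s, h.2.injective⟩
  tfae_have 3 → 1 := fun ⟨L, _, s, h⟩ => L.isTropicalAbelianVariety_of_injective s h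
  tfae_finish
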